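/- Let $n\ge 2$. Write $e^{(1)},\dots,e^{(n)}$ for the unit vectors of $\mathbb{R}^n$ and set $e^{(n+1)}:=-\sum_{i=1}^n e^{(i)}$. A (non-degenerate) tropical line $L$ in $\mathbb{R}^n$ is a trivalent tree with $n+1$ leaves labelled $1,\dots,n+1$, embedded in $\mathbb{R}^n$ as a balanced rational graph: its inner vertices are points of $\mathbb{R}^n$; the edge at the leaf $i$ is a half-ray in direction $e^{(i)}$; each bounded edge is a segment of positive length with an integral direction vector (reversing the edge changes its sign); and at each inner vertex the outgoing direction vectors (with $e^{(i)}$ for the half-rays) sum to $0$. Its faces are its vertices, its bounded segments and its half-rays (all closed). $L$ is a caterpillar if this tree (leaves included) has diameter $n$. A rational projection $\pi:\mathbb{R}^n\to\mathbb{R}^2$ is a map $x\mapsto Ax$ with $A\in\mathbb{Q}^{2\times n}$ of rank $2$. A self-intersection point of $L$ under $\pi$ is a point $a\in\mathbb{R}^2$ with $\pi(F_1)\cap\pi(F_2)=\{a\}$ for two non-adjacent (that is, disjoint) faces $F_1,F_2$ of $L$. (a) For every tropical caterpillar line $L$ in $\mathbb{R}^n$ and every rational projection $\pi:\mathbb{R}^n\to\mathbb{R}^2$,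 there are at most $\sum_{i=1}^{n-2} i=\binom{n-1}{2}$ self-intersection points of $L$ under $\pi$. (b) This bound is attained: there are a tropical caterpillar line $L$ in $\mathbb{R}^n$ and a rational projection $\pi:\mathbb{R}^n\to\mathbb{R}^2$ with exactly $\binom{n-1}{2}$ self-intersection points. Moreover, $L$ can be taken to be a tropical variety $L=\mathcal{T}(I)=\bigcap_{f\in I}\mathcal{T}(f)$, where $I\subset K[x_1,\dots,x_n]$ is the ideal of an affine line $\{a+tb\}$ ($a,b\in K^n$, $b\neq 0$; $I$ consists of the $f$ with $f(a+tb)=0$ in $K[t]$) over some field $K$ with a real valuation $\mathrm{val}:K\to\mathbb{R}\cup\{\infty\}$, and $\mathcal{T}(f)$ is the set of $w\in\mathbb{R}^n$ at which $\min_\alpha(\mathrm{val}(c_\alpha)+\alpha\cdot w)$, over the monomials $c_\alpha x^\alpha$ of $f$, is attained at least twice (and $\mathcal{T}(0)=\mathbb{R}^n$). -/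

import Mathlib

open scoped Polynomial

/-! ### Tropical varieties -/

/-- The tropical hypersurface `T(f)`: the points `w` at which the minimum over the monomials
`c_α x^α` of `f` of `val(c_α) + α ⬝ w` is attained at least twice. (`T(0)` is the whole space.) -/
def tropicalHypersurface {n : ℕ} {K : Type*} [Field K] (v : AddValuation K (WithTop ℝ))
    (f : MvPolynomial (Fin n) K) : Set (Fin n → ℝ) :=
  {w | f ≠ 0 → ∃ α ∈ f.support, ∃ β ∈ f.support, α ≠ β ∧
    (∀ γ ∈ f.support, v (f.coeff α) + ((∑ i, (α i : ℝ) * w i : ℝ) : WithTop ℝ)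
      ≤ v (f.coeff γ) + ((∑ i, (γ i : ℝ) * w i : ℝ) : WithTop ℝ)) ∧
    (∀ γ ∈ f.support, v (f.coeff β) + ((∑ i, (β i : ℝ) * w i : ℝ) : WithTop ℝ)
      ≤ v (f.coeff γ) + ((∑ i, (γ i : ℝ) * w i : ℝ) : WithTop ℝ))}

/-- The tropical variety `T(I)`: the intersection of the tropical hypersurfaces of all `f ∈ I`. -/
def tropicalVariety {n : ℕ} {K : Type*} [Field K] (v : AddValuation K (WithTop ℝ))
    (I : Ideal (MvPolynomial (Fin n) K)) : Set (Fin n → ℝ) :=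
  ⋂ f ∈ I, tropicalHypersurface v f

/-- The ideal of the parametrized affine line `t ↦ a + t b` in `Kⁿ` (a line when `b ≠ 0`): the
polynomials `f` with `f(a + t b) = 0` identically in `t`. -/
noncomputable def lineIdeal {n : ℕ} {K : Type*} [Field K] (a b : Fin n → K) :
    Ideal (MvPolynomial (Fin n) K) :=
  RingHom.ker (MvPolynomial.aeval (R := K)
    (fun i => (Polynomial.C (a i) + Polynomial.C (b i) * Polynomial.X : K[X])))

/-! ### Tropical lines -/

/-- The directions of the `n + 1` half-rays of a tropical line in `ℝⁿ`: the unit vectors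
`e⁽¹⁾, …, e⁽ⁿ⁾` (for the labels `0, …, n - 1`) and `-∑ e⁽ⁱ⁾` (for the last label `n`). -/
def rayDirection {n : ℕ} (i : Fin (n + 1)) : Fin n → ℤ :=
  Fin.lastCases (motive := fun _ => Fin n → ℤ) (fun _ => -1) (fun j => Pi.single j 1) i

/-- A non-degenerate tropical line in `ℝⁿ`: a trivalent tree with `n + 1` leaves labelled by
`Fin (n + 1)` and inner vertices `V`, embedded in `ℝⁿ` with rational slopes as a balanced graph.
The leaf `i` stands for the unbounded end of the half-ray in direction `rayDirection i`. -/
structure TropicalLine (n : ℕ) (V : Type*) [Fintype V] where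
  /-- the combinatorial type -/
  graph : SimpleGraph (V ⊕ Fin (n + 1))
  isTree : graph.IsTree
  trivalent : ∀ u : V, (graph.neighborSet (Sum.inl u)).ncard = 3
  leaf : ∀ i : Fin (n + 1), (graph.neighborSet (Sum.inr i)).ncard = 1
  /-- the positions of the inner vertices in `ℝⁿ` -/
  pos : V → Fin n → ℝ
  /-- the integral direction vector of the edge from `x` to `y`, oriented from `x` to `y`
  (and zero if `x` and `y` do not span an edge) -/
  slope : V ⊕ Fin (n + 1) → V ⊕ Fin (n + 1) → Fin n → ℤ
  slope_of_not_adj : ∀ x y, ¬ graph.Adj x y → slope x y = 0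
  slope_symm : ∀ x y, slope y x = -slope x y
  slope_ray : ∀ u i, graph.Adj (Sum.inl u) (Sum.inr i) →
    slope (Sum.inl u) (Sum.inr i) = rayDirection i
  /-- the balancing condition -/
  balanced : ∀ u : V, ∑ x, slope (Sum.inl u) x = 0
  /-- every bounded edge is a segment of positive length in its direction -/
  bounded_edge : ∀ u w, graph.Adj (Sum.inl u) (Sum.inl w) →
    ∃ l : ℝ, 0 < l ∧ pos w = pos u + l • (fun k => (slope (Sum.inl u) (Sum.inl w) k : ℝ))

namespace TropicalLine

variable {n : ℕ} {V : Type*} [Fintype V]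

/-- A tropical line is a caterpillar if the graph of its combinatorial type has diameter `n`. -/
def IsCaterpillar (L : TropicalLine n V) : Prop :=
  L.graph.diam = n

/-- The closed half-ray of `L` with label `i` emanating from the inner vertex `u`. -/
def halfRay (L : TropicalLine n V) (u : V) (i : Fin (n + 1)) : Set (Fin n → ℝ) :=
  {x | ∃ t : ℝ, 0 ≤ t ∧ x = L.pos u + t • (fun k => (rayDirection i k : ℝ))}

/-- The faces of `L` as a polyhedral complex in `ℝⁿ`: its vertices, its bounded segments and its
half-rays (all of them closed). -/
inductive IsFace (L : TropicalLine n V) : Set (Fin n → ℝ) → Prop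
  | vertex (u : V) : IsFace L {L.pos u}
  | boundedEdge (u w : V) (h : L.graph.Adj (Sum.inl u) (Sum.inl w)) :
      IsFace L (segment ℝ (L.pos u) (L.pos w))
  | ray (u : V) (i : Fin (n + 1)) (h : L.graph.Adj (Sum.inl u) (Sum.inr i)) :
      IsFace L (L.halfRay u i)

/-- The tropical line as a subset of `ℝⁿ`. -/
def support (L : TropicalLine n V) : Set (Fin n → ℝ) :=
  {x | ∃ F, L.IsFace F ∧ x ∈ F}

/-- `L` is the tropical variety of the ideal of an affine line in `Kⁿ`, for some field `K` with a
real valuation. -/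
def IsTropicalization (L : TropicalLine n V) : Prop :=
  ∃ (K : Type) (_ : Field K) (v : AddValuation K (WithTop ℝ)) (a b : Fin n → K),
    b ≠ 0 ∧ L.support = tropicalVariety v (lineIdeal a b)

end TropicalLine

/-! ### Projections and self-intersections -/

/-- The map `ℝⁿ → ℝ²`, `x ↦ A x` of a rational matrix `A`; it is a rational projection when `A` has
rank `2`. -/
def rationalMap {n : ℕ} (A : Matrix (Fin 2) (Fin n) ℚ) (x : Fin n → ℝ) : Fin 2 → ℝ :=
  (A.map (fun q : ℚ => (q : ℝ))).mulVec x

/-- The self-intersection points of `L` under `x ↦ A x`: the points in which the images of two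
non-adjacent (that is, disjoint) faces of `L` intersect. -/
def TropicalLine.selfIntersectionPoints {n : ℕ} {V : Type*} [Fintype V] (L : TropicalLine n V)
    (A : Matrix (Fin 2) (Fin n) ℚ) : Set (Fin 2 → ℝ) :=
  {p | ∃ F G, L.IsFace F ∧ L.IsFace G ∧ Disjoint F G ∧
    (rationalMap A '' F) ∩ (rationalMap A '' G) = {p}}

/-! ### Rays crossing a tripod in the plane -/

/-! Upper bound. Put N = n - 1. A longest path of the tree runs through all N inner vertices, so the
image of the line is a chain of N vertices in the plane, each carrying a backward, a sideways and a
forward edge whose directions sum to zero (`exists_spine`, `exists_planeCaterpillar`). For i < j,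
combine the backward and the sideways edge at i with the sideways and the forward edge at j. This
lists every pair of non-adjacent edges exactly once, four for each pair of vertices, and it has to
be shown that on balance a pair of vertices accounts for at most one point.

One copy of the curve is translated by a small generic vector, so that only transversal crossings
remain. A bounded edge is the difference of two parallel rays; summed over the chain the crossing
numbers telescope, and what is left at the vertex i are three full rays, its walls: `-dir i` and
`ray i` counted positively, and their sum `-dir (i + 1)` counted negatively. Now let i be fixed and
follow the chain from i + 1 on. The negative wall separates the positive ones, so the crossings of a
ray with the walls alternate in sign. Hence the crossings along an edge are bounded by the drop of a
potential, which is 1 if the next crossing is positive and 0 otherwise (`wallCount_sub_le`). From a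
given point the directions of potential 1 form a convex cone, and `dir j = ray j + dir (j + 1)`; so
the rise of the potential at the vertex j plus the crossings of its ray, called `gain`, is at most 1
(`gain_le_one`). Summation over i < j gives `N.choose 2`.

A point where two disjoint faces meet survives the shift as a crossing if the edges involved span
the plane, because a balanced star cannot be pulled off an edge or another star without crossing it
(`exists_hit_of_stars`). The remaining points are vertices whose star is flattened into a line. They
are paid for by pairs of vertices with non-positive gain, of which there are at least as many
(`card_flat_le`, `gain_nonpos_of_coincident`); `card_meeting_le` adds everything up.

Sharpness. The line (T^0 + t, ..., T^(N-1) + t, t) over a Hahn series field tropicalizes to an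
explicit caterpillar. A projection is chosen for which the N sideways rays lie on the lines p 0 + k
* p 1 = f(k) with f convex and steep: any two of the rays meet, and no three of the lines are
concurrent (`not_concurrent`). -/

/-- The signed number of crossings of the ray from `(α, β)` in direction `(ρ, σ)` with the
positive coordinate half-axes (counted positively) and the diagonal ray (counted negatively). -/
noncomputable def tripodCount (α β ρ σ : ℝ) : ℤ :=
  (if 0 < (α * σ - β * ρ) / σ ∧ 0 < -β / σ then 1 else 0)
  + (if 0 < (α * σ - β * ρ) / -ρ ∧ 0 < α / -ρ then 1 else 0)
  - (if 0 < (α * σ - β * ρ) / (σ - ρ) ∧ 0 < (α - β) / (σ - ρ) then 1 else 0)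

/-- The ray from `(α, β)` in direction `(ρ, σ)` meets one of the positive coordinate half-axes
before it meets the diagonal ray. -/
def FirstHit (α β ρ σ : ℝ) : Prop :=
  (0 < α ∧ 0 < β ∧ β < α ∧ σ < 0 ∧ α * σ - β * ρ < 0) ∨
  (0 < α ∧ 0 < β ∧ α < β ∧ ρ < 0 ∧ 0 < α * σ - β * ρ) ∨
  (0 < α ∧ β < 0 ∧ 0 < α * σ - β * ρ ∧ 0 < σ) ∨
  (α < 0 ∧ 0 < β ∧ α * σ - β * ρ < 0 ∧ 0 < ρ) ∨
  (α < 0 ∧ β < 0 ∧ 0 < ρ ∧ 0 < σ)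

/-- The five cases belong to disjoint regions of the starting point, and in each region the
condition on (ρ, σ) is a pair of homogeneous linear inequalities. So the admissible directions at a
given point form a convex cone. -/
theorem FirstHit.add {α β ρ σ ρ' σ' : ℝ} (h : FirstHit α β ρ σ) (h' : FirstHit α β ρ' σ') :
    FirstHit α β (ρ + ρ') (σ + σ') := by
  unfold FirstHit at *
  rcases h with h | h | h | h | h <;> rcases h' with h' | h' | h' | h' | h' <;>
    first
    | (exfalso; linarith [h.1, h.2.1, h.2.2.1, h'.1, h'.2.1, h'.2.2.1])
    | skip
  · exact Or.inl ⟨h.1, h.2.1, h.2.2.1, by linarith, by linarith⟩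
  · exact Or.inr (Or.inl ⟨h.1, h.2.1, h.2.2.1, by linarith, by linarith⟩)
  · exact Or.inr (Or.inr (Or.inl ⟨h.1, h.2.1, by linarith, by linarith⟩))
  · exact Or.inr (Or.inr (Or.inr (Or.inl ⟨h.1, h.2.1, by linarith, by linarith⟩)))
  · exact Or.inr (Or.inr (Or.inr (Or.inr ⟨h.1, h.2.1, by linarith, by linarith⟩)))

theorem FirstHit.swap {α β ρ σ : ℝ} : FirstHit β α σ ρ ↔ FirstHit α β ρ σ := by
  unfold FirstHit
  constructor <;>
  · rintro (h | h | h | h | h)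
    · exact Or.inr (Or.inl ⟨h.2.1, h.1, h.2.2.1, h.2.2.2.1, by linarith [h.2.2.2.2]⟩)
    · exact Or.inl ⟨h.2.1, h.1, h.2.2.1, h.2.2.2.1, by linarith [h.2.2.2.2]⟩
    · exact Or.inr (Or.inr (Or.inr (Or.inl ⟨h.2.1, h.1, by linarith [h.2.2.1], h.2.2.2⟩)))
    · exact Or.inr (Or.inr (Or.inl ⟨h.2.1, h.1, by linarith [h.2.2.1], h.2.2.2⟩))
    · exact Or.inr (Or.inr (Or.inr (Or.inr ⟨h.2.1, h.1, h.2.2.2, h.2.2.1⟩)))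

theorem tripodCount_swap (α β ρ σ : ℝ) : tripodCount β α σ ρ = tripodCount α β ρ σ := by
  unfold tripodCount
  have h1 : (β * ρ - α * σ) / ρ = (α * σ - β * ρ) / -ρ := by rw [div_neg, ← neg_div]; ring
  have h2 : -α / ρ = α / -ρ := by rw [div_neg, ← neg_div]
  have h3 : (β * ρ - α * σ) / -σ = (α * σ - β * ρ) / σ := by rw [div_neg, ← neg_div]; ring
  have h4 : β / -σ = -β / σ := by rw [div_neg, ← neg_div]
  have h5 : (β * ρ - α * σ) / (ρ - σ) = (α * σ - β * ρ) / (σ - ρ) := by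
    rw [← neg_sub σ ρ, div_neg, ← neg_div]; ring
  have h6 : (β - α) / (ρ - σ) = (α - β) / (σ - ρ) := by
    rw [← neg_sub σ ρ, div_neg, ← neg_div]; ring
  rw [h1, h2, h3, h4, h5, h6]; ring

theorem pos_div_and {c x y : ℝ} (hc : 0 < c) : (0 < c / y ∧ 0 < x / y) ↔ (0 < y ∧ 0 < x) := by
  constructor
  · rintro ⟨h, h'⟩
    have hy : 0 < y := by
      rcases div_pos_iff.1 h with h | h
      · exact h.2
      · exact absurd h.1 (by linarith)
    exact ⟨hy, by rcases div_pos_iff.1 h' with h | h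
                  · exact h.1
                  · linarith [h.2]⟩
  · rintro ⟨h, h'⟩
    exact ⟨div_pos hc h, div_pos h' h⟩

theorem tripodCount_of_pos {α β ρ σ : ℝ} (hc : 0 < α * σ - β * ρ) :
    tripodCount α β ρ σ = (if 0 < σ ∧ β < 0 then 1 else 0) + (if ρ < 0 ∧ 0 < α then 1 else 0)
      - (if ρ < σ ∧ β < α then 1 else 0) := by
  unfold tripodCount
  simp only [pos_div_and hc, neg_pos, sub_pos]

/-- A ray with positive determinant turns counterclockwise about the origin. It meets the first
half-axis, the diagonal and the second half-axis in this order, as far as it meets them at all. -/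
theorem firstHit_iff_of_pos {α β ρ σ : ℝ} (hc : 0 < α * σ - β * ρ) (hα : α ≠ 0)
    (hαβ : α ≠ β) :
    FirstHit α β ρ σ ↔ (0 < σ ∧ β < 0) ∨ ((ρ < 0 ∧ 0 < α) ∧ ¬ (ρ < σ ∧ β < α)) := by
  unfold FirstHit
  constructor
  · rintro (h | h | h | h | h)
    · linarith [h.2.2.2.2]
    · exact Or.inr ⟨⟨h.2.2.2.1, h.1⟩, fun h' => by linarith [h'.2, h.2.2.1]⟩
    · exact Or.inl ⟨h.2.2.2, h.2.1⟩
    · linarith [h.2.2.1]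
    · exact Or.inl ⟨h.2.2.2, h.2.1⟩
  · rintro (⟨h, h'⟩ | ⟨⟨h, h'⟩, h''⟩)
    · rcases lt_or_gt_of_ne hα with ha | ha
      · right; right; right; right
        refine ⟨ha, h', ?_, h⟩
        by_contra hr
        push Not at hr
        nlinarith [mul_neg_of_neg_of_pos ha h, mul_nonneg_of_nonpos_of_nonpos h'.le hr]
      · exact Or.inr (Or.inr (Or.inl ⟨ha, h', hc, h⟩))
    · rcases lt_or_gt_of_ne hαβ with hab | hab
      · exact Or.inr (Or.inl ⟨h', by linarith, hab, h, hc⟩)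
      · exfalso
        have hs : σ ≤ ρ := by
          by_contra hs; push Not at hs; exact h'' ⟨hs, hab⟩
        nlinarith [mul_le_mul_of_nonneg_left hs h'.le, mul_neg_of_pos_of_neg (sub_pos.2 hab) h]

/-- P, Q and M stand for the first half-axis, the second one and the diagonal lying ahead of a point
on the ray; the primed versions refer to a later point. Hits ahead can only get lost, a ray through
both half-axes meets the diagonal between them, and the second half-axis cannot be passed before the
diagonal. -/
theorem indicator_sub_le_aux {P Q M P' Q' M' : Prop} [Decidable P] [Decidable Q] [Decidable M]
    [Decidable P'] [Decidable Q'] [Decidable M'] [Decidable (P ∨ Q ∧ ¬ M)]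
    [Decidable (P' ∨ Q' ∧ ¬ M')] (hP : P' → P) (hQ : Q' → Q) (hM : M' → M) (hPQ : P → Q → M)
    (hPQ' : P' → Q' → M') (hMQ : M' → Q → Q') :
    ((if P then 1 else 0) + (if Q then 1 else 0) - (if M then 1 else 0) : ℤ)
      - ((if P' then 1 else 0) + (if Q' then 1 else 0) - (if M' then 1 else 0))
      ≤ (if P ∨ Q ∧ ¬ M then 1 else 0) - (if P' ∨ Q' ∧ ¬ M' then 1 else 0) := by
  by_cases P <;> by_cases Q <;> by_cases M <;> by_cases P' <;> by_cases Q' <;> by_cases M' <;>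
    simp_all

theorem indicator_le_aux {P Q M : Prop} [Decidable P] [Decidable Q] [Decidable M]
    [Decidable (P ∨ Q ∧ ¬ M)] (hPQ : P → Q → M) :
    ((if P then 1 else 0) + (if Q then 1 else 0) - (if M then 1 else 0) : ℤ)
      ≤ (if P ∨ Q ∧ ¬ M then 1 else 0) := by
  by_cases P <;> by_cases Q <;> by_cases M <;> simp_all

-- Crossings alternate in sign along a ray. Those lost between the two points therefore add up to at
-- most the drop of the indicator "the next crossing is positive".
open Classical in
theorem tripodCount_sub_le_of_pos {α β ρ σ T : ℝ} (hT : 0 < T) (hc : 0 < α * σ - β * ρ)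
    (hα : α ≠ 0) (hαβ : α ≠ β) (hα' : α + T * ρ ≠ 0) (hαβ' : α + T * ρ ≠ β + T * σ) :
    tripodCount α β ρ σ - tripodCount (α + T * ρ) (β + T * σ) ρ σ ≤
      (if FirstHit α β ρ σ then 1 else 0)
        - (if FirstHit (α + T * ρ) (β + T * σ) ρ σ then 1 else 0) := by
  have hc' : 0 < (α + T * ρ) * σ - (β + T * σ) * ρ := by
    have : (α + T * ρ) * σ - (β + T * σ) * ρ = α * σ - β * ρ := by ring
    rwa [this]
  rw [tripodCount_of_pos hc, tripodCount_of_pos hc']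
  simp only [firstHit_iff_of_pos hc hα hαβ, firstHit_iff_of_pos hc' hα' hαβ']
  have hP : (0 < σ ∧ β + T * σ < 0) → (0 < σ ∧ β < 0) := fun h =>
    ⟨h.1, by nlinarith [mul_pos hT h.1, h.2]⟩
  have hQ : (ρ < 0 ∧ 0 < α + T * ρ) → (ρ < 0 ∧ 0 < α) := fun h =>
    ⟨h.1, by nlinarith [mul_neg_of_pos_of_neg hT h.1, h.2]⟩
  have hM : (ρ < σ ∧ β + T * σ < α + T * ρ) → (ρ < σ ∧ β < α) := fun h =>
    ⟨h.1, by nlinarith [mul_lt_mul_of_pos_left h.1 hT, h.2]⟩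
  have hPQ : (0 < σ ∧ β < 0) → (ρ < 0 ∧ 0 < α) → (ρ < σ ∧ β < α) := fun h h' =>
    ⟨by linarith [h.1, h'.1], by linarith [h.2, h'.2]⟩
  have hPQ' : (0 < σ ∧ β + T * σ < 0) → (ρ < 0 ∧ 0 < α + T * ρ) →
      (ρ < σ ∧ β + T * σ < α + T * ρ) := fun h h' =>
    ⟨by linarith [h.1, h'.1], by linarith [h.2, h'.2]⟩
  have hMQ : (ρ < σ ∧ β + T * σ < α + T * ρ) → (ρ < 0 ∧ 0 < α) → (ρ < 0 ∧ 0 < α + T * ρ) := by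
    rintro ⟨h1, h2⟩ ⟨h3, -⟩
    refine ⟨h3, ?_⟩
    by_contra h4
    have h4 : α + T * ρ < 0 := lt_of_le_of_ne (not_lt.1 h4) hα'
    rcases le_or_gt 0 σ with hs | hs
    · nlinarith [mul_nonneg_of_nonpos_of_nonpos h4.le h3.le,
        mul_nonpos_of_nonpos_of_nonneg h4.le hs,
        mul_pos_of_neg_of_neg (lt_trans h2 h4) h3]
    · nlinarith [mul_lt_mul_of_neg_left h1 h4, mul_lt_mul_of_neg_right h2 h3]
  exact indicator_sub_le_aux hP hQ hM hPQ hPQ' hMQ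

open Classical in
theorem tripodCount_le_of_pos {α β ρ σ : ℝ} (hc : 0 < α * σ - β * ρ)
    (hα : α ≠ 0) (hαβ : α ≠ β) :
    tripodCount α β ρ σ ≤ (if FirstHit α β ρ σ then 1 else 0) := by
  rw [tripodCount_of_pos hc]
  simp only [firstHit_iff_of_pos hc hα hαβ]
  have hPQ : (0 < σ ∧ β < 0) → (ρ < 0 ∧ 0 < α) → (ρ < σ ∧ β < α) := fun h h' =>
    ⟨by linarith [h.1, h'.1], by linarith [h.2, h'.2]⟩
  exact indicator_le_aux hPQ

open Classical in
theorem tripodCount_sub_le {α β ρ σ T : ℝ} (hT : 0 < T) (hc : α * σ - β * ρ ≠ 0)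
    (hα : α ≠ 0) (hβ : β ≠ 0) (hαβ : α ≠ β) (hα' : α + T * ρ ≠ 0) (hβ' : β + T * σ ≠ 0)
    (hαβ' : α + T * ρ ≠ β + T * σ) :
    tripodCount α β ρ σ - tripodCount (α + T * ρ) (β + T * σ) ρ σ ≤
      (if FirstHit α β ρ σ then 1 else 0)
        - (if FirstHit (α + T * ρ) (β + T * σ) ρ σ then 1 else 0) := by
  rcases lt_or_gt_of_ne hc with hc | hc
  -- The reflection in the diagonal changes the sign of the determinant.
  · have := tripodCount_sub_le_of_pos (α := β) (β := α) (ρ := σ) (σ := ρ) hT (by linarith) hβ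
      hαβ.symm hβ' hαβ'.symm
    simpa only [tripodCount_swap, FirstHit.swap] using this
  · exact tripodCount_sub_le_of_pos hT hc hα hαβ hα' hαβ'

open Classical in
theorem tripodCount_le {α β ρ σ : ℝ} (hc : α * σ - β * ρ ≠ 0)
    (hα : α ≠ 0) (hβ : β ≠ 0) (hαβ : α ≠ β) :
    tripodCount α β ρ σ ≤ (if FirstHit α β ρ σ then 1 else 0) := by
  rcases lt_or_gt_of_ne hc with hc | hc
  · have := tripodCount_le_of_pos (α := β) (β := α) (ρ := σ) (σ := ρ) (by linarith) hβ
      hαβ.symm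
    simpa only [tripodCount_swap, FirstHit.swap] using this
  · exact tripodCount_le_of_pos hc hα hαβ

/-! ### Rays crossing three concurrent rays with balanced directions -/

/-- The determinant of two vectors of the plane. -/
def planeDet (a b : ℝ × ℝ) : ℝ := a.1 * b.2 - a.2 * b.1

theorem planeDet_add_left (a b c : ℝ × ℝ) :
    planeDet (a + b) c = planeDet a c + planeDet b c := by
  simp only [planeDet, Prod.fst_add, Prod.snd_add]; ring

theorem planeDet_add_right (a b c : ℝ × ℝ) :
    planeDet a (b + c) = planeDet a b + planeDet a c := by
  simp only [planeDet, Prod.fst_add, Prod.snd_add]; ring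

theorem planeDet_sub_right (a b c : ℝ × ℝ) :
    planeDet a (b - c) = planeDet a b - planeDet a c := by
  simp only [planeDet, Prod.fst_sub, Prod.snd_sub]; ring

theorem planeDet_smul_left (t : ℝ) (a b : ℝ × ℝ) : planeDet (t • a) b = t * planeDet a b := by
  simp only [planeDet, Prod.smul_fst, Prod.smul_snd, smul_eq_mul]; ring

theorem planeDet_smul_right (t : ℝ) (a b : ℝ × ℝ) : planeDet a (t • b) = t * planeDet a b := by
  simp only [planeDet, Prod.smul_fst, Prod.smul_snd, smul_eq_mul]; ring

theorem planeDet_neg_left (a b : ℝ × ℝ) : planeDet (-a) b = -planeDet a b := by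
  simp only [planeDet, Prod.fst_neg, Prod.snd_neg]; ring

theorem planeDet_neg_right (a b : ℝ × ℝ) : planeDet a (-b) = -planeDet a b := by
  simp only [planeDet, Prod.fst_neg, Prod.snd_neg]; ring

theorem planeDet_swap (a b : ℝ × ℝ) : planeDet a b = -planeDet b a := by
  simp only [planeDet]; ring

@[simp] theorem planeDet_self (a : ℝ × ℝ) : planeDet a a = 0 := by
  simp only [planeDet]; ring

@[simp] theorem planeDet_zero_left (a : ℝ × ℝ) : planeDet 0 a = 0 := by
  simp [planeDet]

@[simp] theorem planeDet_zero_right (a : ℝ × ℝ) : planeDet a 0 = 0 := by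
  simp [planeDet]

theorem exists_smul_of_planeDet_eq_zero {a b : ℝ × ℝ} (ha : a ≠ 0) (h : planeDet a b = 0) :
    ∃ t : ℝ, b = t • a := by
  obtain ⟨x, y⟩ := a
  obtain ⟨z, w⟩ := b
  simp only [planeDet] at h
  by_cases hx : x = 0
  · have hy : y ≠ 0 := by rintro rfl; exact ha (by rw [hx]; rfl)
    refine ⟨w / y, ?_⟩
    have hz : z = 0 := by
      have : y * z = 0 := by rw [hx] at h; linarith
      exact (mul_eq_zero.1 this).resolve_left hy
    ext
    · simp [hx, hz]
    · simp [hy]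
  · refine ⟨z / x, ?_⟩
    ext
    · simp [hx]
    · simp only [Prod.smul_mk, smul_eq_mul]; field_simp; linarith

theorem planeDet_eq_zero_trans {a b c : ℝ × ℝ} (ha : a ≠ 0) (hb : planeDet a b = 0)
    (hc : planeDet a c = 0) : planeDet b c = 0 := by
  obtain ⟨t, rfl⟩ := exists_smul_of_planeDet_eq_zero ha hb
  rw [planeDet_smul_left, hc, mul_zero]

/-- The indicator of the transversal crossing of the open rays from `u` in direction `p` and from
`u + δ` in direction `r`. -/
noncomputable def rayHit (δ p r : ℝ × ℝ) : ℤ :=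
  if 0 < planeDet δ r / planeDet p r ∧ 0 < planeDet δ p / planeDet p r then 1 else 0

theorem rayHit_of_parallel {δ p r : ℝ × ℝ} (h : planeDet p r = 0) : rayHit δ p r = 0 := by
  simp [rayHit, h]

/-- The number of crossings of the ray from `δ` in direction `r` with the rays from the origin in
the directions `p` and `q`, minus those with the ray in direction `p + q`. -/
noncomputable def wallCount (p q δ r : ℝ × ℝ) : ℤ :=
  rayHit δ p r + rayHit δ q r - rayHit δ (p + q) r

@[simp] theorem wallCount_zero (p q δ : ℝ × ℝ) : wallCount p q δ 0 = 0 := by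
  simp [wallCount, rayHit]

theorem wallCount_of_parallel {p q δ r : ℝ × ℝ} (hp : planeDet p r = 0) (hq : planeDet q r = 0) :
    wallCount p q δ r = 0 := by
  simp [wallCount, rayHit_of_parallel, hp, hq, planeDet_add_left]

theorem wallCount_eq_tripodCount {p q : ℝ × ℝ} (h : planeDet p q ≠ 0) (δ r : ℝ × ℝ) :
    wallCount p q δ r =
      tripodCount (planeDet δ q / planeDet p q) (planeDet p δ / planeDet p q)
        (planeDet r q / planeDet p q) (planeDet p r / planeDet p q) := by
  unfold wallCount rayHit tripodCount
  set D := planeDet p q with hD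
  set α := planeDet δ q / D with hα
  set β := planeDet p δ / D with hβ
  set ρ := planeDet r q / D with hρ
  set σ := planeDet p r / D with hσ
  have e1 : planeDet δ r = D * (α * σ - β * ρ) := by
    have : planeDet δ r * D = planeDet δ q * planeDet p r - planeDet p δ * planeDet r q := by
      simp only [hD, planeDet]; ring
    simp only [hα, hβ, hρ, hσ]; field_simp; linarith
  have e2 : planeDet p r = D * σ := by simp only [hσ]; field_simp
  have e3 : planeDet δ p = D * -β := by
    simp only [hβ]; field_simp; simp only [planeDet]; ring
  have e4 : planeDet q r = D * -ρ := by
    simp only [hρ]; field_simp; simp only [planeDet]; ring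
  have e5 : planeDet δ q = D * α := by simp only [hα]; field_simp
  have e6 : planeDet (p + q) r = D * (σ - ρ) := by
    rw [planeDet_add_left, e2, e4]; ring
  have e7 : planeDet δ (p + q) = D * (α - β) := by
    rw [planeDet_add_right, e3, e5]; ring
  rw [e6, e7, e4, e5, e3, e1, e2]
  simp only [mul_div_mul_left _ _ h]

/-! #### Collinear walls -/

/-- The value of `wallCount` on the line spanned by the wall directions `π • τ`, `χ • τ`, as a
function of the coordinate of the crossing. -/
noncomputable def lineCount (π χ h : ℝ) : ℤ :=
  (if 0 < h / π then 1 else 0) + (if 0 < h / χ then 1 else 0) - (if 0 < h / (π + χ) then 1 else 0)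

theorem rayHit_smul (δ τ r : ℝ × ℝ) (π : ℝ) :
    rayHit δ (π • τ) r = if 0 < planeDet δ τ / planeDet τ r then
      (if 0 < planeDet δ r / planeDet τ r / π then 1 else 0) else 0 := by
  unfold rayHit
  rw [planeDet_smul_left, planeDet_smul_right]
  by_cases hπ : π = 0
  · simp [hπ]
  · rw [mul_div_mul_left _ _ hπ, div_div, mul_comm (planeDet τ r) π]
    split_ifs <;> simp_all

theorem wallCount_smul (δ τ r : ℝ × ℝ) (π χ : ℝ) :
    wallCount (π • τ) (χ • τ) δ r = if 0 < planeDet δ τ / planeDet τ r then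
      lineCount π χ (planeDet δ r / planeDet τ r) else 0 := by
  unfold wallCount lineCount
  rw [← add_smul, rayHit_smul, rayHit_smul, rayHit_smul]
  split_ifs <;> simp

theorem lineCount_of_pos {π χ h : ℝ} (hh : 0 < h) : lineCount π χ h =
    (if 0 < π then 1 else 0) + (if 0 < χ then 1 else 0) - (if 0 < π + χ then 1 else 0) := by
  have (x : ℝ) : 0 < h / x ↔ 0 < x := by rw [div_pos_iff_of_pos_left hh]
  simp only [lineCount, this]

theorem lineCount_of_neg {π χ h : ℝ} (hh : h < 0) : lineCount π χ h =
    (if π < 0 then 1 else 0) + (if χ < 0 then 1 else 0) - (if π + χ < 0 then 1 else 0) := by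
  have (x : ℝ) : 0 < h / x ↔ x < 0 := by
    rw [div_pos_iff]
    constructor
    · rintro (h | h)
      · linarith [h.1]
      · exact h.2
    · exact fun h => Or.inr ⟨hh, h⟩
  simp only [lineCount, this]

theorem lineCount_congr {π χ h h' : ℝ} (hh : 0 < h * h') : lineCount π χ h = lineCount π χ h' := by
  rcases lt_or_gt_of_ne (left_ne_zero_of_mul hh.ne') with h1 | h1
  · rw [lineCount_of_neg h1, lineCount_of_neg (by nlinarith)]
  · rw [lineCount_of_pos h1, lineCount_of_pos (by nlinarith)]

theorem lineCount_nonneg {π χ h : ℝ} : 0 ≤ lineCount π χ h := by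
  rcases lt_trichotomy h 0 with h1 | h1 | h1
  · rw [lineCount_of_neg h1]; split_ifs <;> first | (norm_num; done) | (exfalso; linarith)
  · simp [lineCount, h1]
  · rw [lineCount_of_pos h1]; split_ifs <;> first | (norm_num; done) | (exfalso; linarith)

theorem lineCount_le_one {π χ h : ℝ} : lineCount π χ h ≤ 1 := by
  rcases lt_trichotomy h 0 with h1 | h1 | h1
  · rw [lineCount_of_neg h1]; split_ifs <;> first | (norm_num; done) | (exfalso; linarith)
  · simp [lineCount, h1]
  · rw [lineCount_of_pos h1]; split_ifs <;> first | (norm_num; done) | (exfalso; linarith)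

theorem exists_collinear {p q : ℝ × ℝ} (h : planeDet p q = 0) :
    ∃ τ : ℝ × ℝ, ∃ π χ : ℝ, τ ≠ 0 ∧ p = π • τ ∧ q = χ • τ := by
  by_cases hp : p = 0
  · by_cases hq : q = 0
    · exact ⟨(1, 0), 0, 0, by simp, by simp [hp], by simp [hq]⟩
    · exact ⟨q, 0, 1, hq, by simp [hp], by simp⟩
  · obtain ⟨t, rfl⟩ := exists_smul_of_planeDet_eq_zero hp h
    exact ⟨p, 1, t, hp, by simp, rfl⟩

/-- On a line of walls the count depends only on the side of the vertex on which the line is hit. If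
r and s both reach the line, so does r + s, at a point between their hits; genericity keeps it off
the vertex, so it lies on the side of one of the two hits and inherits the count there. -/
theorem wallCount_add_le_of_collinear {p q δ r s : ℝ × ℝ} (h : planeDet p q = 0)
    (hrs : r + s ≠ 0 → planeDet (r + s) δ ≠ 0) :
    wallCount p q δ r + wallCount p q δ s - wallCount p q δ (r + s) ≤ 1 := by
  obtain ⟨τ, π, χ, -, rfl, rfl⟩ := exists_collinear h
  rw [wallCount_smul, wallCount_smul, wallCount_smul]
  have hsum : 0 ≤ (if 0 < planeDet δ τ / planeDet τ (r + s) then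
      lineCount π χ (planeDet δ (r + s) / planeDet τ (r + s)) else 0) := by
    split_ifs
    · exact lineCount_nonneg
    · exact le_rfl
  by_cases hr : 0 < planeDet δ τ / planeDet τ r
  swap
  · rw [if_neg hr]
    have : (if 0 < planeDet δ τ / planeDet τ s then
      lineCount π χ (planeDet δ s / planeDet τ s) else 0) ≤ 1 := by
      split_ifs
      · exact lineCount_le_one
      · norm_num
    linarith
  by_cases hs : 0 < planeDet δ τ / planeDet τ s
  swap
  · rw [if_neg hs]
    have : (if 0 < planeDet δ τ / planeDet τ r then
      lineCount π χ (planeDet δ r / planeDet τ r) else 0) ≤ 1 := by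
      rw [if_pos hr]
      exact lineCount_le_one
    linarith
  rw [if_pos hr, if_pos hs]
  have hrne : planeDet τ r ≠ 0 := fun h => by simp [h] at hr
  have hsne : planeDet τ s ≠ 0 := fun h => by simp [h] at hs
  have hprod : 0 < planeDet τ r * planeDet τ s := by
    rcases div_pos_iff.1 hr with h1 | h1 <;> rcases div_pos_iff.1 hs with h2 | h2
    · exact mul_pos h1.2 h2.2
    · linarith [h1.1, h2.1]
    · linarith [h1.1, h2.1]
    · exact mul_pos_of_neg_of_neg h1.2 h2.2
  have hm : 0 < planeDet δ τ / planeDet τ (r + s) := by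
    rw [planeDet_add_right]
    rcases div_pos_iff.1 hr with h1 | h1
    · exact div_pos h1.1 (by linarith [(pos_iff_pos_of_mul_pos hprod).1 h1.2, h1.2])
    · exact div_pos_of_neg_of_neg h1.1 (by linarith [(neg_iff_neg_of_mul_pos hprod).1 h1.2, h1.2])
  rw [if_pos hm]
  have hmne : planeDet τ (r + s) ≠ 0 := fun h => by simp [h] at hm
  have hm0 : r + s ≠ 0 := by rintro h; simp [h] at hmne
  have hδ : planeDet δ (r + s) ≠ 0 := by
    rw [planeDet_swap]; simpa using hrs hm0
  have h1 := lineCount_le_one (π := π) (χ := χ) (h := planeDet δ r / planeDet τ r)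
  have h2 := lineCount_le_one (π := π) (χ := χ) (h := planeDet δ s / planeDet τ s)
  have h3 := lineCount_nonneg (π := π) (χ := χ) (h := planeDet δ r / planeDet τ r)
  have h4 := lineCount_nonneg (π := π) (χ := χ) (h := planeDet δ s / planeDet τ s)
  have h5 := lineCount_nonneg (π := π) (χ := χ) (h := planeDet δ (r + s) / planeDet τ (r + s))
  by_contra hcon
  have e1 : lineCount π χ (planeDet δ r / planeDet τ r) = 1 := by omega
  have e2 : lineCount π χ (planeDet δ s / planeDet τ s) = 1 := by omega
  have e3 : lineCount π χ (planeDet δ (r + s) / planeDet τ (r + s)) = 0 := by omega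
  set x := planeDet δ r / planeDet τ r with hx
  set y := planeDet δ s / planeDet τ s with hy
  set z := planeDet δ (r + s) / planeDet τ (r + s) with hz
  have hz0 : z ≠ 0 := div_ne_zero hδ hmne
  -- z is the mean of x and y with the weights `planeDet τ r` and `planeDet τ s`, which have the
  -- same sign.
  have key : z * (planeDet τ r + planeDet τ s) = x * planeDet τ r + y * planeDet τ s := by
    rw [hx, hy, hz, div_mul_cancel₀ _ hrne, div_mul_cancel₀ _ hsne, ← planeDet_add_right,
      div_mul_cancel₀ _ hmne, planeDet_add_right]
  have key' : z * (planeDet τ r + planeDet τ s) * planeDet τ r =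
      x * (planeDet τ r * planeDet τ r) + y * (planeDet τ r * planeDet τ s) := by
    rw [key]; ring
  have hrr : 0 < planeDet τ r * planeDet τ r := mul_self_pos.2 hrne
  have hpos : 0 < (planeDet τ r + planeDet τ s) * planeDet τ r := by nlinarith
  have hx0 : x ≠ 0 := by rintro h; rw [h] at e1; simp [lineCount] at e1
  have hy0 : y ≠ 0 := by rintro h; rw [h] at e2; simp [lineCount] at e2
  rcases lt_or_gt_of_ne hx0 with hx1 | hx1 <;> rcases lt_or_gt_of_ne hz0 with hz1 | hz1
  · have := lineCount_congr (π := π) (χ := χ) (mul_pos_of_neg_of_neg hx1 hz1)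
    omega
  · rcases lt_or_gt_of_ne hy0 with hy1 | hy1
    · nlinarith [mul_pos hz1 hpos, mul_neg_of_neg_of_pos hx1 hrr, mul_neg_of_neg_of_pos hy1 hprod]
    · have := lineCount_congr (π := π) (χ := χ) (mul_pos hy1 hz1)
      omega
  · rcases lt_or_gt_of_ne hy0 with hy1 | hy1
    · have := lineCount_congr (π := π) (χ := χ) (mul_pos_of_neg_of_neg hy1 hz1)
      omega
    · nlinarith [mul_neg_of_neg_of_pos hz1 hpos, mul_pos hx1 hrr, mul_pos hy1 hprod]
  · have := lineCount_congr (π := π) (χ := χ) (mul_pos hx1 hz1)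
    omega

/-! #### The potential of a ray -/

/-- The coordinates of `δ` and `r` with respect to the basis `p`, `q` satisfy `FirstHit`. -/
def WallFirstHit (p q δ r : ℝ × ℝ) : Prop :=
  FirstHit (planeDet δ q / planeDet p q) (planeDet p δ / planeDet p q)
    (planeDet r q / planeDet p q) (planeDet p r / planeDet p q)

open Classical in
/-- A potential dominating the variation of `wallCount` along rays. -/
noncomputable def wallPotential (p q δ r : ℝ × ℝ) : ℤ :=
  if planeDet p q = 0 then wallCount p q δ r
  else if r = 0 then 1 else if WallFirstHit p q δ r then 1 else 0

theorem wallPotential_of_collinear {p q : ℝ × ℝ} (h : planeDet p q = 0) (δ r : ℝ × ℝ) :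
    wallPotential p q δ r = wallCount p q δ r := by
  simp [wallPotential, h]

section coordinates

variable {p q δ r : ℝ × ℝ}

theorem first_coord_ne_zero (h : planeDet p q ≠ 0) (hq : planeDet q δ ≠ 0) : planeDet δ q / planeDet p q ≠ 0 := by
  rw [planeDet_swap δ q]; exact div_ne_zero (neg_ne_zero.2 hq) h

theorem second_coord_ne_zero (h : planeDet p q ≠ 0) (hp : planeDet p δ ≠ 0) : planeDet p δ / planeDet p q ≠ 0 :=
  div_ne_zero hp h

theorem coords_ne (h : planeDet p q ≠ 0) (hpq : planeDet (p + q) δ ≠ 0) :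
    planeDet δ q / planeDet p q ≠ planeDet p δ / planeDet p q := by
  intro he
  apply hpq
  have := (div_left_inj' h).1 he
  rw [planeDet_add_left, ← this, planeDet_swap δ q]; ring

theorem coords_det (h : planeDet p q ≠ 0) : planeDet δ q / planeDet p q * (planeDet p r / planeDet p q)
    - planeDet p δ / planeDet p q * (planeDet r q / planeDet p q)
    = planeDet δ r / planeDet p q := by
  field_simp
  simp only [planeDet]; ring

theorem first_coord_add (h : planeDet p q ≠ 0) (T : ℝ) : planeDet (δ + T • r) q / planeDet p q =
    planeDet δ q / planeDet p q + T * (planeDet r q / planeDet p q) := by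
  rw [planeDet_add_left, planeDet_smul_left]; field_simp

theorem second_coord_add (h : planeDet p q ≠ 0) (T : ℝ) : planeDet p (δ + T • r) / planeDet p q =
    planeDet p δ / planeDet p q + T * (planeDet p r / planeDet p q) := by
  rw [planeDet_add_right, planeDet_smul_right]; field_simp

end coordinates

theorem ne_zero_of_planeDet_ne_zero {p q : ℝ × ℝ} (h : planeDet p q ≠ 0) :
    p ≠ 0 ∧ q ≠ 0 ∧ p + q ≠ 0 := by
  refine ⟨by rintro rfl; simp at h, by rintro rfl; simp at h, fun hpq => h ?_⟩
  rw [← neg_eq_of_add_eq_zero_right hpq, planeDet_neg_right, planeDet_self, neg_zero]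

/-- The determinant of `δ` with `a` does not vanish unless `a` does. -/
def GenericFor (δ a : ℝ × ℝ) : Prop := a ≠ 0 → planeDet a δ ≠ 0

theorem wallCount_sub_le {p q δ r : ℝ × ℝ} {T : ℝ} (hT : 0 < T) (hr : GenericFor δ r)
    (hp : GenericFor δ p) (hq : GenericFor δ q) (hpq : GenericFor δ (p + q))
    (hp' : GenericFor (δ + T • r) p) (hq' : GenericFor (δ + T • r) q)
    (hpq' : GenericFor (δ + T • r) (p + q)) :
    wallCount p q δ r - wallCount p q (δ + T • r) r ≤
      wallPotential p q δ r - wallPotential p q (δ + T • r) r := by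
  unfold wallPotential
  by_cases h : planeDet p q = 0
  · simp [h]
  by_cases hr0 : r = 0
  · simp [h, hr0]
  simp only [if_neg h, if_neg hr0, wallCount_eq_tripodCount h]
  obtain ⟨hp0, hq0, hpq0⟩ := ne_zero_of_planeDet_ne_zero h
  have e1 := first_coord_ne_zero h (hq hq0)
  have e2 := second_coord_ne_zero h (hp hp0)
  have e3 := coords_ne h (hpq hpq0)
  have e1' := first_coord_ne_zero h (hq' hq0)
  have e2' := second_coord_ne_zero h (hp' hp0)
  have e3' := coords_ne h (hpq' hpq0)
  unfold WallFirstHit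
  rw [first_coord_add h] at e1' e3' ⊢
  rw [second_coord_add h] at e2' e3' ⊢
  refine tripodCount_sub_le hT ?_ e1 e2 e3 e1' e2' e3'
  rw [coords_det h]
  exact div_ne_zero (by rw [planeDet_swap]; exact neg_ne_zero.2 (hr hr0)) h

theorem wallCount_le_potential {p q δ r : ℝ × ℝ} (hr : GenericFor δ r)
    (hp : GenericFor δ p) (hq : GenericFor δ q) (hpq : GenericFor δ (p + q)) :
    wallCount p q δ r ≤ wallPotential p q δ r := by
  unfold wallPotential
  by_cases h : planeDet p q = 0
  · simp [h]
  by_cases hr0 : r = 0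
  · simp [h, hr0]
  simp only [if_neg h, if_neg hr0, wallCount_eq_tripodCount h]
  obtain ⟨hp0, hq0, hpq0⟩ := ne_zero_of_planeDet_ne_zero h
  refine tripodCount_le ?_ (first_coord_ne_zero h (hq hq0)) (second_coord_ne_zero h (hp hp0))
    (coords_ne h (hpq hpq0))
  rw [coords_det h]
  exact div_ne_zero (by rw [planeDet_swap]; exact neg_ne_zero.2 (hr hr0)) h

theorem wallPotential_le_one {p q δ r : ℝ × ℝ} (h : planeDet p q ≠ 0) :
    wallPotential p q δ r ≤ 1 := by
  unfold wallPotential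
  rw [if_neg h]
  split_ifs <;> norm_num

theorem wallPotential_nonneg {p q δ r : ℝ × ℝ} (h : planeDet p q ≠ 0) :
    0 ≤ wallPotential p q δ r := by
  unfold wallPotential
  rw [if_neg h]
  split_ifs <;> norm_num

theorem WallFirstHit.add {p q δ r s : ℝ × ℝ} (hr : WallFirstHit p q δ r)
    (hs : WallFirstHit p q δ s) : WallFirstHit p q δ (r + s) := by
  unfold WallFirstHit at *
  have := FirstHit.add hr hs
  rwa [← add_div, ← add_div, ← planeDet_add_left, ← planeDet_add_right] at this

/-- This is the local estimate behind `gain_le_one`. A value of 2 would need r and s to have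
potential 1 and r + s to have potential 0, against the convexity of the cone of such directions. -/
theorem wallPotential_add_le {p q δ r s : ℝ × ℝ} (hs : GenericFor δ s)
    (hp : GenericFor δ p) (hq : GenericFor δ q) (hpq : GenericFor δ (p + q))
    (hrs : GenericFor δ (r + s)) :
    wallPotential p q δ r + wallCount p q δ s - wallPotential p q δ (r + s) ≤ 1 := by
  by_cases h : planeDet p q = 0
  · simp only [wallPotential_of_collinear h]
    exact wallCount_add_le_of_collinear h hrs
  have h1 := wallPotential_le_one (δ := δ) (r := r) h
  have h2 := wallPotential_le_one (δ := δ) (r := s) h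
  have h3 := wallCount_le_potential hs hp hq hpq
  have h4 := wallPotential_nonneg (δ := δ) (r := r + s) h
  by_contra hcon
  have e1 : wallPotential p q δ r = 1 := by omega
  have e2 : wallPotential p q δ s = 1 := by omega
  have e3 : wallPotential p q δ (r + s) = 0 := by omega
  have e4 : wallCount p q δ s = 1 := by omega
  have hs0 : s ≠ 0 := by rintro rfl; simp at e4
  unfold wallPotential at e1 e2 e3
  rw [if_neg h] at e1 e2 e3
  -- The value 1 of the potential on the zero vector, a contracted edge, suits both ends of the
  -- estimate: for r + s = 0 it is subtracted, and for r = 0 what remains is the inequality between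
  -- count and potential of s.
  have hrs0 : r + s ≠ 0 := by intro h0; simp [h0] at e3
  by_cases hr0 : r = 0
  · subst hr0
    rw [zero_add] at e3
    omega
  rw [if_neg hr0] at e1
  rw [if_neg hs0] at e2
  rw [if_neg hrs0] at e3
  have f1 : WallFirstHit p q δ r := by by_contra hc; simp [hc] at e1
  have f2 : WallFirstHit p q δ s := by by_contra hc; simp [hc] at e2
  simp [f1.add f2] at e3

/-! ### Caterpillars in the plane -/

/-- The image of a tropical caterpillar line with `N` inner vertices in the plane: the vertex
`pos k` is reached in direction `dir k`, left in direction `dir (k + 1)` after the distance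
`len k`, and carries a ray in direction `ray k`. -/
structure PlaneCaterpillar (N : ℕ) where
  pos : ℕ → ℝ × ℝ
  dir : ℕ → ℝ × ℝ
  ray : ℕ → ℝ × ℝ
  len : ℕ → ℝ
  balance : ∀ k < N, dir k = ray k + dir (k + 1)
  len_pos : ∀ k, k + 1 < N → 0 < len k
  pos_succ : ∀ k, k + 1 < N → pos (k + 1) = pos k + len k • dir (k + 1)

namespace PlaneCaterpillar

variable {N : ℕ} (C : PlaneCaterpillar N)

/-- The directions of the edges, in either orientation. -/
def IsDirection (a : ℝ × ℝ) : Prop :=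
  ∃ k ≤ N, a = C.dir k ∨ a = -C.dir k ∨ a = C.ray k ∨ a = -C.ray k

theorem isDirection_dir {k : ℕ} (hk : k ≤ N) : C.IsDirection (C.dir k) := ⟨k, hk, Or.inl rfl⟩

theorem isDirection_neg_dir {k : ℕ} (hk : k ≤ N) : C.IsDirection (-C.dir k) :=
  ⟨k, hk, Or.inr (Or.inl rfl)⟩

theorem isDirection_ray {k : ℕ} (hk : k ≤ N) : C.IsDirection (C.ray k) :=
  ⟨k, hk, Or.inr (Or.inr (Or.inl rfl))⟩

theorem IsDirection.neg {C : PlaneCaterpillar N} {a : ℝ × ℝ} (h : C.IsDirection a) :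
    C.IsDirection (-a) := by
  obtain ⟨k, hk, rfl | rfl | rfl | rfl⟩ := h
  · exact ⟨k, hk, Or.inr (Or.inl rfl)⟩
  · exact ⟨k, hk, Or.inl (neg_neg _)⟩
  · exact ⟨k, hk, Or.inr (Or.inr (Or.inr rfl))⟩
  · exact ⟨k, hk, Or.inr (Or.inr (Or.inl (neg_neg _)))⟩

/-- The position of the vertex `j` relative to the vertex `i` shifted by `ξ`. -/
def offset (ξ : ℝ × ℝ) (i j : ℕ) : ℝ × ℝ := C.pos j - C.pos i - ξ

/-- A shift by a small vector in general position. -/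
structure IsGenericShift (ξ : ℝ × ℝ) : Prop where
  generic : ∀ i < N, ∀ j < N, ∀ a, C.IsDirection a → GenericFor (C.offset ξ i j) a
  close : ∀ i < N, ∀ j < N, ∀ a, C.IsDirection a → 0 < planeDet a (C.pos j - C.pos i) →
    0 < planeDet a (C.offset ξ i j)

variable {C} {ξ : ℝ × ℝ}

/-- `close` applied to a and to -a: a determinant that is not zero keeps its sign under the shift.
-/
theorem IsGenericShift.mul_pos (hξ : C.IsGenericShift ξ) {i j : ℕ} (hi : i < N) (hj : j < N)
    {a : ℝ × ℝ} (ha : C.IsDirection a) {x : ℝ} (hx : 0 < planeDet a (C.pos j - C.pos i) * x) :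
    0 < planeDet a (C.offset ξ i j) * x := by
  rcases lt_or_gt_of_ne (left_ne_zero_of_mul hx.ne') with h | h
  · have h1 := hξ.close i hi j hj (-a) ha.neg (by rw [planeDet_neg_left]; linarith)
    rw [planeDet_neg_left] at h1
    exact mul_pos_of_neg_of_neg (by linarith) (by nlinarith)
  · exact _root_.mul_pos (hξ.close i hi j hj a ha h) (by nlinarith)

variable (C) (ξ)

theorem offset_succ_right {i j : ℕ} (hj : j + 1 < N) :
    C.offset ξ i (j + 1) = C.offset ξ i j + C.len j • C.dir (j + 1) := by
  simp only [offset, C.pos_succ j hj]; abel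

theorem offset_succ_left {i j : ℕ} (hi : i + 1 < N) :
    C.offset ξ (i + 1) j = C.offset ξ i j - C.len i • C.dir (i + 1) := by
  simp only [offset, C.pos_succ i hi]; abel

/-! ### Telescoping of the crossings along the chain -/

/-- `wallCount` with respect to the walls at the vertex `i`. -/
noncomputable def count (i : ℕ) (δ r : ℝ × ℝ) : ℤ := wallCount (-C.dir i) (C.ray i) δ r

/-- `wallPotential` with respect to the walls at the vertex `i`. -/
noncomputable def potential (i : ℕ) (δ r : ℝ × ℝ) : ℤ := wallPotential (-C.dir i) (C.ray i) δ r

theorem neg_dir_add_ray {i : ℕ} (hi : i < N) : -C.dir i + C.ray i = -C.dir (i + 1) := by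
  rw [C.balance i hi]; abel

/-- The number of crossings of the shifted ray from the vertex `i` in direction `p` with the ray
at the vertex `j` and the edge leaving it. -/
noncomputable def upperHits (j i : ℕ) (p : ℝ × ℝ) : ℤ :=
  rayHit (C.offset ξ i j) p (C.ray j) + rayHit (C.offset ξ i j) p (C.dir (j + 1))
    - if j + 1 < N then rayHit (C.offset ξ i (j + 1)) p (C.dir (j + 1)) else 0

/-- The crossings of the ray at `j` and the edge leaving `j` with the walls at `i`. -/
noncomputable def wallHits (i j : ℕ) : ℤ :=
  C.upperHits ξ j i (-C.dir i) + C.upperHits ξ j i (C.ray i) - C.upperHits ξ j i (-C.dir (i + 1))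

/-- The number of crossings of the edges with larger end `i` and ray at `i`, shifted by `ξ`, with
the ray at `j` and the edge leaving `j`. -/
noncomputable def pairHits (i j : ℕ) : ℤ :=
  C.upperHits ξ j i (-C.dir i) - (if i = 0 then 0 else C.upperHits ξ j (i - 1) (-C.dir i))
    + C.upperHits ξ j i (C.ray i)

/-- An upper bound for the contribution of the pair `i < j` of vertices to the number of
crossings. -/
noncomputable def gain (i j : ℕ) : ℤ :=
  (if j + 1 < N then C.potential i (C.offset ξ i j) (C.dir (j + 1))
    else C.count i (C.offset ξ i j) (C.dir (j + 1)))
  + C.count i (C.offset ξ i j) (C.ray j) - C.potential i (C.offset ξ i j) (C.dir j)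

theorem wallHits_eq {i : ℕ} (hi : i < N) (j : ℕ) : C.wallHits ξ i j =
    C.count i (C.offset ξ i j) (C.ray j) + C.count i (C.offset ξ i j) (C.dir (j + 1))
      - if j + 1 < N then C.count i (C.offset ξ i (j + 1)) (C.dir (j + 1)) else 0 := by
  simp only [wallHits, upperHits, count, wallCount, C.neg_dir_add_ray hi]
  split_ifs <;> ring

variable {ξ} (hξ : C.IsGenericShift ξ)

section
include hξ

theorem generic_wall {i j : ℕ} (hi : i < N) (hj : j < N) :
    GenericFor (C.offset ξ i j) (-C.dir i) ∧ GenericFor (C.offset ξ i j) (C.ray i) ∧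
      GenericFor (C.offset ξ i j) (-C.dir i + C.ray i) := by
  refine ⟨hξ.generic i hi j hj _ (C.isDirection_neg_dir hi.le),
    hξ.generic i hi j hj _ (C.isDirection_ray hi.le), ?_⟩
  rw [C.neg_dir_add_ray hi]
  exact hξ.generic i hi j hj _ (C.isDirection_neg_dir hi)

theorem count_le_potential {i j : ℕ} (hi : i < N) (hj : j < N) {r : ℝ × ℝ} (hr : C.IsDirection r) :
    C.count i (C.offset ξ i j) r ≤ C.potential i (C.offset ξ i j) r := by
  obtain ⟨h1, h2, h3⟩ := C.generic_wall hξ hi hj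
  exact wallCount_le_potential (hξ.generic i hi j hj _ hr) h1 h2 h3

theorem gain_le_one {i j : ℕ} (hi : i < N) (hj : j < N) : C.gain ξ i j ≤ 1 := by
  obtain ⟨h1, h2, h3⟩ := C.generic_wall hξ hi hj
  have key := wallPotential_add_le (r := C.dir (j + 1))
    (hξ.generic i hi j hj _ (C.isDirection_ray hj.le)) h1 h2 h3
    (by rw [add_comm, ← C.balance j hj]; exact hξ.generic i hi j hj _ (C.isDirection_dir hj.le))
  rw [add_comm (C.dir (j + 1)), ← C.balance j hj] at key
  have := C.count_le_potential hξ hi hj (C.isDirection_dir (k := j + 1) hj)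
  unfold gain potential count at *
  split_ifs <;> linarith

/-- The chain leaves i opposite to the negative wall. In the basis of the positive walls the next
vertex has two negative coordinates and the direction is (-1, -1), so no wall is ahead. -/
theorem potential_start {i : ℕ} (hi : i + 1 < N) :
    C.potential i (C.offset ξ i (i + 1)) (C.dir (i + 1)) ≤ 0 := by
  have hi' : i < N := by omega
  have hsum := C.neg_dir_add_ray hi'
  have hd : C.dir (i + 1) = -(-C.dir i + C.ray i) := by rw [hsum, neg_neg]
  have hp : planeDet (-C.dir i) (C.dir (i + 1)) = -planeDet (-C.dir i) (C.ray i) := by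
    rw [hd, planeDet_neg_right, planeDet_add_right, planeDet_self, zero_add]
  have hq : planeDet (C.ray i) (C.dir (i + 1)) = planeDet (-C.dir i) (C.ray i) := by
    rw [hd, planeDet_neg_right, planeDet_add_right, planeDet_self, add_zero, planeDet_swap,
      neg_neg]
  unfold potential
  by_cases h : planeDet (-C.dir i) (C.ray i) = 0
  · rw [wallPotential_of_collinear h, wallCount_of_parallel (by rw [hp, h, neg_zero]) (by rw [hq, h])]
  have hl := C.len_pos i hi
  have hpos : C.pos (i + 1) - C.pos i = C.len i • C.dir (i + 1) := by rw [C.pos_succ i hi]; abel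
  have hD := mul_self_pos.2 h
  have h1 := hξ.mul_pos hi' hi (C.isDirection_neg_dir hi'.le)
    (x := -planeDet (-C.dir i) (C.ray i)) (by
      rw [hpos, planeDet_smul_right, hp]
      nlinarith [_root_.mul_pos hl hD])
  have hd0 : C.dir (i + 1) ≠ 0 := by
    intro h0; rw [h0] at hq; simp at hq; exact h hq.symm
  unfold wallPotential
  rw [if_neg h, if_neg hd0, if_neg]
  unfold WallFirstHit FirstHit
  have e1 : planeDet (C.dir (i + 1)) (C.ray i) / planeDet (-C.dir i) (C.ray i) = -1 := by
    rw [planeDet_swap, hq, neg_div, div_self h]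
  have e2 : planeDet (-C.dir i) (C.dir (i + 1)) / planeDet (-C.dir i) (C.ray i) = -1 := by
    rw [hp, neg_div, div_self h]
  have h3 : planeDet (-C.dir i) (C.offset ξ i (i + 1)) / planeDet (-C.dir i) (C.ray i) < 0 := by
    rw [div_neg_iff]
    rcases lt_or_gt_of_ne h with h' | h'
    · exact Or.inl ⟨by nlinarith, h'⟩
    · exact Or.inr ⟨by nlinarith, h'⟩
  have h2 := hξ.mul_pos hi' hi (C.isDirection_ray hi'.le)
    (x := planeDet (-C.dir i) (C.ray i)) (by
      rw [hpos, planeDet_smul_right, hq]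
      nlinarith [_root_.mul_pos hl hD])
  have h4 : planeDet (C.offset ξ i (i + 1)) (C.ray i) / planeDet (-C.dir i) (C.ray i) < 0 := by
    rw [planeDet_swap, div_neg_iff]
    rcases lt_or_gt_of_ne h with h' | h'
    · exact Or.inl ⟨by nlinarith, h'⟩
    · exact Or.inr ⟨by nlinarith, h'⟩
  rw [e1, e2]
  rintro (h | h | h | h | h) <;> linarith [h.1, h.2.1, h.2.2.1, h.2.2.2]

/-- The potential of the edge arriving at m is carried along in the induction. Passing the edge from
m to m + 1 trades the difference of counts for a difference of potentials by `wallCount_sub_le`. -/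
theorem wallHits_sum_le {i m : ℕ} (him : i < m) (hm : m < N) :
    ∑ j ∈ Finset.Ico (i + 1) m, C.wallHits ξ i j + C.potential i (C.offset ξ i m) (C.dir m) ≤
      ∑ j ∈ Finset.Ico (i + 1) m, C.gain ξ i j := by
  have hi : i < N := by omega
  induction m, him using Nat.le_induction with
  | base => simpa using C.potential_start hξ hm
  | succ m him ih =>
    have ih := ih (by omega)
    have hm' : m < N := by omega
    rw [Finset.sum_Ico_succ_top (by omega), Finset.sum_Ico_succ_top (by omega),
      C.wallHits_eq ξ hi m]
    obtain ⟨h1, h2, h3⟩ := C.generic_wall hξ hi hm'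
    obtain ⟨h1', h2', h3'⟩ := C.generic_wall hξ hi hm
    rw [C.offset_succ_right ξ hm] at h1' h2' h3' ⊢
    have := wallCount_sub_le (C.len_pos m hm)
      (hξ.generic i hi m hm' _ (C.isDirection_dir (k := m + 1) hm.le)) h1 h2 h3 h1' h2' h3'
    unfold gain count potential at *
    rw [if_pos hm, if_pos hm]
    linarith

/-- The forward edge of the last vertex is unbounded, so nothing is subtracted for its far end and
`gain` uses the count instead of the potential. The distinction matters when this direction is zero:
its count is 0, while its potential is 1 if the walls span the plane. -/
theorem wallHits_sum_le_gain {i : ℕ} (hi : i < N) :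
    ∑ j ∈ Finset.Ico (i + 1) N, C.wallHits ξ i j ≤ ∑ j ∈ Finset.Ico (i + 1) N, C.gain ξ i j := by
  obtain ⟨M, rfl⟩ : ∃ M, N = M + 1 := ⟨N - 1, by omega⟩
  rcases Nat.lt_or_ge i M with h | h
  · rw [Finset.sum_Ico_succ_top (by omega), Finset.sum_Ico_succ_top (by omega)]
    have := C.wallHits_sum_le hξ h (Nat.lt_succ_self M)
    rw [C.wallHits_eq ξ hi M]
    have hg : C.gain ξ i M = C.count i (C.offset ξ i M) (C.dir (M + 1))
        + C.count i (C.offset ξ i M) (C.ray M) - C.potential i (C.offset ξ i M) (C.dir M) := by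
      simp [gain]
    rw [if_neg (lt_irrefl _), hg]
    linarith
  · rw [Finset.Ico_eq_empty (by omega)]; simp

/-- The three rays entering `upperHits` lie on lines through the vertex j + 1, which lies from j in
the direction `dir (j + 1)`. The ray from j in the opposite direction stays away from them, also
after a small shift. -/
theorem upperHits_pred {j : ℕ} (hj : j + 1 < N) :
    C.upperHits ξ (j + 1) j (-C.dir (j + 1)) = 0 := by
  have hj' : j < N := by omega
  have hpos : C.pos (j + 1) - C.pos j = C.len j • C.dir (j + 1) := by rw [C.pos_succ j hj]; abel
  have hl := C.len_pos j hj
  have key : ∀ k < N, ∀ r, C.IsDirection r →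
      planeDet r (C.pos k - C.pos j) = C.len j * planeDet r (C.dir (j + 1)) →
      rayHit (C.offset ξ j k) (-C.dir (j + 1)) r = 0 := by
    intro k hk r hr he
    unfold rayHit
    rw [if_neg]
    rintro ⟨h, -⟩
    by_cases hz : planeDet r (C.dir (j + 1)) = 0
    · rw [planeDet_neg_left, planeDet_swap (C.dir (j + 1)) r, hz] at h
      simp at h
    · have h1 := hξ.mul_pos hj' hk hr (x := planeDet r (C.dir (j + 1))) (by
        rw [he, mul_assoc]; exact _root_.mul_pos hl (mul_self_pos.2 hz))
      rw [planeDet_neg_left, planeDet_swap _ r, planeDet_swap (C.dir (j + 1)) r, neg_neg,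
        div_pos_iff] at h
      rcases h with h | h <;> nlinarith
  unfold upperHits
  rw [key _ hj _ (C.isDirection_ray hj.le) (by rw [hpos, planeDet_smul_right]),
    key _ hj _ (C.isDirection_dir (k := j + 1 + 1) hj) (by rw [hpos, planeDet_smul_right])]
  split_ifs with h
  · rw [key _ h _ (C.isDirection_dir (k := j + 1 + 1) hj)]
    · simp
    · rw [C.pos_succ (j + 1) h, C.pos_succ j hj]
      rw [show C.pos j + C.len j • C.dir (j + 1) + C.len (j + 1) • C.dir (j + 1 + 1) - C.pos j =
        C.len j • C.dir (j + 1) + C.len (j + 1) • C.dir (j + 1 + 1) by abel, planeDet_add_right,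
        planeDet_smul_right, planeDet_smul_right, planeDet_self]
      ring
  · simp

/-- The backward edge at i is the ray `-dir i` from i minus the same ray from i - 1. Collecting the
terms by starting point turns edges into walls; the one unmatched term, at the vertex before j,
vanishes by `upperHits_pred`. -/
theorem pairHits_sum_eq {j : ℕ} (hj : j < N) :
    ∑ i ∈ Finset.range j, C.pairHits ξ i j = ∑ i ∈ Finset.range j, C.wallHits ξ i j := by
  have key : ∀ m, ∑ i ∈ Finset.range (m + 1), C.pairHits ξ i j =
      ∑ i ∈ Finset.range (m + 1), C.wallHits ξ i j + C.upperHits ξ j m (-C.dir (m + 1)) := by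
    intro m
    induction m with
    | zero => simp [pairHits, wallHits]
    | succ m ih =>
      rw [Finset.sum_range_succ, ih, Finset.sum_range_succ _ (m + 1)]
      simp only [pairHits, wallHits, Nat.add_sub_cancel, Nat.succ_ne_zero, if_false]
      ring
  cases j with
  | zero => simp
  | succ j => rw [key j, C.upperHits_pred hξ hj, add_zero]

theorem pairHits_total_le :
    ∑ j ∈ Finset.range N, ∑ i ∈ Finset.range j, C.pairHits ξ i j ≤
      ∑ j ∈ Finset.range N, ∑ i ∈ Finset.range j, C.gain ξ i j := by
  have swap : ∀ f : ℕ → ℕ → ℤ, ∑ j ∈ Finset.range N, ∑ i ∈ Finset.range j, f i j =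
      ∑ i ∈ Finset.range N, ∑ j ∈ Finset.Ico (i + 1) N, f i j := by
    intro f
    refine Finset.sum_comm' fun x y => ?_
    simp only [Finset.mem_range, Finset.mem_Ico]
    omega
  rw [Finset.sum_congr rfl fun j hj => C.pairHits_sum_eq hξ (Finset.mem_range.1 hj), swap, swap]
  exact Finset.sum_le_sum fun i hi => C.wallHits_sum_le_gain hξ (Finset.mem_range.1 hi)

end

end PlaneCaterpillar

namespace PlaneCaterpillar

variable {N : ℕ} (C : PlaneCaterpillar N) {ξ : ℝ × ℝ} (hξ : C.IsGenericShift ξ)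

/-! #### Pairs of vertices without gain -/

theorem gain_eq_of_collinear {i : ℕ} (h : planeDet (-C.dir i) (C.ray i) = 0) (j : ℕ) :
    C.gain ξ i j = C.count i (C.offset ξ i j) (C.dir (j + 1))
      + C.count i (C.offset ξ i j) (C.ray j) - C.count i (C.offset ξ i j) (C.dir j) := by
  simp only [gain, potential, wallPotential_of_collinear h]
  simp [count]

theorem gain_eq_zero_of_parallel {i j : ℕ} {τ : ℝ × ℝ} (hτ : τ ≠ 0)
    (h : planeDet (-C.dir i) (C.ray i) = 0) (hj : j < N)
    (hi1 : planeDet τ (C.dir i) = 0) (hi2 : planeDet τ (C.ray i) = 0)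
    (hj1 : planeDet τ (C.dir j) = 0) (hj2 : planeDet τ (C.ray j) = 0) : C.gain ξ i j = 0 := by
  have key : ∀ r, planeDet τ r = 0 → C.count i (C.offset ξ i j) r = 0 := by
    intro r hr
    refine wallCount_of_parallel ?_ (planeDet_eq_zero_trans hτ hi2 hr)
    rw [planeDet_neg_left, planeDet_eq_zero_trans hτ hi1 hr, neg_zero]
  have hj3 : planeDet τ (C.dir (j + 1)) = 0 := by
    rw [C.balance j hj, planeDet_add_right, hj2, zero_add] at hj1
    exact hj1
  rw [C.gain_eq_of_collinear h, key _ hj1, key _ hj2, key _ hj3]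
  norm_num

theorem gain_nonpos_of_degenerate {i j : ℕ} (hj : j < N) (hj1 : C.dir j = 0)
    (hj2 : C.ray j = 0) : C.gain ξ i j ≤ 0 := by
  have hj3 : C.dir (j + 1) = 0 := by
    have := C.balance j hj
    rw [hj1, hj2, zero_add] at this
    exact this.symm
  unfold gain
  rw [hj1, hj2, hj3]
  by_cases h : planeDet (-C.dir i) (C.ray i) = 0
  · simp [potential, wallPotential_of_collinear h, count]
  · simp only [potential, wallPotential, h, count, wallCount_zero]
    split_ifs <;> simp

theorem potential_eq_zero_of_not {i : ℕ} {δ r : ℝ × ℝ} (h : planeDet (-C.dir i) (C.ray i) ≠ 0)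
    (hr : r ≠ 0) (hf : ¬ WallFirstHit (-C.dir i) (C.ray i) δ r) : C.potential i δ r = 0 := by
  simp [potential, wallPotential, h, hr, hf]

section
include hξ

theorem offset_div_mul_pos {i j : ℕ} (hi : i < N) (hj : j < N) {τ r : ℝ × ℝ} {l : ℝ}
    (hl : l ≠ 0) (hpos : C.pos j - C.pos i = l • τ) (hr : C.IsDirection r)
    (h : planeDet τ r ≠ 0) : 0 < planeDet (C.offset ξ i j) r / planeDet τ r * l := by
  have h1 := hξ.mul_pos hi hj hr (x := -l * planeDet τ r) (by
    rw [hpos, planeDet_smul_right, planeDet_swap]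
    nlinarith [_root_.mul_pos (mul_self_pos.2 hl) (mul_self_pos.2 h)])
  rw [planeDet_swap] at h1
  have h2 : planeDet (C.offset ξ i j) r / planeDet τ r * l =
      (-planeDet (C.offset ξ i j) r * (-l * planeDet τ r)) / (planeDet τ r * planeDet τ r) := by
    field_simp
  rw [h2]
  exact div_pos h1 (mul_self_pos.2 h)

/-- If the walls at i and the vertex j lie on one line, a ray from j hits that line close to j, if
at all. Whether it does is decided by its component transversal to the line, and the side of i is
the one of j. -/
theorem count_congr {i j : ℕ} (hi : i < N) (hj : j < N) {τ r r' : ℝ × ℝ} {l π χ : ℝ}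
    (h1 : -C.dir i = π • τ) (h2 : C.ray i = χ • τ)
    (hl : l ≠ 0) (hpos : C.pos j - C.pos i = l • τ) (hr : C.IsDirection r)
    (hr' : C.IsDirection r') (h : planeDet τ r = planeDet τ r') :
    C.count i (C.offset ξ i j) r = C.count i (C.offset ξ i j) r' := by
  unfold count
  rw [h1, h2, wallCount_smul, wallCount_smul]
  by_cases h0 : planeDet τ r = 0
  · rw [← h, h0]; simp
  · have e1 := C.offset_div_mul_pos hξ hi hj hl hpos hr h0
    have e2 := C.offset_div_mul_pos hξ hi hj hl hpos hr' (h ▸ h0)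
    rw [lineCount_congr (h' := planeDet (C.offset ξ i j) r' / planeDet τ r'), h]
    have := _root_.mul_pos e1 e2
    have hll := mul_self_pos.2 hl
    by_contra hneg
    push Not at hneg
    nlinarith [mul_nonpos_of_nonpos_of_nonneg hneg hll.le]

/-- One of the two outgoing directions at j is parallel to the line and has count 0. The other one
has the same transversal component as `dir j`, hence the same count by `count_congr`. -/
theorem gain_eq_zero_of_line {i j : ℕ} (hi : i < N) (hj : j < N) {τ : ℝ × ℝ} {l : ℝ}
    (hτ : τ ≠ 0) (h1 : planeDet τ (C.dir i) = 0) (h2 : planeDet τ (C.ray i) = 0)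
    (hl : l ≠ 0) (hpos : C.pos j - C.pos i = l • τ)
    (h : planeDet τ (C.ray j) = 0 ∨ planeDet τ (C.dir (j + 1)) = 0) : C.gain ξ i j = 0 := by
  have hcol : planeDet (-C.dir i) (C.ray i) = 0 := by
    rw [planeDet_neg_left, planeDet_eq_zero_trans hτ h1 h2, neg_zero]
  obtain ⟨π, hπ⟩ := exists_smul_of_planeDet_eq_zero hτ h1
  obtain ⟨χ, hχ⟩ := exists_smul_of_planeDet_eq_zero hτ h2
  have h1' : -C.dir i = (-π) • τ := by rw [hπ, neg_smul]
  have hb : planeDet τ (C.dir j) = planeDet τ (C.ray j) + planeDet τ (C.dir (j + 1)) := by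
    rw [C.balance j hj, planeDet_add_right]
  have hp : ∀ r, planeDet τ r = 0 → C.count i (C.offset ξ i j) r = 0 := by
    intro r hr
    unfold count
    rw [h1', hχ, wallCount_smul, hr]
    simp
  have d1 := C.isDirection_dir hj.le
  have d2 := C.isDirection_ray hj.le
  have d3 := C.isDirection_dir (k := j + 1) hj
  rw [C.gain_eq_of_collinear hcol]
  rcases h with h | h
  · rw [hp _ h, C.count_congr hξ hi hj h1' hχ hl hpos d3 d1 (by rw [hb, h, zero_add])]
    ring
  · rw [hp _ h, C.count_congr hξ hi hj h1' hχ hl hpos d2 d1 (by rw [hb, h, add_zero])]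
    ring

/-- On the side of i where j lies, the walls at i cancel or are absent. -/
theorem gain_eq_zero_of_behind {i j : ℕ} (hi : i < N) (hj : j < N) {τ : ℝ × ℝ} {l π χ : ℝ}
    (h1 : -C.dir i = π • τ) (h2 : C.ray i = χ • τ)
    (hl : l ≠ 0) (hpos : C.pos j - C.pos i = l • τ)
    (h : lineCount π χ l = 0) : C.gain ξ i j = 0 := by
  have hcol : planeDet (-C.dir i) (C.ray i) = 0 := by
    rw [h1, h2, planeDet_smul_left, planeDet_smul_right, planeDet_self]; ring
  have key : ∀ r, C.IsDirection r → C.count i (C.offset ξ i j) r = 0 := by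
    intro r hr
    unfold count
    rw [h1, h2, wallCount_smul]
    by_cases h0 : planeDet τ r = 0
    · simp [h0]
    · rw [lineCount_congr (C.offset_div_mul_pos hξ hi hj hl hpos hr h0), h]
      simp
  rw [C.gain_eq_of_collinear hcol, key _ (C.isDirection_dir hj.le),
    key _ (C.isDirection_ray hj.le), key _ (C.isDirection_dir (k := j + 1) hj)]
  norm_num

/-- A zero direction has count 0 but potential 1; hence the extra condition `hout` wherever `gain`
uses the potential of `dir (j + 1)`. -/
theorem gain_nonpos_of_potential {i j : ℕ} (hi : i < N) (hj : j < N)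
    (h : planeDet (-C.dir i) (C.ray i) ≠ 0) (hout : j + 1 < N → C.dir (j + 1) ≠ 0)
    (h1 : C.dir (j + 1) ≠ 0 → C.potential i (C.offset ξ i j) (C.dir (j + 1)) ≤ 0)
    (h2 : C.ray j ≠ 0 → C.potential i (C.offset ξ i j) (C.ray j) ≤ 0) : C.gain ξ i j ≤ 0 := by
  have hcount : ∀ r, C.IsDirection r → (r ≠ 0 → C.potential i (C.offset ξ i j) r ≤ 0) →
      C.count i (C.offset ξ i j) r ≤ 0 := by
    intro r hr hpot
    by_cases hr0 : r = 0
    · simp [hr0, count]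
    · exact (C.count_le_potential hξ hi hj hr).trans (hpot hr0)
  have e1 := hcount _ (C.isDirection_dir (k := j + 1) hj) h1
  have e2 := hcount _ (C.isDirection_ray hj.le) h2
  have e3 : 0 ≤ C.potential i (C.offset ξ i j) (C.dir j) := wallPotential_nonneg h
  unfold gain
  split_ifs with hN
  · linarith [h1 (hout hN)]
  · linarith

/-- A ray parallel to a positive wall, starting next to it, never crosses this wall. Whatever it
meets of the other walls, a positive crossing does not come first, so both outgoing potentials
vanish. -/
theorem gain_nonpos_of_mem_left_wall {i j : ℕ} (hi : i < N) (hj : j < N)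
    (h : planeDet (-C.dir i) (C.ray i) ≠ 0) (hout : j + 1 < N → C.dir (j + 1) ≠ 0)
    {s : ℝ} (hs : 0 < s) (hpos : C.pos j - C.pos i = s • -C.dir i)
    (h1 : planeDet (C.dir i) (C.dir (j + 1)) = 0) (h2 : planeDet (C.dir i) (C.ray j) = 0) :
    C.gain ξ i j ≤ 0 := by
  have hD := _root_.mul_pos hs (mul_self_pos.2 h)
  have ha := hξ.mul_pos hi hj (C.isDirection_ray hi.le)
    (x := -planeDet (-C.dir i) (C.ray i)) (by
      rw [hpos, planeDet_smul_right, planeDet_swap (C.ray i)]; nlinarith)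
  have hab := hξ.mul_pos hi hj (C.isDirection_neg_dir (k := i + 1) hi)
    (x := -planeDet (-C.dir i) (C.ray i)) (by
      rw [← C.neg_dir_add_ray hi, hpos, planeDet_smul_right, planeDet_add_left, planeDet_self,
        planeDet_swap (C.ray i)]; nlinarith)
  rw [← C.neg_dir_add_ray hi, planeDet_add_left, planeDet_swap (C.ray i)] at hab
  rw [planeDet_swap (C.ray i)] at ha
  have key : ∀ r, planeDet (C.dir i) r = 0 →
      ¬ WallFirstHit (-C.dir i) (C.ray i) (C.offset ξ i j) r := by
    intro r hr
    unfold WallFirstHit FirstHit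
    have hσ : planeDet (-C.dir i) r = 0 := by rw [planeDet_neg_left, hr, neg_zero]
    have hα : 0 < planeDet (C.offset ξ i j) (C.ray i) / planeDet (-C.dir i) (C.ray i) := by
      rw [div_pos_iff]
      rcases lt_or_gt_of_ne h with h' | h'
      · exact Or.inr ⟨by nlinarith, h'⟩
      · exact Or.inl ⟨by nlinarith, h'⟩
    have hαβ : planeDet (-C.dir i) (C.offset ξ i j) / planeDet (-C.dir i) (C.ray i) <
        planeDet (C.offset ξ i j) (C.ray i) / planeDet (-C.dir i) (C.ray i) := by
      rw [← sub_pos, ← sub_div, div_pos_iff]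
      rcases lt_or_gt_of_ne h with h' | h'
      · exact Or.inr ⟨by nlinarith, h'⟩
      · exact Or.inl ⟨by nlinarith, h'⟩
    rw [hσ, zero_div]
    rintro (h | h | h | h | h) <;> linarith [h.1, h.2.1, h.2.2.1, h.2.2.2]
  exact C.gain_nonpos_of_potential hξ hi hj h hout
    (fun h0 => (C.potential_eq_zero_of_not h h0 (key _ h1)).le)
    (fun h0 => (C.potential_eq_zero_of_not h h0 (key _ h2)).le)

theorem gain_nonpos_of_mem_right_wall {i j : ℕ} (hi : i < N) (hj : j < N)
    (h : planeDet (-C.dir i) (C.ray i) ≠ 0) (hout : j + 1 < N → C.dir (j + 1) ≠ 0)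
    {s : ℝ} (hs : 0 < s) (hpos : C.pos j - C.pos i = s • C.ray i)
    (h1 : planeDet (C.ray i) (C.dir (j + 1)) = 0) (h2 : planeDet (C.ray i) (C.ray j) = 0) :
    C.gain ξ i j ≤ 0 := by
  have hD := _root_.mul_pos hs (mul_self_pos.2 h)
  have hb := hξ.mul_pos hi hj (C.isDirection_neg_dir hi.le)
    (x := planeDet (-C.dir i) (C.ray i)) (by
      rw [hpos, planeDet_smul_right]; nlinarith)
  have hab := hξ.mul_pos hi hj (C.isDirection_neg_dir (k := i + 1) hi)
    (x := planeDet (-C.dir i) (C.ray i)) (by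
      rw [← C.neg_dir_add_ray hi, hpos, planeDet_smul_right, planeDet_add_left, planeDet_self]
      nlinarith)
  rw [← C.neg_dir_add_ray hi, planeDet_add_left, planeDet_swap (C.ray i)] at hab
  have key : ∀ r, planeDet (C.ray i) r = 0 →
      ¬ WallFirstHit (-C.dir i) (C.ray i) (C.offset ξ i j) r := by
    intro r hr
    unfold WallFirstHit FirstHit
    have hρ : planeDet r (C.ray i) = 0 := by rw [planeDet_swap, hr, neg_zero]
    have hβ : 0 < planeDet (-C.dir i) (C.offset ξ i j) / planeDet (-C.dir i) (C.ray i) := by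
      rw [div_pos_iff]
      rcases lt_or_gt_of_ne h with h' | h'
      · exact Or.inr ⟨by nlinarith, h'⟩
      · exact Or.inl ⟨by nlinarith, h'⟩
    have hαβ : planeDet (C.offset ξ i j) (C.ray i) / planeDet (-C.dir i) (C.ray i) <
        planeDet (-C.dir i) (C.offset ξ i j) / planeDet (-C.dir i) (C.ray i) := by
      rw [← sub_pos, ← sub_div, div_pos_iff]
      rcases lt_or_gt_of_ne h with h' | h'
      · exact Or.inr ⟨by nlinarith, h'⟩
      · exact Or.inl ⟨by nlinarith, h'⟩
    rw [hρ, zero_div]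
    rintro (h | h | h | h | h) <;> linarith [h.1, h.2.1, h.2.2.1, h.2.2.2]
  exact C.gain_nonpos_of_potential hξ hi hj h hout
    (fun h0 => (C.potential_eq_zero_of_not h h0 (key _ h1)).le)
    (fun h0 => (C.potential_eq_zero_of_not h h0 (key _ h2)).le)

/-- The potential of a ray parallel to the edge leaving `i` from a point on that edge. -/
theorem potential_of_behind {i j : ℕ} (hi : i < N) (hj : j < N)
    (h : planeDet (-C.dir i) (C.ray i) ≠ 0) {s : ℝ} (hs : 0 < s)
    (hpos : C.pos j - C.pos i = s • C.dir (i + 1)) {r : ℝ × ℝ} {ν : ℝ} (hν : ν ≠ 0)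
    (hr : r = ν • C.dir (i + 1)) :
    C.potential i (C.offset ξ i j) r = if ν < 0 then 1 else 0 := by
  have hsum := C.neg_dir_add_ray hi
  have hd : C.dir (i + 1) = -(-C.dir i + C.ray i) := by rw [hsum, neg_neg]
  have hp : planeDet (-C.dir i) (C.dir (i + 1)) = -planeDet (-C.dir i) (C.ray i) := by
    rw [hd, planeDet_neg_right, planeDet_add_right, planeDet_self, zero_add]
  have hq : planeDet (C.ray i) (C.dir (i + 1)) = planeDet (-C.dir i) (C.ray i) := by
    rw [hd, planeDet_neg_right, planeDet_add_right, planeDet_self, add_zero, planeDet_swap,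
      neg_neg]
  have hD := mul_self_pos.2 h
  have h1 := hξ.mul_pos hi hj (C.isDirection_neg_dir hi.le)
    (x := -planeDet (-C.dir i) (C.ray i)) (by
      rw [hpos, planeDet_smul_right, hp]
      nlinarith [_root_.mul_pos hs hD])
  have h2 := hξ.mul_pos hi hj (C.isDirection_ray hi.le)
    (x := planeDet (-C.dir i) (C.ray i)) (by
      rw [hpos, planeDet_smul_right, hq]
      nlinarith [_root_.mul_pos hs hD])
  have hd0 : C.dir (i + 1) ≠ 0 := by
    intro h0; rw [h0] at hq; simp at hq; exact h hq.symm
  have hr0 : r ≠ 0 := by rw [hr]; exact smul_ne_zero hν hd0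
  have h3 : planeDet (-C.dir i) (C.offset ξ i j) / planeDet (-C.dir i) (C.ray i) < 0 := by
    rw [div_neg_iff]
    rcases lt_or_gt_of_ne h with h' | h'
    · exact Or.inl ⟨by nlinarith, h'⟩
    · exact Or.inr ⟨by nlinarith, h'⟩
  have h4 : planeDet (C.offset ξ i j) (C.ray i) / planeDet (-C.dir i) (C.ray i) < 0 := by
    rw [planeDet_swap, div_neg_iff]
    rcases lt_or_gt_of_ne h with h' | h'
    · exact Or.inl ⟨by nlinarith, h'⟩
    · exact Or.inr ⟨by nlinarith, h'⟩
  have e1 : planeDet r (C.ray i) / planeDet (-C.dir i) (C.ray i) = -ν := by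
    rw [hr, planeDet_smul_left, planeDet_swap, hq, mul_neg, neg_div, mul_div_assoc, div_self h,
      mul_one]
  have e2 : planeDet (-C.dir i) r / planeDet (-C.dir i) (C.ray i) = -ν := by
    rw [hr, planeDet_smul_right, hp, mul_neg, neg_div, mul_div_assoc, div_self h, mul_one]
  unfold potential wallPotential
  rw [if_neg h, if_neg hr0]
  congr 1
  unfold WallFirstHit FirstHit
  rw [e1, e2, eq_iff_iff]
  constructor
  · rintro (h | h | h | h | h) <;> linarith [h.1, h.2.1, h.2.2.1, h.2.2.2]
  · exact fun h => Or.inr (Or.inr (Or.inr (Or.inr ⟨h4, h3, by linarith, by linarith⟩)))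

/-- On the extension of the forward edge of i the potential tells whether a direction points back to
i. If both outgoing edges at j point away, the gain has no positive term; otherwise at most one of
them points back, and so does `dir j`, whose potential 1 is subtracted. -/
theorem gain_nonpos_of_behind {i j : ℕ} (hi : i < N) (hj : j < N)
    (h : planeDet (-C.dir i) (C.ray i) ≠ 0) {s : ℝ} (hs : 0 < s)
    (hpos : C.pos j - C.pos i = s • C.dir (i + 1)) {ν ν' : ℝ} (hν : ν ≠ 0) (hν' : ν' ≠ 0)
    (h1 : C.dir (j + 1) = ν • C.dir (i + 1)) (h2 : C.ray j = ν' • C.dir (i + 1))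
    (hpos' : 0 < ν ∨ 0 < ν') (hneg : (0 < ν ∧ 0 < ν') ∨ ν' + ν < 0) : C.gain ξ i j ≤ 0 := by
  have p1 := C.potential_of_behind hξ hi hj h hs hpos hν h1
  have p2 := C.potential_of_behind hξ hi hj h hs hpos hν' h2
  have c1 := C.count_le_potential hξ hi hj (C.isDirection_dir (k := j + 1) hj)
  have c2 := C.count_le_potential hξ hi hj (C.isDirection_ray hj.le)
  have p3 : 0 ≤ C.potential i (C.offset ξ i j) (C.dir j) := wallPotential_nonneg h
  have hg : C.gain ξ i j ≤ C.potential i (C.offset ξ i j) (C.dir (j + 1))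
      + C.potential i (C.offset ξ i j) (C.ray j) - C.potential i (C.offset ξ i j) (C.dir j) := by
    unfold gain
    split_ifs <;> linarith
  rcases hneg with ⟨hn1, hn2⟩ | hn
  · rw [if_neg hn1.not_gt] at p1
    rw [if_neg hn2.not_gt] at p2
    linarith
  · have p4 := C.potential_of_behind hξ hi hj h hs hpos hn.ne
      (r := C.dir j) (by rw [C.balance j hj, h1, h2, add_smul])
    rw [if_pos hn] at p4
    rcases hpos' with hp | hp
    · rw [if_neg hp.not_gt] at p1
      split_ifs at p2 <;> linarith
    · rw [if_neg hp.not_gt] at p2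
      split_ifs at p1 <;> linarith

end

end PlaneCaterpillar

/-! ### Crossings of balanced stars -/

/-- The point z lies in the open sector spanned by x and y. A balanced star at z that is not zero
has an edge with a negative coordinate, since otherwise all of them would vanish. This edge leaves
the sector through one of its sides; the sign of `planeDet z (f k)` tells which. -/
theorem exists_hit_of_sector {x y z : ℝ × ℝ} {f : Fin 3 → ℝ × ℝ} (hf : f 0 + f 1 + f 2 = 0)
    (hne : ∃ k, f k ≠ 0) (hz : ∀ k, f k ≠ 0 → planeDet (f k) z ≠ 0)
    (h : planeDet x y ≠ 0) (hx : 0 < planeDet x z * planeDet x y)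
    (hy : planeDet y z * planeDet x y < 0) :
    ∃ k, (0 < planeDet z (f k) * planeDet x (f k) ∧ 0 < planeDet z x * planeDet x (f k)) ∨
      (0 < planeDet z (f k) * planeDet y (f k) ∧ 0 < planeDet z y * planeDet y (f k)) := by
  set D := planeDet x y with hD
  have hDD := mul_self_pos.2 h
  have hcomb : ∀ r, planeDet z r * D = -planeDet y z * planeDet x r - planeDet x z * planeDet r y := by
    intro r; simp only [hD, planeDet]; ring
  have key : ∃ k, planeDet (f k) y * D < 0 ∨ planeDet x (f k) * D < 0 := by
    by_contra hcon
    push Not at hcon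
    have hs1 : planeDet (f 0) y + planeDet (f 1) y + planeDet (f 2) y = 0 := by
      rw [← planeDet_add_left, ← planeDet_add_left, hf, planeDet_zero_left]
    have hs2 : planeDet x (f 0) + planeDet x (f 1) + planeDet x (f 2) = 0 := by
      rw [← planeDet_add_right, ← planeDet_add_right, hf, planeDet_zero_right]
    have t1 : planeDet (f 0) y * D + planeDet (f 1) y * D + planeDet (f 2) y * D = 0 := by
      rw [← add_mul, ← add_mul, hs1, zero_mul]
    have t2 : planeDet x (f 0) * D + planeDet x (f 1) * D + planeDet x (f 2) * D = 0 := by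
      rw [← add_mul, ← add_mul, hs2, zero_mul]
    obtain ⟨k, hk⟩ := hne
    have z1 : planeDet (f k) y * D = 0 := by
      have h0 := (hcon 0).1; have h1 := (hcon 1).1; have h2 := (hcon 2).1
      fin_cases k <;> simp only [Fin.zero_eta, Fin.mk_one, Fin.reduceFinMk] <;> linarith
    have z2 : planeDet x (f k) * D = 0 := by
      have h0 := (hcon 0).2; have h1 := (hcon 1).2; have h2 := (hcon 2).2
      fin_cases k <;> simp only [Fin.zero_eta, Fin.mk_one, Fin.reduceFinMk] <;> linarith
    have z1' := (mul_eq_zero.1 z1).resolve_right h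
    have z2' := (mul_eq_zero.1 z2).resolve_right h
    have := hcomb (f k)
    rw [z1', z2'] at this
    have hz' : planeDet z (f k) = 0 := by
      have h3 : planeDet z (f k) * D = 0 := by linarith
      exact (mul_eq_zero.1 h3).resolve_right h
    exact hz k hk (by rw [planeDet_swap, hz', neg_zero])
  obtain ⟨k, hk⟩ := key
  have hfk : f k ≠ 0 := by
    rintro h0
    rw [h0] at hk
    simp at hk
  have hc0 : planeDet z (f k) ≠ 0 := by
    rw [planeDet_swap]; exact neg_ne_zero.2 (hz k hfk)
  have hc := hcomb (f k)
  have sw1 : planeDet z x = -planeDet x z := planeDet_swap _ _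
  have sw2 : planeDet z y = -planeDet y z := planeDet_swap _ _
  have sw3 : planeDet y (f k) = -planeDet (f k) y := planeDet_swap _ _
  refine ⟨k, ?_⟩
  rw [sw1, sw2, sw3]
  obtain ⟨α, hα⟩ : ∃ α, α = -(planeDet y z * D) := ⟨_, rfl⟩
  obtain ⟨β, hβ⟩ : ∃ β, β = planeDet x z * D := ⟨_, rfl⟩
  obtain ⟨ρ, hρ⟩ : ∃ ρ, ρ = planeDet (f k) y * D := ⟨_, rfl⟩
  obtain ⟨σ, hσ⟩ : ∃ σ, σ = planeDet x (f k) * D := ⟨_, rfl⟩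
  obtain ⟨c, hcc⟩ : ∃ c, c = planeDet z (f k) * D := ⟨_, rfl⟩
  have hα0 : 0 < α := by rw [hα]; linarith
  have hβ0 : 0 < β := by rw [hβ]; exact hx
  have hceq : c * (D * D) = α * σ - β * ρ := by
    rw [hcc, hc, hα, hβ, hρ, hσ]; ring
  have hcne : c ≠ 0 := by rw [hcc]; exact mul_ne_zero hc0 h
  have g1 : planeDet z (f k) * planeDet x (f k) * (D * D) = c * σ := by rw [hcc, hσ]; ring
  have g2 : -planeDet x z * planeDet x (f k) * (D * D) = -(β * σ) := by rw [hβ, hσ]; ring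
  have g3 : planeDet z (f k) * -planeDet (f k) y * (D * D) = -(c * ρ) := by rw [hcc, hρ]; ring
  have g4 : -planeDet y z * -planeDet (f k) y * (D * D) = -(α * ρ) := by rw [hα, hρ]; ring
  have pull : ∀ {u w : ℝ}, u * (D * D) = w → 0 < w → 0 < u := fun h1 h2 =>
    pos_of_mul_pos_left (h1 ▸ h2) hDD.le
  rw [← hρ, ← hσ] at hk
  rcases lt_or_gt_of_ne hcne with hneg | hpos
  · have hσ0 : σ < 0 := by
      rcases hk with hk | hk
      · by_contra hcon
        push Not at hcon
        nlinarith [mul_nonneg hα0.le hcon, mul_neg_of_pos_of_neg hβ0 hk, mul_neg_of_neg_of_pos hneg hDD]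
      · exact hk
    exact Or.inl ⟨pull g1 (mul_pos_of_neg_of_neg hneg hσ0), pull g2 (by nlinarith)⟩
  · have hρ0 : ρ < 0 := by
      rcases hk with hk | hk
      · exact hk
      · by_contra hcon
        push Not at hcon
        nlinarith [mul_nonneg hβ0.le hcon, mul_neg_of_pos_of_neg hα0 hk, mul_pos hpos hDD]
    exact Or.inr ⟨pull g3 (by nlinarith), pull g4 (by nlinarith)⟩

theorem exists_pos_of_sum_eq_zero {x : Fin 3 → ℝ} (h : x 0 + x 1 + x 2 = 0)
    (hne : ∃ k, x k ≠ 0) {y : ℝ} (hy : y ≠ 0) : ∃ k, 0 < y * x k := by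
  by_contra hcon
  push Not at hcon
  have hs : y * x 0 + y * x 1 + y * x 2 = 0 := by rw [← mul_add, ← mul_add, h, mul_zero]
  obtain ⟨k, hk⟩ := hne
  apply hk
  have h0 := hcon 0; have h1 := hcon 1; have h2 := hcon 2
  have : y * x k = 0 := by
    fin_cases k <;> simp only [Fin.zero_eta, Fin.mk_one, Fin.reduceFinMk] <;> linarith
  exact (mul_eq_zero.1 this).resolve_left hy

/-- If the directions e span the plane, the star at z starts in one of the three sectors between
them and has to leave it. If they lie on a line, balancing yields an edge f l from z towards this
line and an edge e k on the half of the line where it arrives. -/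
theorem exists_hit_of_stars {e f : Fin 3 → ℝ × ℝ} {z : ℝ × ℝ} (he : e 0 + e 1 + e 2 = 0)
    (hf : f 0 + f 1 + f 2 = 0) (hze : ∀ k, e k ≠ 0 → planeDet (e k) z ≠ 0)
    (hzf : ∀ k, f k ≠ 0 → planeDet (f k) z ≠ 0) (hne : ∃ k l, planeDet (e k) (f l) ≠ 0) :
    ∃ k l, 0 < planeDet z (f l) * planeDet (e k) (f l) ∧
      0 < planeDet z (e k) * planeDet (e k) (f l) := by
  obtain ⟨k₀, l₀, hkl⟩ := hne
  have hf0 : ∃ k, f k ≠ 0 := ⟨l₀, by rintro h; rw [h] at hkl; simp at hkl⟩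
  have e2 : e 2 = -(e 0 + e 1) := (neg_eq_of_add_eq_zero_right he).symm
  by_cases h : planeDet (e 0) (e 1) = 0
  · set τ := e k₀ with hτ
    have hτ0 : τ ≠ 0 := by intro h0; rw [h0] at hkl; simp at hkl
    have hpar : ∀ k, planeDet τ (e k) = 0 := by
      have h01 := h
      have h10 : planeDet (e 1) (e 0) = 0 := by rw [planeDet_swap, h, neg_zero]
      intro k
      rw [hτ]
      fin_cases k₀ <;> fin_cases k <;>
        simp [e2, planeDet_add_left, planeDet_add_right, planeDet_neg_left, planeDet_neg_right,
          h01, h10]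
    choose π hπ using fun k => exists_smul_of_planeDet_eq_zero hτ0 (hpar k)
    have hzτ : planeDet z τ ≠ 0 := by
      rw [planeDet_swap]; exact neg_ne_zero.2 (hze k₀ hτ0)
    obtain ⟨l, hl⟩ := exists_pos_of_sum_eq_zero (x := fun l => planeDet τ (f l))
      (by
        show planeDet τ (f 0) + planeDet τ (f 1) + planeDet τ (f 2) = 0
        rw [← planeDet_add_right, ← planeDet_add_right, hf, planeDet_zero_right])
      ⟨l₀, hkl⟩ hzτ
    have hfl : f l ≠ 0 := by rintro h0; simp [h0] at hl
    have hzl : planeDet z (f l) ≠ 0 := by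
      rw [planeDet_swap]; exact neg_ne_zero.2 (hzf l hfl)
    have hτl : planeDet τ (f l) ≠ 0 := by intro h0; simp [h0] at hl
    have hπ1 : ∃ k, π k ≠ 0 := ⟨k₀, by
      intro h0; have := hπ k₀; rw [h0, zero_smul] at this; exact hτ0 this⟩
    have hπs : π 0 + π 1 + π 2 = 0 := by
      have : (π 0 + π 1 + π 2) • τ = 0 := by
        rw [add_smul, add_smul, ← hπ, ← hπ, ← hπ, he]
      exact (smul_eq_zero.1 this).resolve_right hτ0
    obtain ⟨k, hk⟩ := exists_pos_of_sum_eq_zero hπs hπ1 (mul_ne_zero hzl hτl)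
    refine ⟨k, l, ?_, ?_⟩
    · rw [hπ k, planeDet_smul_left]; linarith
    · rw [hπ k, planeDet_smul_left, planeDet_smul_right]
      have hk0 : π k ≠ 0 := by intro h0; simp [h0] at hk
      have := mul_pos hl (mul_self_pos.2 hk0)
      have e : planeDet z τ * planeDet τ (f l) * (π k * π k) =
        π k * planeDet z τ * (π k * planeDet τ (f l)) := by ring
      rwa [e] at this
  · have hs : planeDet (e 0) z + planeDet (e 1) z + planeDet (e 2) z = 0 := by
      rw [← planeDet_add_left, ← planeDet_add_left, he, planeDet_zero_left]
    have h12 : planeDet (e 1) (e 2) = planeDet (e 0) (e 1) := by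
      rw [e2, planeDet_neg_right, planeDet_add_right, planeDet_self, add_zero, planeDet_swap,
        neg_neg]
    have h20 : planeDet (e 2) (e 0) = planeDet (e 0) (e 1) := by
      rw [e2, planeDet_neg_left, planeDet_add_left, planeDet_self, zero_add, planeDet_swap,
        neg_neg]
    have he0 : e 0 ≠ 0 := by rintro h0; rw [h0] at h; simp at h
    have he1 : e 1 ≠ 0 := by rintro h0; rw [h0] at h; simp at h
    have he2' : e 2 ≠ 0 := by rintro h0; rw [h0] at h12; simp at h12; exact h h12.symm
    set D := planeDet (e 0) (e 1) with hD
    have hs' : planeDet (e 0) z * D + planeDet (e 1) z * D + planeDet (e 2) z * D = 0 := by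
      rw [← add_mul, ← add_mul, hs, zero_mul]
    have n0 : planeDet (e 0) z * D ≠ 0 := mul_ne_zero (hze 0 he0) h
    have n1 : planeDet (e 1) z * D ≠ 0 := mul_ne_zero (hze 1 he1) h
    have n2 : planeDet (e 2) z * D ≠ 0 := mul_ne_zero (hze 2 he2') h
    have fin : (0 < planeDet (e 0) z * D ∧ planeDet (e 1) z * D < 0) ∨
        (0 < planeDet (e 1) z * D ∧ planeDet (e 2) z * D < 0) ∨
        (0 < planeDet (e 2) z * D ∧ planeDet (e 0) z * D < 0) := by
      rcases lt_or_gt_of_ne n0 with a | a <;> rcases lt_or_gt_of_ne n1 with b | b <;>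
        rcases lt_or_gt_of_ne n2 with c | c <;>
        first
        | exact Or.inl ⟨a, b⟩
        | exact Or.inr (Or.inl ⟨b, c⟩)
        | exact Or.inr (Or.inr ⟨c, a⟩)
        | (exfalso; linarith)
    rcases fin with ⟨a, b⟩ | ⟨a, b⟩ | ⟨a, b⟩
    · obtain ⟨l, hl | hl⟩ := exists_hit_of_sector hf hf0 hzf h a b
      · exact ⟨0, l, hl⟩
      · exact ⟨1, l, hl⟩
    · obtain ⟨l, hl | hl⟩ := exists_hit_of_sector (x := e 1) (y := e 2) hf hf0 hzf (by rwa [h12])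
        (by rwa [h12]) (by rwa [h12])
      · exact ⟨1, l, hl⟩
      · exact ⟨2, l, hl⟩
    · obtain ⟨l, hl | hl⟩ := exists_hit_of_sector (x := e 2) (y := e 0) hf hf0 hzf (by rwa [h20])
        (by rwa [h20]) (by rwa [h20])
      · exact ⟨2, l, hl⟩
      · exact ⟨0, l, hl⟩

/-! ### Crossings of segments and rays -/

/-- The segment or ray from the origin in direction `p` and the one from `δ` in direction `r`, of
the lengths `l` and `m` (or infinite), cross transversally. -/
def EdgeCross (δ p r : ℝ × ℝ) (l m : Option ℝ) : Prop :=
  planeDet p r ≠ 0 ∧ ∃ s t : ℝ, 0 < s ∧ 0 < t ∧ (∀ x ∈ l, s < x) ∧ (∀ x ∈ m, t < x) ∧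
    s • p = δ + t • r

/-- The crossing number of two segments or rays, in terms of crossing numbers of rays. -/
noncomputable def edgeHits (δ p r : ℝ × ℝ) (l m : Option ℝ) : ℤ :=
  rayHit δ p r - l.elim 0 (fun x => rayHit (δ - x • p) p r)
    - m.elim 0 (fun y => rayHit (δ + y • r) p r)
    + l.elim 0 (fun x => m.elim 0 (fun y => rayHit (δ - x • p + y • r) p r))

-- With the parameters S and T of the intersection of the two lines, `edgeHits` for bounded edges is
-- the product ([0 < S] - [x < S]) * ([0 < T] - [y < T]) of two non-negative factors; an unbounded
-- edge loses the subtracted term.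
open Classical in
theorem indicator_le_edgeHits {δ p r : ℝ × ℝ} {l m : Option ℝ} (hl : ∀ x ∈ l, 0 < x)
    (hm : ∀ x ∈ m, 0 < x) : (if EdgeCross δ p r l m then 1 else 0) ≤ edgeHits δ p r l m := by
  by_cases h : planeDet p r = 0
  · rw [if_neg fun hc => hc.1 h]
    cases l <;> cases m <;> simp [edgeHits, rayHit_of_parallel h]
  set S := planeDet δ r / planeDet p r with hS
  set T := planeDet δ p / planeDet p r with hT
  have h' : planeDet r p = -planeDet p r := planeDet_swap _ _
  have hit : ∀ x y : ℝ, rayHit (δ - x • p + y • r) p r = if 0 < S - x ∧ 0 < T - y then 1 else 0 := by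
    intro x y
    unfold rayHit
    have e1 : planeDet (δ - x • p + y • r) r / planeDet p r = S - x := by
      rw [sub_eq_add_neg, ← neg_smul, planeDet_add_left, planeDet_add_left, planeDet_smul_left,
        planeDet_smul_left, planeDet_self, hS]
      field_simp; ring
    have e2 : planeDet (δ - x • p + y • r) p / planeDet p r = T - y := by
      rw [sub_eq_add_neg, ← neg_smul, planeDet_add_left, planeDet_add_left, planeDet_smul_left,
        planeDet_smul_left, planeDet_self, h', hT]
      field_simp; ring
    rw [e1, e2]
  have hit0 : rayHit δ p r = if 0 < S ∧ 0 < T then 1 else 0 := by simpa using hit 0 0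
  have hit1 : ∀ x : ℝ, rayHit (δ - x • p) p r = if 0 < S - x ∧ 0 < T then 1 else 0 := by
    intro x; simpa using hit x 0
  have hit2 : ∀ y : ℝ, rayHit (δ + y • r) p r = if 0 < S ∧ 0 < T - y then 1 else 0 := by
    intro y; simpa using hit 0 y
  have hcross : EdgeCross δ p r l m → 0 < S ∧ 0 < T ∧ (∀ x ∈ l, S < x) ∧ ∀ x ∈ m, T < x := by
    rintro ⟨-, s, t, hs, ht, hsl, htm, heq⟩
    have hδ : δ = s • p + (-t) • r := by rw [heq, neg_smul]; abel
    have e1 : S = s := by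
      rw [hS, hδ, planeDet_add_left, planeDet_smul_left, planeDet_smul_left, planeDet_self]
      field_simp; ring
    have e2 : T = t := by
      rw [hT, hδ, planeDet_add_left, planeDet_smul_left, planeDet_smul_left, planeDet_self, h']
      field_simp; ring
    rw [e1, e2]
    exact ⟨hs, ht, hsl, htm⟩
  by_cases hc : EdgeCross δ p r l m
  · rw [if_pos hc]
    obtain ⟨h1, h2, h3, h4⟩ := hcross hc
    cases l with
    | none =>
      cases m with
      | none => simp [edgeHits, hit0, h1, h2]
      | some y =>
        have := h4 y rfl
        simp [edgeHits, hit0, hit2, h1, h2, this.not_gt]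
    | some x =>
      have := h3 x rfl
      cases m with
      | none => simp [edgeHits, hit0, hit1, h1, h2, this.not_gt]
      | some y =>
        have := h4 y rfl
        simp [edgeHits, hit0, hit1, hit2, hit, h1, h2, (h3 x rfl).not_gt, this.not_gt]
  · rw [if_neg hc]
    cases l with
    | none =>
      cases m with
      | none => simp only [edgeHits, hit0, Option.elim]; split_ifs <;> norm_num
      | some y =>
        have := hm y rfl
        simp only [edgeHits, hit0, hit2, Option.elim]
        split_ifs with a b b <;> norm_num
        exact a ⟨b.1, by linarith [b.2]⟩
    | some x =>
      have := hl x rfl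
      cases m with
      | none =>
        simp only [edgeHits, hit0, hit1, Option.elim]
        split_ifs with a b b <;> norm_num
        exact a ⟨by linarith [b.1], b.2⟩
      | some y =>
        have := hm y rfl
        simp only [edgeHits, hit0, hit1, hit2, hit, Option.elim]
        by_cases a : 0 < S <;> by_cases b : 0 < T <;> by_cases c : 0 < S - x <;>
          by_cases d : 0 < T - y <;> simp only [a, b, c, d] <;> norm_num
        · exact b (by linarith)
        · exact a (by linarith)

/-! ### Crossings of the edges of a plane caterpillar -/

theorem EdgeCross.flip_left {δ p r : ℝ × ℝ} {l : ℝ} {m : Option ℝ}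
    (h : EdgeCross δ p r (some l) m) : EdgeCross (δ - l • p) (-p) r (some l) m := by
  obtain ⟨hd, s, t, hs, ht, hl, hm, heq⟩ := h
  refine ⟨by rw [planeDet_neg_left]; exact neg_ne_zero.2 hd, l - s, t,
    by linarith [hl l rfl], ht, by rintro x ⟨⟩; linarith, hm, ?_⟩
  rw [sub_smul, smul_neg, smul_neg, heq]; abel

theorem EdgeCross.flip_right {δ p r : ℝ × ℝ} {l : Option ℝ} {m : ℝ}
    (h : EdgeCross δ p r l (some m)) : EdgeCross (δ + m • r) p (-r) l (some m) := by
  obtain ⟨hd, s, t, hs, ht, hl, hm, heq⟩ := h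
  refine ⟨by rw [planeDet_neg_right]; exact neg_ne_zero.2 hd, s, m - t,
    hs, by linarith [hm m rfl], hl, by rintro x ⟨⟩; linarith, ?_⟩
  rw [sub_smul, smul_neg, smul_neg, heq]; abel

theorem eq_zero_of_smul_eq_smul {p r : ℝ × ℝ} {s t : ℝ} (h : planeDet p r ≠ 0)
    (heq : s • p = t • r) : s = 0 ∧ t = 0 := by
  constructor
  · have := congrArg (fun x => planeDet x r) heq
    simp only [planeDet_smul_left, planeDet_self, mul_zero] at this
    exact (mul_eq_zero.1 this).resolve_right h
  · have := congrArg (fun x => planeDet p x) heq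
    simp only [planeDet_smul_right, planeDet_self, mul_zero] at this
    exact (mul_eq_zero.1 this.symm).resolve_right h

theorem div_pos_iff_mul_pos {x y : ℝ} : 0 < x / y ↔ 0 < x * y := by
  rw [div_pos_iff, mul_pos_iff]

theorem div_neg_iff_mul_neg {x y : ℝ} : x / y < 0 ↔ x * y < 0 := by
  rw [div_neg_iff, mul_neg_iff]

namespace PlaneCaterpillar

variable {N : ℕ} (C : PlaneCaterpillar N) (ξ : ℝ × ℝ)

/-- The directions of the three edges at the vertex `k`: backward, sideways and forward. -/
def edgeDir (k : ℕ) : Fin 3 → ℝ × ℝ := ![-C.dir k, C.ray k, C.dir (k + 1)]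

/-- The lengths of the three edges at the vertex `k`, if bounded. -/
noncomputable def edgeLen (k : ℕ) : Fin 3 → Option ℝ :=
  ![if k = 0 then none else some (C.len (k - 1)), none, if k + 1 < N then some (C.len k) else none]

/-- The point `a` lies in the relative interior of the edge `κ` at the vertex `k`. -/
def OnEdge (k : ℕ) (κ : Fin 3) (a : ℝ × ℝ) : Prop :=
  ∃ s : ℝ, 0 < s ∧ (∀ x ∈ C.edgeLen k κ, s < x) ∧ a = C.pos k + s • C.edgeDir k κ

/-- A crossing after the shift by `ξ` between one of the first two edges at a vertex and one of
the last two edges at a later vertex, which accounts for the point `a`. -/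
def HasCrossing (a : ℝ × ℝ) : Prop :=
  ∃ i j : ℕ, ∃ b c : Fin 3, i < j ∧ j < N ∧ b ≠ 2 ∧ c ≠ 0 ∧
    EdgeCross (C.offset ξ i j) (C.edgeDir i b) (C.edgeDir j c) (C.edgeLen i b) (C.edgeLen j c) ∧
    (∃ s : ℝ, a = C.pos i + s • C.edgeDir i b) ∧ ∃ t : ℝ, a = C.pos j + t • C.edgeDir j c

theorem edgeDir_sum {k : ℕ} (hk : k < N) :
    C.edgeDir k 0 + C.edgeDir k 1 + C.edgeDir k 2 = 0 := by
  simp only [edgeDir, C.balance k hk, Matrix.cons_val]; abel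

theorem isDirection_edgeDir {k : ℕ} (hk : k < N) (κ : Fin 3) : C.IsDirection (C.edgeDir k κ) := by
  fin_cases κ
  · exact C.isDirection_neg_dir hk.le
  · exact C.isDirection_ray hk.le
  · exact C.isDirection_dir hk

theorem edgeLen_pos {k : ℕ} (hk : k < N) (κ : Fin 3) : ∀ x ∈ C.edgeLen k κ, 0 < x := by
  fin_cases κ
  · rcases k with _ | k
    · simp [edgeLen]
    · simpa [edgeLen] using C.len_pos k hk
  · simp [edgeLen]
  · by_cases h : k + 1 < N
    · simpa [edgeLen, h] using C.len_pos k h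
    · simp [edgeLen, h]

theorem exists_end {k : ℕ} (hk : k < N) (κ : Fin 3) : ∀ x ∈ C.edgeLen k κ,
    ∃ e < N, C.pos e = C.pos k + x • C.edgeDir k κ := by
  fin_cases κ
  · rcases k with _ | k
    · simp [edgeLen]
    · simp only [edgeLen, edgeDir]
      simp
      exact ⟨k, by omega, by rw [C.pos_succ k hk]; abel⟩
  · simp [edgeLen]
  · by_cases h : k + 1 < N
    · simp [edgeLen, edgeDir, h]
      exact ⟨k + 1, h, C.pos_succ k h⟩
    · simp [edgeLen, h]

theorem pairHits_eq {i j : ℕ} (hi : i < N) : C.pairHits ξ i j =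
    ∑ x ∈ ({0, 1} : Finset (Fin 3)) ×ˢ ({1, 2} : Finset (Fin 3)),
      edgeHits (C.offset ξ i j) (C.edgeDir i x.1) (C.edgeDir j x.2) (C.edgeLen i x.1)
        (C.edgeLen j x.2) := by
  have hj : ∀ k, j + 1 < N → C.offset ξ k j + C.len j • C.dir (j + 1) = C.offset ξ k (j + 1) :=
    fun k h => (C.offset_succ_right ξ h).symm
  rw [Finset.sum_product]
  rcases i with _ | i
  · by_cases h : j + 1 < N
    · simp [pairHits, upperHits, edgeHits, edgeDir, edgeLen, h, hj]; ring
    · simp [pairHits, upperHits, edgeHits, edgeDir, edgeLen, h]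
  · have hb : ∀ x, C.offset ξ (i + 1) x + C.len i • C.dir (i + 1) = C.offset ξ i x := by
      intro x; rw [C.offset_succ_left ξ hi]; abel
    by_cases h : j + 1 < N <;>
      simp [pairHits, upperHits, edgeHits, edgeDir, edgeLen, h, hj, hb] <;> ring

-- Each point is sent to the label of the crossing accounting for it. The map is injective, because
-- the point lies on the lines carrying the two unshifted edges, and these are not parallel.
open Classical in
theorem card_le_of_hasCrossing (S : Finset (ℝ × ℝ)) (hS : ∀ a ∈ S, C.HasCrossing ξ a) :
    (S.card : ℤ) ≤ ∑ j ∈ Finset.range N, ∑ i ∈ Finset.range j, C.pairHits ξ i j := by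
  choose! i j b c hij hjN hb hc hcr hs ht using hS
  set D : Finset ((Σ _ : ℕ, ℕ) × Fin 3 × Fin 3) :=
    ((Finset.range N).sigma fun j => Finset.range j) ×ˢ
      (({0, 1} : Finset (Fin 3)) ×ˢ ({1, 2} : Finset (Fin 3))) with hD
  set P : (Σ _ : ℕ, ℕ) × Fin 3 × Fin 3 → Prop := fun x =>
    EdgeCross (C.offset ξ x.1.2 x.1.1) (C.edgeDir x.1.2 x.2.1) (C.edgeDir x.1.1 x.2.2)
      (C.edgeLen x.1.2 x.2.1) (C.edgeLen x.1.1 x.2.2) with hP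
  have h1 : S.card ≤ (D.filter P).card := by
    refine Finset.card_le_card_of_injOn (fun a => (⟨j a, i a⟩, b a, c a)) ?_ ?_
    · intro a ha
      simp only [Finset.coe_filter, Set.mem_ofPred_eq, hD, Finset.mem_product, Finset.mem_sigma,
        Finset.mem_range]
      refine ⟨⟨⟨hjN a ha, hij a ha⟩, ?_, ?_⟩, hcr a ha⟩
      · have := hb a ha
        generalize b a = x at *
        fin_cases x <;> simp_all
      · have := hc a ha
        generalize c a = x at *
        fin_cases x <;> simp_all
    · intro a ha a' ha' heq
      simp only [Prod.mk.injEq, Sigma.mk.injEq, heq_eq_eq] at heq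
      obtain ⟨⟨e1, e2⟩, e3, e4⟩ := heq
      obtain ⟨s, h1⟩ := hs a ha
      obtain ⟨s', h2⟩ := hs a' ha'
      obtain ⟨t, h3⟩ := ht a ha
      obtain ⟨t', h4⟩ := ht a' ha'
      rw [← e2, ← e3] at h2
      rw [← e1, ← e4] at h4
      have hdiff : (s - s') • C.edgeDir (i a) (b a) = (t - t') • C.edgeDir (j a) (c a) := by
        rw [sub_smul, sub_smul]
        have e1 : s • C.edgeDir (i a) (b a) - s' • C.edgeDir (i a) (b a) = a - a' := by
          linear_combination h2 - h1
        have e2 : t • C.edgeDir (j a) (c a) - t' • C.edgeDir (j a) (c a) = a - a' := by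
          linear_combination h4 - h3
        rw [e1, e2]
      have := (eq_zero_of_smul_eq_smul (hcr a ha).1 hdiff).1
      rw [h1, h2, sub_eq_zero.1 this]
  calc (S.card : ℤ) ≤ ((D.filter P).card : ℤ) := by exact_mod_cast h1
    _ = ∑ x ∈ D, if P x then 1 else 0 := by
      rw [Finset.card_filter]; push_cast; rfl
    _ ≤ ∑ x ∈ D, edgeHits (C.offset ξ x.1.2 x.1.1) (C.edgeDir x.1.2 x.2.1)
        (C.edgeDir x.1.1 x.2.2) (C.edgeLen x.1.2 x.2.1) (C.edgeLen x.1.1 x.2.2) := by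
      refine Finset.sum_le_sum fun x hx => ?_
      simp only [hD, Finset.mem_product, Finset.mem_sigma, Finset.mem_range] at hx
      exact indicator_le_edgeHits (C.edgeLen_pos (hx.1.2.trans hx.1.1) _) (C.edgeLen_pos hx.1.1 _)
    _ = _ := by
      rw [hD, Finset.sum_product, Finset.sum_sigma]
      refine Finset.sum_congr rfl fun j hj => Finset.sum_congr rfl fun i hi => ?_
      rw [C.pairHits_eq ξ ((Finset.mem_range.1 hi).trans (Finset.mem_range.1 hj))]

variable {C ξ} (hξ : C.IsGenericShift ξ)

section
include hξ

/-- The parameters of the shifted crossing are quotients of determinants. All strict inequalities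
survive the shift, those at the far end of an edge being tested with the offset of that end. Only
for s = 0 or t = 0 does the shift itself decide, which is the content of `hs0` and `ht0`. -/
theorem edgeCross_of_meet {k k' : ℕ} (hk : k < N) (hk' : k' < N) {κ κ' : Fin 3} {a : ℝ × ℝ}
    {s t : ℝ} (hdet : planeDet (C.edgeDir k κ) (C.edgeDir k' κ') ≠ 0) (hs : 0 ≤ s) (ht : 0 ≤ t)
    (hsl : ∀ x ∈ C.edgeLen k κ, s < x) (htl : ∀ x ∈ C.edgeLen k' κ', t < x)
    (has : a = C.pos k + s • C.edgeDir k κ) (hat : a = C.pos k' + t • C.edgeDir k' κ')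
    (hs0 : s = 0 → 0 < planeDet (C.offset ξ k k') (C.edgeDir k' κ') *
      planeDet (C.edgeDir k κ) (C.edgeDir k' κ'))
    (ht0 : t = 0 → 0 < planeDet (C.offset ξ k k') (C.edgeDir k κ) *
      planeDet (C.edgeDir k κ) (C.edgeDir k' κ')) :
    EdgeCross (C.offset ξ k k') (C.edgeDir k κ) (C.edgeDir k' κ') (C.edgeLen k κ)
      (C.edgeLen k' κ') := by
  have hpd := C.isDirection_edgeDir hk κ
  have hrd := C.isDirection_edgeDir hk' κ'
  have hend := C.exists_end hk κ
  have hend' := C.exists_end hk' κ'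
  generalize C.edgeDir k κ = p at *
  generalize C.edgeDir k' κ' = r at *
  have hdet' : planeDet r p = -planeDet p r := planeDet_swap _ _
  have hpos : C.pos k' - C.pos k = s • p + (-t) • r := by
    rw [neg_smul, ← sub_eq_add_neg, sub_eq_sub_iff_add_eq_add, ← hat, has]; abel
  have hDD := mul_self_pos.2 hdet
  refine ⟨hdet, planeDet (C.offset ξ k k') r / planeDet p r,
    planeDet (C.offset ξ k k') p / planeDet p r, ?_, ?_, ?_, ?_, ?_⟩
  · rw [div_pos_iff_mul_pos]
    rcases hs.eq_or_lt with h | h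
    · exact hs0 h.symm
    · have := hξ.mul_pos hk hk' hrd (x := -planeDet p r) (by
        rw [hpos, planeDet_add_right, planeDet_smul_right, planeDet_smul_right, planeDet_self,
          hdet']
        nlinarith)
      rw [planeDet_swap] at this
      linarith
  · rw [div_pos_iff_mul_pos]
    rcases ht.eq_or_lt with h | h
    · exact ht0 h.symm
    · have := hξ.mul_pos hk hk' hpd (x := -planeDet p r) (by
        rw [hpos, planeDet_add_right, planeDet_smul_right, planeDet_smul_right, planeDet_self]
        nlinarith)
      rw [planeDet_swap] at this
      linarith
  · intro x hx
    obtain ⟨e, he, hpe⟩ := hend x hx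
    have hoff : C.offset ξ e k' = C.offset ξ k k' + (-x) • p := by
      simp only [offset, hpe, neg_smul]; abel
    have hpos' : C.pos k' - C.pos e = (s - x) • p + (-t) • r := by
      rw [hpe, ← sub_sub, hpos, sub_smul]; abel
    have := hξ.mul_pos he hk' hrd (x := planeDet p r) (by
      rw [hpos', planeDet_add_right, planeDet_smul_right, planeDet_smul_right, planeDet_self,
        hdet']
      nlinarith [hsl x hx])
    rw [hoff, planeDet_add_right, planeDet_smul_right, hdet', planeDet_swap] at this
    rw [← sub_neg, div_sub' hdet, div_neg_iff_mul_neg]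
    nlinarith
  · intro y hy
    obtain ⟨e, he, hpe⟩ := hend' y hy
    have hoff : C.offset ξ k e = C.offset ξ k k' + y • r := by
      simp only [offset, hpe]; abel
    have hpos' : C.pos e - C.pos k = s • p + (y - t) • r := by
      rw [hpe, add_sub_right_comm, hpos, sub_smul, neg_smul]; abel
    have := hξ.mul_pos hk he hpd (x := planeDet p r) (by
      rw [hpos', planeDet_add_right, planeDet_smul_right, planeDet_smul_right, planeDet_self]
      nlinarith [htl y hy])
    rw [hoff, planeDet_add_right, planeDet_smul_right, planeDet_swap] at this
    rw [← sub_neg, div_sub' hdet, div_neg_iff_mul_neg]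
    nlinarith
  · obtain ⟨D, hD⟩ : ∃ D, D = planeDet p r := ⟨_, rfl⟩
    rw [← hD] at hdet ⊢
    have hD' : D = p.1 * r.2 - p.2 * r.1 := hD
    ext <;> simp only [planeDet, Prod.smul_fst, Prod.smul_snd, Prod.fst_add, Prod.snd_add,
      smul_eq_mul] <;> field_simp <;> rw [hD'] <;> ring

end
end PlaneCaterpillar

/-! ### From meeting points to counted crossings -/

namespace PlaneCaterpillar

variable {N : ℕ} {C : PlaneCaterpillar N} {ξ : ℝ × ℝ}

theorem edgeLen_forward {k : ℕ} (h : k + 1 < N) : C.edgeLen k 2 = some (C.len k) := by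
  simp [edgeLen, h]

theorem edgeLen_backward (k : ℕ) : C.edgeLen (k + 1) 0 = some (C.len k) := by
  simp [edgeLen]

theorem edgeDir_backward (k : ℕ) : C.edgeDir (k + 1) 0 = -C.edgeDir k 2 := by
  simp [edgeDir]

variable (hξ : C.IsGenericShift ξ)

section
include hξ

/-- A bounded edge can be read from either end: the forward edge of k is the backward edge of k + 1,
and the backward edge of k' is the forward edge of k' - 1. This brings every pair of non-adjacent
edges into the form counted by `HasCrossing`. -/
theorem hasCrossing_of_meet {k k' : ℕ} (hkk : k < k') (hk' : k' < N) {κ κ' : Fin 3} {a : ℝ × ℝ}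
    {s t : ℝ} (hdet : planeDet (C.edgeDir k κ) (C.edgeDir k' κ') ≠ 0) (hs : 0 ≤ s) (ht : 0 ≤ t)
    (hsl : ∀ x ∈ C.edgeLen k κ, s < x) (htl : ∀ x ∈ C.edgeLen k' κ', t < x)
    (has : a = C.pos k + s • C.edgeDir k κ) (hat : a = C.pos k' + t • C.edgeDir k' κ')
    (hs0 : s = 0 → 0 < planeDet (C.offset ξ k k') (C.edgeDir k' κ') *
      planeDet (C.edgeDir k κ) (C.edgeDir k' κ'))
    (ht0 : t = 0 → 0 < planeDet (C.offset ξ k k') (C.edgeDir k κ) *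
      planeDet (C.edgeDir k κ) (C.edgeDir k' κ')) :
    C.HasCrossing ξ a := by
  have hk : k < N := hkk.trans hk'
  have hcr := edgeCross_of_meet hξ hk hk' hdet hs ht hsl htl has hat hs0 ht0
  -- the same edges seen from their other ends
  have left : κ = 2 → k + 1 < k' → EdgeCross (C.offset ξ (k + 1) k') (C.edgeDir (k + 1) 0)
      (C.edgeDir k' κ') (C.edgeLen (k + 1) 0) (C.edgeLen k' κ') ∧
      ∃ s : ℝ, a = C.pos (k + 1) + s • C.edgeDir (k + 1) 0 := by
    rintro rfl h
    rw [edgeLen_forward (by omega)] at hcr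
    rw [edgeLen_backward, edgeDir_backward, C.offset_succ_left ξ (by omega),
      C.pos_succ k (by omega)]
    exact ⟨hcr.flip_left, C.len k - s, by
      rw [has]; simp only [edgeDir, Matrix.cons_val]; module⟩
  have right : ∀ m, k' = m + 1 → κ' = 0 → ∀ δ p l, EdgeCross δ p (C.edgeDir k' κ') l
      (C.edgeLen k' κ') → δ = C.offset ξ k k' ∨ δ = C.offset ξ (k + 1) k' →
      EdgeCross (δ - C.len m • C.dir (m + 1)) p (C.edgeDir m 2) l (C.edgeLen m 2) := by
    rintro m rfl rfl δ p l hc hδ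
    rw [edgeLen_backward] at hc
    rw [edgeLen_forward hk', ← neg_neg (C.edgeDir m 2), ← edgeDir_backward]
    have := hc.flip_right
    rwa [edgeDir_backward, smul_neg, ← sub_eq_add_neg] at this
  have hsub : ∀ m, k' = m + 1 → ∀ x, C.offset ξ x k' - C.len m • C.dir (m + 1) =
      C.offset ξ x m := by
    rintro m rfl x; rw [C.offset_succ_right ξ hk']; abel
  have hatm : ∀ m, k' = m + 1 → κ' = 0 → ∃ t : ℝ, a = C.pos m + t • C.edgeDir m 2 := by
    rintro m rfl rfl
    refine ⟨C.len m - t, ?_⟩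
    rw [hat, C.pos_succ m hk', edgeDir_backward]
    simp only [edgeDir, Matrix.cons_val]; module
  by_cases hκ : κ = 2
  · by_cases hκ' : κ' = 0
    · obtain ⟨m, rfl⟩ : ∃ m, k' = m + 1 := ⟨k' - 1, by omega⟩
      rcases lt_trichotomy (k + 1) m with h | h | h
      · obtain ⟨h1, h2⟩ := left hκ (by omega)
        have h3 := right m rfl hκ' _ _ _ h1 (Or.inr rfl)
        rw [hsub m rfl] at h3
        exact ⟨k + 1, m, 0, 2, h, by omega, by decide, by decide, h3, h2, hatm m rfl hκ'⟩
      -- The two edges share the vertex k + 1. As they are not parallel, they meet nowhere else, and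
      -- the strict bound on s excludes this end.
      · exfalso
        subst h hκ hκ'
        rw [edgeLen_forward (by omega)] at hsl
        rw [edgeDir_backward] at hat hdet
        rw [C.pos_succ (k + 1) hk', C.pos_succ k (by omega)] at hat
        have : (s - C.len k) • C.edgeDir k 2 = (C.len (k + 1) - t) • C.edgeDir (k + 1) 2 := by
          simp only [edgeDir, Matrix.cons_val] at has hat ⊢
          linear_combination (norm := module) hat - has
        have := (eq_zero_of_smul_eq_smul (by
          rw [planeDet_neg_right] at hdet; exact neg_ne_zero.1 hdet) this).1
        linarith [hsl _ rfl]
      · exfalso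
        obtain rfl : k = m := by omega
        subst hκ hκ'
        rw [edgeDir_backward, planeDet_neg_right, planeDet_self, neg_zero] at hdet
        exact hdet rfl
    · rcases Nat.lt_or_ge (k + 1) k' with h | h
      · obtain ⟨h1, h2⟩ := left hκ h
        exact ⟨k + 1, k', 0, κ', h, hk', by decide, hκ', h1, h2, t, hat⟩
      · exfalso
        obtain rfl : k' = k + 1 := by omega
        subst hκ
        rw [edgeLen_forward hk'] at hsl
        rw [C.pos_succ k hk'] at hat
        have : (s - C.len k) • C.edgeDir k 2 = t • C.edgeDir (k + 1) κ' := by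
          have e : C.edgeDir k 2 = C.dir (k + 1) := rfl
          rw [e] at has ⊢
          linear_combination (norm := module) hat - has
        have := (eq_zero_of_smul_eq_smul hdet this).1
        linarith [hsl _ rfl]
  · by_cases hκ' : κ' = 0
    · obtain ⟨m, rfl⟩ : ∃ m, k' = m + 1 := ⟨k' - 1, by omega⟩
      rcases Nat.lt_or_ge k m with h | h
      · have h3 := right m rfl hκ' _ _ _ hcr (Or.inl rfl)
        rw [hsub m rfl] at h3
        exact ⟨k, m, κ, 2, h, by omega, hκ, by decide, h3, ⟨s, has⟩, hatm m rfl hκ'⟩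
      · exfalso
        obtain rfl : m = k := by omega
        subst hκ'
        rw [edgeLen_backward] at htl
        rw [edgeDir_backward] at hat hdet
        rw [C.pos_succ m hk'] at hat
        have : s • C.edgeDir m κ = (C.len m - t) • C.edgeDir m 2 := by
          have e : C.edgeDir m 2 = C.dir (m + 1) := rfl
          rw [e] at hat ⊢
          linear_combination (norm := module) hat - has
        have := (eq_zero_of_smul_eq_smul (by
          rw [planeDet_neg_right] at hdet; exact neg_ne_zero.1 hdet) this).2
        linarith [htl _ rfl]
    · exact ⟨k, k', κ, κ', hkk, hk', hκ, hκ', hcr, ⟨s, has⟩, t, hat⟩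

theorem hasCrossing_of_transversal {k k' : ℕ} (hkk : k < k') (hk' : k' < N) {κ κ' : Fin 3}
    {a : ℝ × ℝ} (hdet : planeDet (C.edgeDir k κ) (C.edgeDir k' κ') ≠ 0) (h : C.OnEdge k κ a)
    (h' : C.OnEdge k' κ' a) : C.HasCrossing ξ a := by
  obtain ⟨s, hs, hsl, has⟩ := h
  obtain ⟨t, ht, htl, hat⟩ := h'
  exact hasCrossing_of_meet hξ hkk hk' hdet hs.le ht.le hsl htl has hat (fun h => (hs.ne' h).elim)
    (fun h => (ht.ne' h).elim)

theorem generic_edgeDir {i j k : ℕ} (hi : i < N) (hj : j < N) (hk : k < N) (κ : Fin 3)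
    (h : C.edgeDir k κ ≠ 0) : planeDet (C.edgeDir k κ) (C.offset ξ i j) ≠ 0 :=
  hξ.generic i hi j hj _ (C.isDirection_edgeDir hk κ) h

/-- The shift moves the vertex off the edge to one side. As its star is balanced and not parallel to
the edge, some edge of the star crosses back. -/
theorem hasCrossing_of_vertex_on_edge {k k' : ℕ} (hkk : k ≠ k') (hk : k < N) (hk' : k' < N)
    {κ' : Fin 3} (h : C.OnEdge k' κ' (C.pos k))
    (hdet : ∃ κ, planeDet (C.edgeDir k κ) (C.edgeDir k' κ') ≠ 0) :
    C.HasCrossing ξ (C.pos k) := by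
  obtain ⟨t, ht, htl, hat⟩ := h
  have hne : C.edgeDir k' κ' ≠ 0 := by
    rintro h0; obtain ⟨κ, h⟩ := hdet; rw [h0] at h; simp at h
  have hsum : planeDet (C.edgeDir k 0) (C.edgeDir k' κ') +
      planeDet (C.edgeDir k 1) (C.edgeDir k' κ') + planeDet (C.edgeDir k 2) (C.edgeDir k' κ') = 0 := by
    rw [← planeDet_add_left, ← planeDet_add_left, C.edgeDir_sum hk, planeDet_zero_left]
  have hself : C.pos k = C.pos k + (0 : ℝ) • C.edgeDir k 0 := by rw [zero_smul, add_zero]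
  rcases lt_or_gt_of_ne hkk with hlt | hlt
  · obtain ⟨κ, hκ⟩ := exists_pos_of_sum_eq_zero
      (x := fun κ => planeDet (C.edgeDir k κ) (C.edgeDir k' κ')) hsum hdet
      (y := planeDet (C.offset ξ k k') (C.edgeDir k' κ')) (by
        rw [planeDet_swap]; exact neg_ne_zero.2 (generic_edgeDir hξ hk hk' hk' _ hne))
    exact hasCrossing_of_meet hξ (κ := κ) (s := 0) hlt hk' (right_ne_zero_of_mul hκ.ne') le_rfl ht.le
      (C.edgeLen_pos hk κ) htl (by rw [zero_smul, add_zero]) hat (fun _ => hκ)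
      (fun h => (ht.ne' h).elim)
  · obtain ⟨κ, hκ⟩ := exists_pos_of_sum_eq_zero
      (x := fun κ => planeDet (C.edgeDir k κ) (C.edgeDir k' κ')) hsum hdet
      (y := -planeDet (C.offset ξ k' k) (C.edgeDir k' κ')) (by
        rw [neg_ne_zero, planeDet_swap]
        exact neg_ne_zero.2 (generic_edgeDir hξ hk' hk hk' _ hne))
    have e : planeDet (C.edgeDir k' κ') (C.edgeDir k κ) =
      -planeDet (C.edgeDir k κ) (C.edgeDir k' κ') := planeDet_swap _ _
    refine hasCrossing_of_meet hξ (κ' := κ) (t := 0) hlt hk ?_ ht.le le_rfl htl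
      (C.edgeLen_pos hk κ) hat (by rw [zero_smul, add_zero]) (fun h => (ht.ne' h).elim)
      (fun _ => ?_)
    · rw [e, neg_ne_zero]; exact right_ne_zero_of_mul hκ.ne'
    · rw [e]; linarith

theorem hasCrossing_of_coincident {k k' : ℕ} (hkk : k < k') (hk' : k' < N)
    (hpos : C.pos k = C.pos k') (hdet : ∃ κ κ', planeDet (C.edgeDir k κ) (C.edgeDir k' κ') ≠ 0) :
    C.HasCrossing ξ (C.pos k) := by
  have hk := hkk.trans hk'
  obtain ⟨κ, κ', h1, h2⟩ := exists_hit_of_stars (z := C.offset ξ k k') (C.edgeDir_sum hk)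
    (C.edgeDir_sum hk') (fun κ => generic_edgeDir hξ hk hk' hk κ)
    (fun κ => generic_edgeDir hξ hk hk' hk' κ) hdet
  exact hasCrossing_of_meet hξ (s := 0) (t := 0) hkk hk' (right_ne_zero_of_mul h1.ne') le_rfl
    le_rfl (C.edgeLen_pos hk κ) (C.edgeLen_pos hk' κ') (by rw [zero_smul, add_zero])
    (by rw [zero_smul, add_zero, hpos]) (fun _ => h1) (fun _ => h2)

end

/-! ### Points where non-adjacent edges meet -/

variable (C) in
/-- The point `a` lies on the images of two disjoint faces, which do not overlap there. -/
def IsMeeting (a : ℝ × ℝ) : Prop :=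
  (∃ k < N, ∃ k' < N, k < k' ∧ a = C.pos k ∧ a = C.pos k') ∨
  (∃ k < N, ∃ k' < N, ∃ κ', k ≠ k' ∧ a = C.pos k ∧ C.OnEdge k' κ' a) ∨
  (∃ k, ∃ k' < N, ∃ κ κ', k < k' ∧ planeDet (C.edgeDir k κ) (C.edgeDir k' κ') ≠ 0 ∧
    C.OnEdge k κ a ∧ C.OnEdge k' κ' a)

variable (C) in
/-- The vertex `k` is the only one at its position, and lies inside another edge, to which all
its edges are parallel. -/
def IsFlat (k : ℕ) : Prop :=
  k < N ∧ (∀ k' < N, k' ≠ k → C.pos k' ≠ C.pos k) ∧ ∃ k' < N, ∃ κ', k ≠ k' ∧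
    C.edgeDir k' κ' ≠ 0 ∧ C.OnEdge k' κ' (C.pos k) ∧
    ∀ κ, planeDet (C.edgeDir k κ) (C.edgeDir k' κ') = 0

/-- What fails to produce a crossing is a vertex all of whose edges are parallel to the edge, or to
the whole star, that it meets. -/
theorem IsMeeting.cases (hξ : C.IsGenericShift ξ) {a : ℝ × ℝ} (h : C.IsMeeting a) :
    C.HasCrossing ξ a ∨ (∃ k' < N, ∃ k < k', a = C.pos k ∧ a = C.pos k' ∧
      ∀ κ κ', planeDet (C.edgeDir k κ) (C.edgeDir k' κ') = 0) ∨
      ∃ k, C.IsFlat k ∧ a = C.pos k := by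
  by_contra hcon
  push Not at hcon
  obtain ⟨h1, h2, h3⟩ := hcon
  have multi : ∀ k < N, ∀ k' < N, k < k' → a = C.pos k → a ≠ C.pos k' := by
    rintro k hk k' hk' hlt rfl heq
    obtain ⟨κ, κ', hd⟩ := h2 k' hk' k hlt rfl heq
    exact h1 (hasCrossing_of_coincident hξ hlt hk' heq ⟨κ, κ', hd⟩)
  have uniq : ∀ k < N, ∀ k' < N, a = C.pos k → k' ≠ k → C.pos k' ≠ C.pos k := by
    intro k hk k' hk' ha hne heq
    rcases lt_or_gt_of_ne hne with hlt | hlt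
    · exact multi k' hk' k hk hlt (ha.trans heq.symm) ha
    · exact multi k hk k' hk' hlt ha (ha.trans heq.symm)
  rcases h with ⟨k, hk, k', hk', hlt, ha, ha'⟩ | ⟨k, hk, k', hk', κ', hne, ha, hon⟩ |
    ⟨k, k', hk', κ, κ', hlt, hdet, hon, hon'⟩
  · exact multi k hk k' hk' hlt ha ha'
  · refine h3 k ⟨hk, fun m hm => uniq k hk m hm ha, k', hk', κ', hne, ?_, ha ▸ hon, ?_⟩ ha
    · intro h0
      obtain ⟨s, -, -, hs⟩ := hon
      rw [h0, smul_zero, add_zero] at hs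
      exact uniq k hk k' hk' ha hne.symm (hs.symm.trans ha)
    · by_contra hcon
      push Not at hcon
      subst ha
      exact h1 (hasCrossing_of_vertex_on_edge hξ hne hk hk' hon hcon)
  · exact h1 (hasCrossing_of_transversal hξ hlt hk' hdet hon hon')

end PlaneCaterpillar

/-! ### Flat vertices and slack pairs -/

namespace PlaneCaterpillar

variable {N : ℕ} {C : PlaneCaterpillar N} {ξ : ℝ × ℝ}

theorem edgeDir_zero (k : ℕ) : C.edgeDir k 0 = -C.dir k := rfl

theorem edgeDir_two (k : ℕ) : C.edgeDir k 2 = C.dir (k + 1) := rfl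

theorem planeDet_edgeDir_eq_zero {k : ℕ} (hk : k < N) (h : planeDet (-C.dir k) (C.ray k) = 0)
    (κ κ' : Fin 3) : planeDet (C.edgeDir k κ) (C.edgeDir k κ') = 0 := by
  have h' : planeDet (C.dir k) (C.ray k) = 0 := by rwa [planeDet_neg_left, neg_eq_zero] at h
  have h'' : planeDet (C.ray k) (C.dir k) = 0 := by rw [planeDet_swap, h', neg_zero]
  have hd : C.dir (k + 1) = C.dir k - C.ray k := by rw [C.balance k hk]; abel
  fin_cases κ <;> fin_cases κ' <;>
    simp [edgeDir, hd, planeDet_self, planeDet_neg_left, planeDet_neg_right, sub_eq_add_neg, planeDet_add_left,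
      planeDet_add_right, h', h'']

theorem parallel_of_collinear {k : ℕ} (hk : k < N) (h : planeDet (-C.dir k) (C.ray k) = 0)
    {κ : Fin 3} (hne : C.edgeDir k κ ≠ 0) {τ : ℝ × ℝ} (hτ : planeDet τ (C.edgeDir k κ) = 0)
    (κ' : Fin 3) : planeDet τ (C.edgeDir k κ') = 0 :=
  planeDet_eq_zero_trans hne (by rw [planeDet_swap, hτ, neg_zero])
    (planeDet_edgeDir_eq_zero hk h κ κ')

variable (C) in
/-- The vertex `i` is the only one at its position, all its edges are parallel to `τ`, and it
lies inside another edge parallel to `τ`. -/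
def IsFlatAlong (τ : ℝ × ℝ) (i : ℕ) : Prop :=
  i < N ∧ (∀ k < N, k ≠ i → C.pos k ≠ C.pos i) ∧ (∀ κ, planeDet τ (C.edgeDir i κ) = 0) ∧
    ∃ k < N, ∃ κ, i ≠ k ∧ C.edgeDir k κ ≠ 0 ∧ planeDet τ (C.edgeDir k κ) = 0 ∧
      C.OnEdge k κ (C.pos i)

theorem IsFlat.exists_isFlatAlong {i : ℕ} (h : C.IsFlat i) : ∃ τ ≠ 0, C.IsFlatAlong τ i := by
  obtain ⟨hi, hu, k, hk, κ, hne, h0, hon, hpar⟩ := h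
  refine ⟨C.edgeDir k κ, h0, hi, hu, fun κ' => ?_, k, hk, κ, hne, h0, planeDet_self _, hon⟩
  rw [planeDet_swap, hpar, neg_zero]

section
variable {τ : ℝ × ℝ} {i : ℕ}

theorem IsFlatAlong.dir_ne_zero (h : C.IsFlatAlong τ (i + 1)) : C.dir (i + 1) ≠ 0 := by
  intro h0
  refine h.2.1 i (by have := h.1; omega) (by omega) ?_
  rw [C.pos_succ i h.1, h0, smul_zero, add_zero]

theorem IsFlatAlong.dir_succ_ne_zero (h : C.IsFlatAlong τ i) (hi : i + 1 < N) :
    C.dir (i + 1) ≠ 0 := by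
  intro h0
  refine h.2.1 (i + 1) hi (by omega) ?_
  rw [C.pos_succ i hi, h0, smul_zero, add_zero]

theorem IsFlatAlong.planeDet_dir (h : C.IsFlatAlong τ i) : planeDet τ (C.dir i) = 0 := by
  have := h.2.2.1 0; rwa [edgeDir_zero, planeDet_neg_right, neg_eq_zero] at this

theorem IsFlatAlong.planeDet_ray (h : C.IsFlatAlong τ i) : planeDet τ (C.ray i) = 0 :=
  h.2.2.1 1

theorem IsFlatAlong.planeDet_dir_succ (h : C.IsFlatAlong τ i) : planeDet τ (C.dir (i + 1)) = 0 :=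
  h.2.2.1 2

theorem IsFlatAlong.collinear (hτ : τ ≠ 0) (h : C.IsFlatAlong τ i) :
    planeDet (-C.dir i) (C.ray i) = 0 :=
  planeDet_eq_zero_trans hτ (h.2.2.1 0) (h.2.2.1 1)

variable (C) in
/-- The vertex `i` lies on the ray at a later vertex `j` or on the edge leaving `j`. -/
def LiesAbove (τ : ℝ × ℝ) (i j : ℕ) (c : Fin 3) : Prop :=
  i < j ∧ j < N ∧ c ≠ 0 ∧ C.edgeDir j c ≠ 0 ∧ planeDet τ (C.edgeDir j c) = 0 ∧
    C.OnEdge j c (C.pos i)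

variable (C) in
/-- The vertex `i` lies on the ray at an earlier vertex `k` or on the edge leading to `k`. -/
def LiesBelow (τ : ℝ × ℝ) (i k : ℕ) (b : Fin 3) : Prop :=
  k < i ∧ b ≠ 2 ∧ C.edgeDir k b ≠ 0 ∧ planeDet τ (C.edgeDir k b) = 0 ∧ C.OnEdge k b (C.pos i)

theorem OnEdge.flip_forward {k : ℕ} (hk : k + 1 < N) {a : ℝ × ℝ} (h : C.OnEdge k 2 a) :
    C.OnEdge (k + 1) 0 a := by
  obtain ⟨s, hs, hl, ha⟩ := h
  rw [edgeLen_forward hk] at hl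
  refine ⟨C.len k - s, by linarith [hl _ rfl], by rw [edgeLen_backward]; rintro _ ⟨⟩; linarith, ?_⟩
  rw [ha, edgeDir_two, edgeDir_zero, C.pos_succ k hk]; module

theorem OnEdge.flip_backward {k : ℕ} (hk : k + 1 < N) {a : ℝ × ℝ} (h : C.OnEdge (k + 1) 0 a) :
    C.OnEdge k 2 a := by
  obtain ⟨s, hs, hl, ha⟩ := h
  rw [edgeLen_backward] at hl
  refine ⟨C.len k - s, by linarith [hl _ rfl], by
    rw [edgeLen_forward hk]; rintro _ ⟨⟩; linarith, ?_⟩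
  rw [ha, edgeDir_two, edgeDir_zero, C.pos_succ k hk]; module

theorem not_onEdge_self {k : ℕ} {κ : Fin 3} (h : C.edgeDir k κ ≠ 0) : ¬ C.OnEdge k κ (C.pos k) := by
  rintro ⟨s, hs, -, ha⟩
  have : s • C.edgeDir k κ = 0 := by simpa using ha.symm
  exact (smul_ne_zero hs.ne' h) this

/-- The edge through the vertex is read from that end for which it is one of the edges attributed to
a pair of vertices. This end is never the vertex i itself, since an edge of non-zero direction does
not contain its own end in its interior. -/
theorem IsFlatAlong.lies (h : C.IsFlatAlong τ i) :
    (∃ j c, C.LiesAbove τ i j c) ∨ ∃ k b, C.LiesBelow τ i k b := by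
  obtain ⟨hi, -, -, k, hk, κ, hne, h0, hpar, hon⟩ := h
  rcases lt_or_gt_of_ne hne with hlt | hlt
  · by_cases hκ : κ = 0
    · obtain ⟨m, rfl⟩ : ∃ m, k = m + 1 := ⟨k - 1, by omega⟩
      subst hκ
      have h0' : C.edgeDir m 2 ≠ 0 := by
        rw [edgeDir_backward] at h0; exact neg_ne_zero.1 h0
      have hon' := hon.flip_backward hk
      have him : i ≠ m := by rintro rfl; exact not_onEdge_self h0' hon'
      refine Or.inl ⟨m, 2, by omega, by omega, by decide, h0', ?_, hon'⟩
      rwa [edgeDir_backward, planeDet_neg_right, neg_eq_zero] at hpar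
    · exact Or.inl ⟨k, κ, hlt, hk, hκ, h0, hpar, hon⟩
  · by_cases hκ : κ = 2
    · subst hκ
      have hk1 : k + 1 < N := by omega
      have h0' : C.edgeDir (k + 1) 0 ≠ 0 := by
        rw [edgeDir_backward]; exact neg_ne_zero.2 h0
      have hon' := hon.flip_forward hk1
      have him : i ≠ k + 1 := by rintro rfl; exact not_onEdge_self h0' hon'
      refine Or.inr ⟨k + 1, 0, by omega, by decide, h0', ?_, hon'⟩
      rwa [edgeDir_backward, planeDet_neg_right, neg_eq_zero]
    · exact Or.inr ⟨k, κ, hlt, hκ, h0, hpar, hon⟩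

variable (C ξ) in
/-- A pair of vertices in direction `τ` from each other without contribution to the number of
crossings. -/
def IsSlackAlong (τ : ℝ × ℝ) (i j : ℕ) : Prop :=
  i < j ∧ j < N ∧ C.gain ξ i j ≤ 0 ∧ ∃ l : ℝ, l ≠ 0 ∧ C.pos j - C.pos i = l • τ

theorem exists_smul_ne_zero {a b : ℝ × ℝ} (hb : b ≠ 0) (ha : a ≠ 0) (h : planeDet a b = 0) :
    ∃ x : ℝ, x ≠ 0 ∧ b = x • a := by
  obtain ⟨x, hx⟩ := exists_smul_of_planeDet_eq_zero ha h
  refine ⟨x, ?_, hx⟩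
  rintro rfl
  exact hb (by rw [hx, zero_smul])

theorem IsFlatAlong.exists_smul_of_ne (h : C.IsFlatAlong τ i) {j : ℕ} (hj : j < N) (hij : j ≠ i)
    (hτ : τ ≠ 0) (hpar : planeDet τ (C.pos j - C.pos i) = 0) :
    ∃ l : ℝ, l ≠ 0 ∧ C.pos j - C.pos i = l • τ :=
  exists_smul_ne_zero (sub_ne_zero.2 (h.2.1 j hj hij)) hτ hpar

section
variable (hξ : C.IsGenericShift ξ)
include hξ

/-- The flat vertex is the earlier one: its walls lie on the line through j, and one of the outgoing
directions at j is parallel to this line. -/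
theorem IsFlatAlong.isSlackAlong_of_liesAbove (hτ : τ ≠ 0) (h : C.IsFlatAlong τ i) {j : ℕ}
    {c : Fin 3} (hj : C.LiesAbove τ i j c) : C.IsSlackAlong ξ τ i j := by
  obtain ⟨hlt, hjN, hc, h0, hpar, s, hs, -, ha⟩ := hj
  obtain ⟨l, hl, hpos⟩ := h.exists_smul_of_ne hjN hlt.ne' hτ (by
    rw [ha, sub_add_cancel_left, planeDet_neg_right, planeDet_smul_right, hpar, mul_zero, neg_zero])
  refine ⟨hlt, hjN, (gain_eq_zero_of_line C hξ h.1 hjN hτ h.planeDet_dir h.planeDet_ray hl hpos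
    ?_).le, l, hl, hpos⟩
  fin_cases c
  · exact (hc rfl).elim
  · exact Or.inl hpar
  · exact Or.inr hpar

/-- The flat vertex is the later one: it sits on a positive wall at k, with all its edges parallel
to this wall. -/
theorem IsFlatAlong.isSlackAlong_of_liesBelow (hτ : τ ≠ 0) (h : C.IsFlatAlong τ i) {k : ℕ}
    {b : Fin 3} (hk : C.LiesBelow τ i k b) : C.IsSlackAlong ξ τ k i := by
  obtain ⟨hlt, hb, h0, hpar, s, hs, -, ha⟩ := hk
  have hkN := hlt.trans h.1
  obtain ⟨x, hx, hx'⟩ := exists_smul_ne_zero h0 hτ hpar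
  have hpos : C.pos i - C.pos k = s • C.edgeDir k b := by rw [ha, add_sub_cancel_left]
  refine ⟨hlt, h.1, ?_, s * x, mul_ne_zero hs.ne' hx, by rw [hpos, hx', smul_smul]⟩
  have hpar' : ∀ {v}, planeDet τ v = 0 → planeDet (C.edgeDir k b) v = 0 := by
    intro v hv; rw [hx', planeDet_smul_left, hv, mul_zero]
  by_cases hcol : planeDet (-C.dir k) (C.ray k) = 0
  · have hall := parallel_of_collinear hkN hcol h0 hpar
    refine (gain_eq_zero_of_parallel C hτ hcol h.1 ?_ (hall 1) h.planeDet_dir h.planeDet_ray).le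
    have := hall 0
    rwa [edgeDir_zero, planeDet_neg_right, neg_eq_zero] at this
  · fin_cases b
    · refine gain_nonpos_of_mem_left_wall C hξ hkN h.1 hcol h.dir_succ_ne_zero hs hpos ?_ ?_
      · have := hpar' h.planeDet_dir_succ
        simpa [edgeDir_zero, planeDet_neg_left] using this
      · have := hpar' h.planeDet_ray
        simpa [edgeDir_zero, planeDet_neg_left] using this
    · exact gain_nonpos_of_mem_right_wall C hξ hkN h.1 hcol h.dir_succ_ne_zero hs hpos
        (hpar' h.planeDet_dir_succ) (hpar' h.planeDet_ray)
    · exact (hb rfl).elim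

omit hξ in
theorem IsFlatAlong.isSlackAlong (hτ : τ ≠ 0) (h : C.IsFlatAlong τ i) {j : ℕ} (hij : i < j)
    (hj : C.IsFlatAlong τ j) (hpar : planeDet τ (C.pos j - C.pos i) = 0) :
    C.IsSlackAlong ξ τ i j :=
  ⟨hij, hj.1, (gain_eq_zero_of_parallel C hτ (h.collinear hτ) hj.1 h.planeDet_dir h.planeDet_ray
    hj.planeDet_dir hj.planeDet_ray).le, h.exists_smul_of_ne hj.1 hij.ne' hτ hpar⟩

/-- A pair of consecutive flat vertices which lie inside edges of each other. -/
theorem isSlackAlong_of_adjacent (hspan : ∀ τ ≠ 0, ∃ k < N, ∃ κ, planeDet τ (C.edgeDir k κ) ≠ 0)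
    (hτ : τ ≠ 0) (h : C.IsFlatAlong τ i) (h' : C.IsFlatAlong τ (i + 1)) {c b : Fin 3}
    (hc : C.LiesAbove τ i (i + 1) c) (hb : C.LiesBelow τ (i + 1) i b) :
    ∃ j k, C.IsSlackAlong ξ τ j k ∧ (j, k) ≠ (i, i + 1) ∧ (j = i ∨ j = i + 1 ∨ k = i ∨ k = i + 1) := by
  have hiN := h'.1
  have hd0 := h'.dir_ne_zero
  obtain ⟨z, hz, hdz⟩ := exists_smul_ne_zero hd0 hτ h.planeDet_dir_succ
  have hlen := C.len_pos i hiN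
  have hpos := C.pos_succ i hiN
  have hbal := C.balance i h.1
  have hbal' := C.balance (i + 1) hiN
  obtain ⟨-, -, hc0, -, -, s, hs, hsl, hsa⟩ := hc
  obtain ⟨-, hb2, -, -, t, ht, htl, hta⟩ := hb
  obtain ⟨x, hx, hxs, hec⟩ : ∃ x : ℝ, 0 < x ∧ x * s = C.len i ∧
      C.edgeDir (i + 1) c = (-x) • C.dir (i + 1) := by
    refine ⟨C.len i / s, by positivity, by field_simp, ?_⟩
    have e1 : s • C.edgeDir (i + 1) c = -(C.len i • C.dir (i + 1)) := by
      rw [hpos, add_assoc, left_eq_add] at hsa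
      exact eq_neg_of_add_eq_zero_right hsa
    have : C.edgeDir (i + 1) c = s⁻¹ • (s • C.edgeDir (i + 1) c) := by
      rw [smul_smul, inv_mul_cancel₀ hs.ne', one_smul]
    rw [this, e1]; module
  obtain ⟨y, hy, heb⟩ : ∃ y : ℝ, 0 < y ∧ C.edgeDir i b = y • C.dir (i + 1) := by
    refine ⟨C.len i / t, by positivity, ?_⟩
    have e1 : t • C.edgeDir i b = C.len i • C.dir (i + 1) := by
      rw [hpos] at hta; exact (add_left_cancel hta).symm
    have : C.edgeDir i b = t⁻¹ • (t • C.edgeDir i b) := by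
      rw [smul_smul, inv_mul_cancel₀ ht.ne', one_smul]
    rw [this, e1]; module
  -- the star at `i`
  obtain ⟨π, χ, hπ, hχ, hπχ⟩ : ∃ π χ : ℝ, -C.dir i = π • C.dir (i + 1) ∧
      C.ray i = χ • C.dir (i + 1) ∧ ((b = 0 ∧ π = y ∧ χ = -(1 + y)) ∨
        (b = 1 ∧ χ = y ∧ π = -(1 + y))) := by
    fin_cases b
    · refine ⟨y, -(1 + y), heb, ?_, Or.inl ⟨rfl, rfl, rfl⟩⟩
      have e : C.ray i = -(-C.dir i) - C.dir (i + 1) := by rw [hbal]; abel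
      rw [e, show -C.dir i = y • C.dir (i + 1) from heb]; module
    · refine ⟨-(1 + y), y, ?_, heb, Or.inr ⟨rfl, rfl, rfl⟩⟩
      rw [hbal, show C.ray i = y • C.dir (i + 1) from heb]; module
    · exact (hb2 rfl).elim
  -- the star at `i + 1`
  obtain ⟨μ, ν, hμ, hν, hμν⟩ : ∃ μ ν : ℝ, C.ray (i + 1) = μ • C.dir (i + 1) ∧
      C.dir (i + 2) = ν • C.dir (i + 1) ∧ ((c = 1 ∧ μ = -x ∧ ν = 1 + x) ∨
        (c = 2 ∧ ν = -x ∧ μ = 1 + x)) := by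
    fin_cases c
    · exact (hc0 rfl).elim
    · refine ⟨-x, 1 + x, hec, ?_, Or.inl ⟨rfl, rfl, rfl⟩⟩
      have e : C.dir (i + 2) = C.dir (i + 1) - C.ray (i + 1) := eq_sub_of_add_eq' hbal'.symm
      rw [e, show C.ray (i + 1) = (-x) • C.dir (i + 1) from hec]; module
    · refine ⟨1 + x, -x, ?_, hec, Or.inr ⟨rfl, rfl, rfl⟩⟩
      have e : C.ray (i + 1) = C.dir (i + 1) - C.dir (i + 2) := eq_sub_of_add_eq hbal'.symm
      rw [e, show C.dir (i + 2) = (-x) • C.dir (i + 1) from hec]; module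
  -- Each of the two vertices lies on an edge of the other, so the pair (i, i + 1) serves for both
  -- of them. The second pair is found with the next vertex on the chain, or with the previous one
  -- if there is no next.
  by_cases hN : i + 2 < N
  · have hlen' := C.len_pos (i + 1) hN
    have hpos' := C.pos_succ (i + 1) hN
    rcases hμν with ⟨rfl, hμ', hν'⟩ | ⟨rfl, hν', hμ'⟩
    -- Here both positive walls at i + 1 point back, while i + 2 lies ahead.
    · refine ⟨i + 1, i + 2, ⟨by omega, hN, (gain_eq_zero_of_behind C hξ hiN hN
        (τ := C.dir (i + 1)) (l := C.len (i + 1) * ν) (π := -1) (χ := μ) (by simp) hμ ?_ ?_ ?_).le,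
        C.len (i + 1) * ν * z, ?_, ?_⟩, by simp, by simp⟩
      · rw [hν']; positivity
      · rw [hpos', hν, smul_smul]; abel
      · rw [lineCount_of_pos (by rw [hν']; positivity), if_neg (by norm_num),
          if_neg (by linarith), if_neg (by linarith)]; norm_num
      · rw [hν']; positivity
      · rw [hpos', hν, hdz, smul_smul, smul_smul]; abel
    -- The forward edge at i + 1 runs back over i, so i + 2 lies beyond i. On that side one positive
    -- wall at i cancels against the negative one.
    · have hsl' : s < C.len (i + 1) := hsl _ (by rw [edgeLen_forward hN]; rfl)
      have hl : C.len i + C.len (i + 1) * ν < 0 := by rw [hν', ← hxs]; nlinarith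
      have hp : C.pos (i + 2) - C.pos i = (C.len i + C.len (i + 1) * ν) • C.dir (i + 1) := by
        rw [hpos', hpos, hν]; module
      refine ⟨i, i + 2, ⟨by omega, hN, (gain_eq_zero_of_behind C hξ h.1 hN hπ hχ hl.ne hp ?_).le,
        (C.len i + C.len (i + 1) * ν) * z, mul_ne_zero hl.ne hz, ?_⟩, by simp, by simp⟩
      · rw [lineCount_of_neg hl]
        rcases hπχ with ⟨-, e1, e2⟩ | ⟨-, e1, e2⟩
        · rw [if_neg (by linarith), if_pos (by linarith), if_pos (by linarith)]; norm_num
        · rw [if_pos (by linarith), if_neg (by linarith), if_pos (by linarith)]; norm_num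
      · rw [hp, hdz, smul_smul]
  -- A previous vertex exists because two flat vertices alone would not span the plane.
  · obtain ⟨m, rfl⟩ : ∃ m, i = m + 1 := by
      rcases i with _ | m
      · exfalso
        obtain ⟨k, hk, κ, hκ⟩ := hspan τ hτ
        obtain rfl | rfl : k = 0 ∨ k = 1 := by omega
        · exact hκ (h.2.2.1 κ)
        · exact hκ (h'.2.2.1 κ)
      · exact ⟨m, rfl⟩
    have hm : m < N := by omega
    have hdm : C.dir (m + 1) ≠ 0 := h.dir_ne_zero
    obtain ⟨w, hw, hdw⟩ := exists_smul_ne_zero hdm hτ h.planeDet_dir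
    have hlenm := C.len_pos m h.1
    have hposm := C.pos_succ m h.1
    have hcol : planeDet (-C.dir m) (C.ray m) = 0 → planeDet τ (C.dir m) = 0 ∧
        planeDet τ (C.ray m) = 0 := by
      intro hcol
      have hall := parallel_of_collinear hm hcol (κ := 2) hdm h.planeDet_dir
      have := hall 0
      rw [edgeDir_zero, planeDet_neg_right, neg_eq_zero] at this
      exact ⟨this, hall 1⟩
    rcases hπχ with ⟨rfl, e1, e2⟩ | ⟨rfl, e1, e2⟩
    -- The vertex i + 1 lies inside the edge from m to i; it is reached in the direction towards m,
    -- and one of its outgoing edges points away from m.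
    · have htl' : t < C.len m := htl _ (by rw [edgeLen_backward]; rfl)
      have hp : C.pos (m + 1 + 1) - C.pos m = (C.len m - t) • C.dir (m + 1) := by
        rw [hta, hposm, edgeDir_zero]; module
      refine ⟨m, m + 2, ⟨by omega, hiN, ?_, (C.len m - t) * w,
        mul_ne_zero (by linarith) hw, by rw [hp]; nth_rewrite 1 [hdw]; rw [smul_smul]⟩,
        by simp, by simp⟩
      by_cases hc : planeDet (-C.dir m) (C.ray m) = 0
      · exact (gain_eq_zero_of_parallel C hτ hc hiN (hcol hc).1 (hcol hc).2 h'.planeDet_dir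
          h'.planeDet_ray).le
      · have hd : C.dir (m + 1 + 1) = (-y⁻¹) • C.dir (m + 1) := by
          have : C.dir (m + 1) = (-y) • C.dir (m + 1 + 1) := by
            rw [neg_smul, ← e1, ← hπ, neg_neg]
          rw [this]
          rw [smul_smul, neg_mul_neg, inv_mul_cancel₀ hy.ne', one_smul]
        have hy' : 0 < y⁻¹ := inv_pos.2 hy
        refine gain_nonpos_of_behind C hξ hm hiN hc (by linarith : 0 < C.len m - t) hp
          (ν := ν * -y⁻¹) (ν' := μ * -y⁻¹) ?_ ?_ (by rw [hν, hd, smul_smul])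
          (by rw [hμ, hd, smul_smul]) ?_ (Or.inr ?_)
        · rcases hμν with ⟨-, f1, f2⟩ | ⟨-, f1, f2⟩ <;> rw [‹ν = _›] <;>
            exact mul_ne_zero (by linarith) (by linarith)
        · rcases hμν with ⟨-, f1, f2⟩ | ⟨-, f1, f2⟩ <;> rw [‹μ = _›] <;>
            exact mul_ne_zero (by linarith) (by linarith)
        · rcases hμν with ⟨-, f1, f2⟩ | ⟨-, f1, f2⟩
          · right; rw [f1]; nlinarith
          · left; rw [f1]; nlinarith
        · rcases hμν with ⟨-, f1, f2⟩ | ⟨-, f1, f2⟩ <;> rw [f1, f2] <;> nlinarith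
    -- Both outgoing edges at i point away from m.
    · have hp : C.pos (m + 1) - C.pos m = C.len m • C.dir (m + 1) := by
        rw [hposm, add_sub_cancel_left]
      refine ⟨m, m + 1, ⟨by omega, h.1, ?_, C.len m * w, mul_ne_zero hlenm.ne' hw, by
        rw [hp]; nth_rewrite 1 [hdw]; rw [smul_smul]⟩, by simp, by simp⟩
      by_cases hc : planeDet (-C.dir m) (C.ray m) = 0
      · exact (gain_eq_zero_of_parallel C hτ hc h.1 (hcol hc).1 (hcol hc).2 h.planeDet_dir
          h.planeDet_ray).le
      · have hd : C.dir (m + 1 + 1) = (1 + y)⁻¹ • C.dir (m + 1) := by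
          have : C.dir (m + 1) = (1 + y) • C.dir (m + 1 + 1) := by
            rw [← neg_neg (C.dir (m + 1)), hπ, e2]; module
          rw [this]
          rw [smul_smul, inv_mul_cancel₀ (by linarith), one_smul]
        have hy' : 0 < (1 + y)⁻¹ := by positivity
        have hyy : 0 < y * (1 + y)⁻¹ := by positivity
        exact gain_nonpos_of_behind C hξ hm h.1 hc hlenm hp
          (ν := (1 + y)⁻¹) (ν' := y * (1 + y)⁻¹) hy'.ne' hyy.ne' hd
          (by rw [hχ, hd, smul_smul, e1]) (Or.inl hy') (Or.inl ⟨hy', hyy⟩)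

theorem exists_isSlackAlong_of_two
    (hspan : ∀ τ ≠ 0, ∃ k < N, ∃ κ, planeDet τ (C.edgeDir k κ) ≠ 0) (hτ : τ ≠ 0)
    (h : C.IsFlatAlong τ i) {i' : ℕ} (hii : i < i') (h' : C.IsFlatAlong τ i')
    (hpar : planeDet τ (C.pos i' - C.pos i) = 0) :
    ∃ j k, C.IsSlackAlong ξ τ j k ∧ (j, k) ≠ (i, i') ∧ (j = i ∨ j = i' ∨ k = i ∨ k = i') := by
  rcases Nat.lt_or_ge (i + 1) i' with hlt | hge
  -- The edge arriving at i' is parallel to τ, so the vertex before i' lies on the same line and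
  -- gives a second slack pair with i.
  · obtain ⟨m, rfl⟩ : ∃ m, i' = m + 1 := ⟨i' - 1, by omega⟩
    have hm : m < N := by have := h'.1; omega
    obtain ⟨l, hl, hp⟩ := h.exists_smul_of_ne hm (by omega) hτ (by
      have e : C.pos m - C.pos i = (C.pos (m + 1) - C.pos i) - C.len m • C.dir (m + 1) := by
        rw [C.pos_succ m h'.1]; abel
      rw [e, planeDet_sub_right, hpar, planeDet_smul_right, h'.planeDet_dir]; simp)
    exact ⟨i, m, ⟨by omega, hm, (gain_eq_zero_of_line C hξ h.1 hm hτ h.planeDet_dir h.planeDet_ray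
      hl hp (Or.inr h'.planeDet_dir)).le, l, hl, hp⟩, by simp, by simp⟩
  · obtain rfl : i' = i + 1 := by omega
    rcases h.lies with ⟨j, c, hj⟩ | ⟨k, b, hk⟩
    · by_cases hji : j = i + 1
      · subst hji
        rcases h'.lies with ⟨j', c', hj'⟩ | ⟨k, b, hk⟩
        · have := hj'.1
          exact ⟨i + 1, j', h'.isSlackAlong_of_liesAbove hξ hτ hj', by simp, by simp⟩
        · by_cases hki : k = i
          · subst hki
            exact isSlackAlong_of_adjacent hξ hspan hτ h h' hj hk
          · exact ⟨k, i + 1, h'.isSlackAlong_of_liesBelow hξ hτ hk, by simp [hki], by simp⟩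
      · exact ⟨i, j, h.isSlackAlong_of_liesAbove hξ hτ hj, by simp [hji], by simp⟩
    · have := hk.1
      exact ⟨k, i, h.isSlackAlong_of_liesBelow hξ hτ hk, by simp, by simp⟩

/-- There are at least as many slack pairs along a line as flat vertices. -/
theorem exists_finset_isSlackAlong
    (hspan : ∀ τ ≠ 0, ∃ k < N, ∃ κ, planeDet τ (C.edgeDir k κ) ≠ 0) (hτ : τ ≠ 0)
    (S : Finset ℕ) (hS : ∀ i ∈ S, C.IsFlatAlong τ i)
    (hpar : ∀ i ∈ S, ∀ j ∈ S, planeDet τ (C.pos j - C.pos i) = 0) :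
    ∃ T : Finset (ℕ × ℕ), S.card ≤ T.card ∧
      ∀ p ∈ T, C.IsSlackAlong ξ τ p.1 p.2 ∧ (p.1 ∈ S ∨ p.2 ∈ S) := by
  classical
  rcases Nat.lt_or_ge S.card 3 with hlt | hge
  · interval_cases hcard : S.card
    · exact ⟨∅, le_rfl, by simp⟩
    · obtain ⟨i, rfl⟩ := Finset.card_eq_one.1 hcard
      have h := hS i (by simp)
      rcases h.lies with ⟨j, c, hj⟩ | ⟨k, b, hk⟩
      · exact ⟨{(i, j)}, by simp, by simpa using h.isSlackAlong_of_liesAbove hξ hτ hj⟩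
      · exact ⟨{(k, i)}, by simp, by simpa using h.isSlackAlong_of_liesBelow hξ hτ hk⟩
    · obtain ⟨i, j, hij, rfl⟩ := Finset.card_eq_two.1 hcard
      wlog hlt : i < j generalizing i j
      · rw [Finset.pair_comm] at hS hpar hcard ⊢
        exact this j i hij.symm hS hpar hcard (by omega)
      have hi := hS i (by simp)
      have hj := hS j (by simp)
      have hp := hpar i (by simp) j (by simp)
      obtain ⟨k, l, h1, h2, h3⟩ := exists_isSlackAlong_of_two hξ hspan hτ hi hlt hj hp
      refine ⟨{(i, j), (k, l)}, by rw [Finset.card_pair h2.symm], ?_⟩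
      simp only [Finset.mem_insert, Finset.mem_singleton, forall_eq_or_imp, forall_eq]
      exact ⟨⟨hi.isSlackAlong hτ hlt hj hp, by simp⟩, h1, by tauto⟩
  · have hne : S.Nonempty := Finset.card_pos.1 (by omega)
    set m := S.min' hne with hm
    set M := S.max' hne with hM
    have hmS : m ∈ S := S.min'_mem hne
    have hMS : M ∈ S := S.max'_mem hne
    obtain ⟨z, hz, hzmM⟩ : ∃ z ∈ S, z ∉ ({m, M} : Finset ℕ) := by
      by_contra hcon
      push Not at hcon
      have := Finset.card_le_card (show S ⊆ {m, M} from hcon)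
      have := Finset.card_le_two (a := m) (b := M)
      omega
    simp only [Finset.mem_insert, Finset.mem_singleton, not_or] at hzmM
    have hle : ∀ k ∈ S, m ≤ k ∧ k ≤ M := fun k hk => ⟨S.min'_le k hk, S.le_max' k hk⟩
    have hzz := hle z hz
    -- Any two flat vertices on the line form a slack pair, and k ≥ 3 points have at least k pairs.
    -- Those chosen here are all pairs containing m, together with (z, M).
    set f : ℕ → ℕ × ℕ := fun k => if k = m then (m, M) else if k = M then (z, M) else (m, k) with hf
    refine ⟨S.image f, ?_, ?_⟩
    · rw [Finset.card_image_of_injOn]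
      intro a ha b hb hab
      simp only [hf] at hab
      have := hle a ha
      have := hle b hb
      split_ifs at hab <;> simp only [Prod.mk.injEq] at hab <;> omega
    · intro p hp
      obtain ⟨k, hk, rfl⟩ := Finset.mem_image.1 hp
      have hkk := hle k hk
      simp only [hf]
      split_ifs with h1 h2
      · exact ⟨(hS m hmS).isSlackAlong hτ (by omega) (hS M hMS) (hpar m hmS M hMS), Or.inl hmS⟩
      · exact ⟨(hS z hz).isSlackAlong hτ (by omega) (hS M hMS) (hpar z hz M hMS), Or.inl hz⟩
      · exact ⟨(hS m hmS).isSlackAlong hτ (by omega) (hS k hk) (hpar m hmS k hk), Or.inl hmS⟩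

end
end
end PlaneCaterpillar

/-! ### The bound for the number of meeting points -/

namespace PlaneCaterpillar

variable {N : ℕ} {C : PlaneCaterpillar N} {ξ : ℝ × ℝ}

/-- Parallel stars have no transversal crossings, so all counts vanish. If the star at k' is zero,
the potential of a zero vector is added at most once and subtracted once. -/
theorem gain_nonpos_of_coincident {k k' : ℕ} (hk' : k' < N)
    (h : ∀ κ κ', planeDet (C.edgeDir k κ) (C.edgeDir k' κ') = 0) : C.gain ξ k k' ≤ 0 := by
  by_cases h' : ∃ κ', C.edgeDir k' κ' ≠ 0
  · obtain ⟨κ', hκ'⟩ := h'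
    have hpar : ∀ κ, planeDet (C.edgeDir k' κ') (C.edgeDir k κ) = 0 := fun κ => by
      rw [planeDet_swap, h, neg_zero]
    have hcol : planeDet (-C.dir k) (C.ray k) = 0 :=
      planeDet_eq_zero_trans hκ' (hpar 0) (hpar 1)
    by_cases h'' : ∃ κ, C.edgeDir k κ ≠ 0
    · obtain ⟨κ, hκ⟩ := h''
      have hpar' : ∀ κ'', planeDet (C.edgeDir k' κ') (C.edgeDir k' κ'') = 0 := fun κ'' =>
        planeDet_eq_zero_trans hκ (h κ κ') (h κ κ'')
      refine (gain_eq_zero_of_parallel C hκ' hcol hk' ?_ (hpar 1) ?_ (hpar' 1)).le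
      · have := hpar 0
        rwa [edgeDir_zero, planeDet_neg_right, neg_eq_zero] at this
      · have := hpar' 0
        rwa [edgeDir_zero, planeDet_neg_right, neg_eq_zero] at this
    · push Not at h''
      have h0 : -C.dir k = 0 := h'' 0
      have h1 : C.ray k = 0 := h'' 1
      rw [gain_eq_of_collinear C hcol]
      have : ∀ δ r, C.count k δ r = 0 := fun δ r => by
        unfold count
        rw [h0, h1, wallCount_of_parallel (planeDet_zero_left _) (planeDet_zero_left _)]
      simp [this]
  · push Not at h'
    have h0 : -C.dir k' = 0 := h' 0
    exact gain_nonpos_of_degenerate C hk' (neg_eq_zero.1 h0) (h' 1)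

/-- The line through `p` in direction `τ`. -/
def lineThrough (τ p : ℝ × ℝ) : Set (ℝ × ℝ) := {x | planeDet τ (x - p) = 0}

theorem lineThrough_smul {τ p q : ℝ × ℝ} {l : ℝ} (hl : l ≠ 0) (h : planeDet τ (q - p) = 0) :
    lineThrough (l • τ) q = lineThrough τ p := by
  ext x
  have e : x - p = (x - q) + (q - p) := by abel
  change planeDet (l • τ) (x - q) = 0 ↔ planeDet τ (x - p) = 0
  rw [e, planeDet_smul_left, planeDet_add_right, h, add_zero, mul_eq_zero]
  simp [hl]

theorem parallel_of_lineThrough_eq {τ τ' p q : ℝ × ℝ} (h : lineThrough τ p = lineThrough τ' q) :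
    planeDet τ (q - p) = 0 ∧ planeDet τ τ' = 0 := by
  have h1 : q ∈ lineThrough τ p := by
    rw [h]; show planeDet τ' (q - q) = 0; rw [sub_self, planeDet_zero_right]
  have h2 : q + τ' ∈ lineThrough τ p := by
    rw [h]; show planeDet τ' (q + τ' - q) = 0; rw [add_sub_cancel_left, planeDet_self]
  refine ⟨h1, ?_⟩
  have h2' : planeDet τ (q + τ' - p) = 0 := h2
  have h1' : planeDet τ (q - p) = 0 := h1
  rw [add_sub_right_comm, planeDet_add_right, h1', zero_add] at h2'
  exact h2'

theorem IsFlatAlong.congr {τ τ' : ℝ × ℝ} {i : ℕ} (h : C.IsFlatAlong τ i) (hτ : τ ≠ 0)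
    (h' : planeDet τ τ' = 0) : C.IsFlatAlong τ' i := by
  obtain ⟨h1, h2, h3, k, hk, κ, h4, h5, h6, h7⟩ := h
  exact ⟨h1, h2, fun κ => planeDet_eq_zero_trans hτ h' (h3 κ), k, hk, κ, h4, h5,
    planeDet_eq_zero_trans hτ h' h6, h7⟩

section
variable (hξ : C.IsGenericShift ξ)
include hξ

-- The flat vertices are sorted by the line containing their star. A slack pair of distinct
-- positions determines the line it spans, so the pairs found for different lines are different.
open Classical in
theorem card_flat_le (hspan : ∀ τ ≠ 0, ∃ k < N, ∃ κ, planeDet τ (C.edgeDir k κ) ≠ 0)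
    (B : Finset ℕ) (hB : ∀ k ∈ B, C.IsFlat k) :
    B.card ≤ (((Finset.range N).sigma fun j => Finset.range j).filter fun x =>
      C.gain ξ x.2 x.1 ≤ 0 ∧ C.pos x.2 ≠ C.pos x.1).card := by
  set Q := ((Finset.range N).sigma fun j => Finset.range j).filter fun x =>
      C.gain ξ x.2 x.1 ≤ 0 ∧ C.pos x.2 ≠ C.pos x.1 with hQ
  choose! τ hτ hflat using fun k (hk : k ∈ B) => (hB k hk).exists_isFlatAlong
  set line : ℕ → Set (ℝ × ℝ) := fun k => lineThrough (τ k) (C.pos k) with hline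
  set pairLine : (Σ _ : ℕ, ℕ) → Set (ℝ × ℝ) := fun x =>
    lineThrough (C.pos x.1 - C.pos x.2) (C.pos x.2) with hpairLine
  calc B.card = ∑ ℓ ∈ B.image line, (B.filter fun k => line k = ℓ).card :=
        Finset.card_eq_sum_card_image line B
    _ ≤ ∑ ℓ ∈ B.image line, (Q.filter fun x => pairLine x = ℓ).card := by
        refine Finset.sum_le_sum fun ℓ hℓ => ?_
        obtain ⟨k₀, hk₀, rfl⟩ := Finset.mem_image.1 hℓ
        have hrel : ∀ k ∈ B.filter fun k => line k = line k₀,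
            planeDet (τ k₀) (C.pos k - C.pos k₀) = 0 ∧ planeDet (τ k₀) (τ k) = 0 := by
          intro k hk
          exact parallel_of_lineThrough_eq (Finset.mem_filter.1 hk).2.symm
        obtain ⟨T, hT, hslack⟩ := exists_finset_isSlackAlong hξ hspan (hτ k₀ hk₀)
          (B.filter fun k => line k = line k₀)
          (fun k hk => (hflat k (Finset.mem_filter.1 hk).1).congr
            (hτ k (Finset.mem_filter.1 hk).1) (by rw [planeDet_swap, (hrel k hk).2, neg_zero]))
          (fun i hi j hj => by
            have e : C.pos j - C.pos i = (C.pos j - C.pos k₀) - (C.pos i - C.pos k₀) := by abel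
            rw [e, planeDet_sub_right, (hrel i hi).1, (hrel j hj).1, sub_zero])
        refine hT.trans (Finset.card_le_card_of_injOn (fun p => ⟨p.2, p.1⟩) ?_ ?_)
        · intro p hp
          obtain ⟨⟨h1, h2, h3, l, hl, h4⟩, hmem⟩ := hslack p hp
          simp only [hQ, Finset.coe_filter, Finset.mem_filter, Finset.mem_sigma, Finset.mem_range,
            Set.mem_ofPred_eq]
          refine ⟨⟨⟨h2, h1⟩, h3, ?_⟩, ?_⟩
          · intro heq
            rw [heq, sub_self] at h4
            exact (smul_ne_zero hl (hτ k₀ hk₀)) h4.symm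
          · simp only [hpairLine, hline]
            rw [h4]
            refine lineThrough_smul hl ?_
            rcases hmem with hmem | hmem
            · exact (hrel _ hmem).1
            · have e : C.pos p.1 - C.pos k₀ = (C.pos p.2 - C.pos k₀) - l • τ k₀ := by
                rw [← h4]; abel
              rw [e, planeDet_sub_right, (hrel _ hmem).1, planeDet_smul_right, planeDet_self]
              simp
        · rintro ⟨a, b⟩ - ⟨c, d⟩ - hab
          simp only [Sigma.mk.injEq, heq_eq_eq] at hab
          simp [hab]
    _ = ((B.image line).biUnion fun ℓ => Q.filter fun x => pairLine x = ℓ).card := by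
        rw [Finset.card_biUnion]
        intro ℓ _ ℓ' _ hne
        rw [Function.onFun, Finset.disjoint_left]
        intro x hx hx'
        exact hne ((Finset.mem_filter.1 hx).2.symm.trans (Finset.mem_filter.1 hx').2)
    _ ≤ Q.card := by
        refine Finset.card_le_card fun x hx => ?_
        obtain ⟨ℓ, -, hx⟩ := Finset.mem_biUnion.1 hx
        exact (Finset.mem_filter.1 hx).1

-- Each of the `N.choose 2` pairs contributes at most 1 to the number of crossings, and at most 0 if
-- it is slack. Slack pairs in distinct positions pay for the flat vertices, those in equal
-- positions for the coincident parallel stars.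
open Classical in
theorem card_meeting_le (hspan : ∀ τ ≠ 0, ∃ k < N, ∃ κ, planeDet τ (C.edgeDir k κ) ≠ 0)
    (S : Finset (ℝ × ℝ)) (hS : ∀ a ∈ S, C.IsMeeting a) : S.card ≤ N.choose 2 := by
  set D := (Finset.range N).sigma fun j => Finset.range j with hD
  set E := S.filter fun a => C.HasCrossing ξ a with hE
  set M := (S.filter fun a => ¬ C.HasCrossing ξ a).filter fun a => ∃ k' < N, ∃ k < k',
    a = C.pos k ∧ a = C.pos k' ∧ ∀ κ κ', planeDet (C.edgeDir k κ) (C.edgeDir k' κ') = 0 with hM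
  set F := (S.filter fun a => ¬ C.HasCrossing ξ a).filter fun a => ¬ ∃ k' < N, ∃ k < k',
    a = C.pos k ∧ a = C.pos k' ∧ ∀ κ κ', planeDet (C.edgeDir k κ) (C.edgeDir k' κ') = 0 with hF
  have hcard : S.card = E.card + (M.card + F.card) := by
    rw [hE, hM, hF, Finset.card_filter_add_card_filter_not, Finset.card_filter_add_card_filter_not]
  have hMQ : M.card ≤ (D.filter fun x =>
      C.gain ξ x.2 x.1 ≤ 0 ∧ ¬ C.pos x.2 ≠ C.pos x.1).card := by
    choose! k' hk' k hk hak hak' hdet using fun a (ha : a ∈ M) => (Finset.mem_filter.1 ha).2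
    refine Finset.card_le_card_of_injOn (fun a => ⟨k' a, k a⟩) ?_ ?_
    · intro a ha
      simp only [hD, Finset.coe_filter, Finset.mem_sigma, Finset.mem_range, Set.mem_ofPred_eq,
        not_not]
      exact ⟨⟨hk' a ha, hk a ha⟩, gain_nonpos_of_coincident (hk' a ha) (hdet a ha), (hak a ha).symm.trans (hak' a ha)⟩
    · intro a ha b hb hab
      simp only [Sigma.mk.injEq, heq_eq_eq] at hab
      rw [hak a ha, hak b hb, hab.2]
  have hFQ : F.card ≤ (D.filter fun x =>
      C.gain ξ x.2 x.1 ≤ 0 ∧ C.pos x.2 ≠ C.pos x.1).card := by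
    have hflat : ∀ a ∈ F, ∃ k, C.IsFlat k ∧ a = C.pos k := by
      intro a ha
      obtain ⟨ha, h2⟩ := Finset.mem_filter.1 ha
      obtain ⟨ha, h1⟩ := Finset.mem_filter.1 ha
      exact ((hS a ha).cases hξ).resolve_left h1 |>.resolve_left h2
    choose! k hk hak using hflat
    have h1 : F.card ≤ (F.image k).card := by
      rw [Finset.card_image_of_injOn]
      intro a ha b hb hab
      rw [hak a ha, hak b hb, hab]
    refine h1.trans (card_flat_le hξ hspan _ ?_)
    intro i hi
    obtain ⟨a, ha, rfl⟩ := Finset.mem_image.1 hi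
    exact hk a ha
  have hEX := (C.card_le_of_hasCrossing ξ E fun a ha => (Finset.mem_filter.1 ha).2).trans
    (pairHits_total_le C hξ)
  have hsplit : (D.filter fun x => C.gain ξ x.2 x.1 ≤ 0).card =
      (D.filter fun x => C.gain ξ x.2 x.1 ≤ 0 ∧ C.pos x.2 ≠ C.pos x.1).card +
      (D.filter fun x => C.gain ξ x.2 x.1 ≤ 0 ∧ ¬ C.pos x.2 ≠ C.pos x.1).card := by
    rw [← Finset.filter_filter, ← Finset.filter_filter, Finset.card_filter_add_card_filter_not]
  have hgain : ∑ j ∈ Finset.range N, ∑ i ∈ Finset.range j, C.gain ξ i j +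
      ((D.filter fun x => C.gain ξ x.2 x.1 ≤ 0).card : ℤ) ≤ D.card := by
    have e : ∑ j ∈ Finset.range N, ∑ i ∈ Finset.range j, C.gain ξ i j =
      ∑ x ∈ D, C.gain ξ x.2 x.1 := by rw [hD, Finset.sum_sigma]
    rw [e, Finset.card_filter, Finset.card_eq_sum_ones]
    push_cast
    rw [← Finset.sum_add_distrib]
    refine Finset.sum_le_sum fun x hx => ?_
    simp only [hD, Finset.mem_sigma, Finset.mem_range] at hx
    have := C.gain_le_one hξ (hx.2.trans hx.1) hx.1
    split_ifs with h <;> omega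
  have hDcard : D.card = N.choose 2 := by
    rw [hD, Finset.card_sigma]
    simp only [Finset.card_range]
    rw [Finset.sum_range_id, Nat.choose_two_right]
  rw [hDcard] at hgain
  zify
  rw [hcard]
  push_cast
  have h1 := Int.ofNat_le.2 hMQ
  have h2 := Int.ofNat_le.2 hFQ
  rw [hsplit] at hgain
  push_cast at hgain
  omega

end

variable (C) in
theorem finite_directions : {a | C.IsDirection a}.Finite := by
  have h := Set.finite_le_nat N
  refine ((h.image C.dir).union ((h.image fun k => -C.dir k).union
    ((h.image C.ray).union (h.image fun k => -C.ray k)))).subset ?_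
  rintro a ⟨k, hk, rfl | rfl | rfl | rfl⟩
  · exact Or.inl ⟨k, hk, rfl⟩
  · exact Or.inr (Or.inl ⟨k, hk, rfl⟩)
  · exact Or.inr (Or.inr (Or.inl ⟨k, hk, rfl⟩))
  · exact Or.inr (Or.inr (Or.inr ⟨k, hk, rfl⟩))

-- The shift is ε • (1, M) with a slope M different from those of all edges, and ε > 0 small. A
-- determinant that vanishes before the shift becomes a non-zero multiple of ε.
open Filter Topology in
variable (C) in
theorem exists_isGenericShift : ∃ ξ, C.IsGenericShift ξ := by
  obtain ⟨M, hM⟩ := (C.finite_directions.image fun a => a.2 / a.1).exists_notMem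
  have hdir : ∀ a, C.IsDirection a → a ≠ 0 → planeDet a (1, M) ≠ 0 := by
    intro a ha h0 hdet
    simp only [planeDet, mul_one] at hdet
    by_cases h1 : a.1 = 0
    · exact h0 (Prod.ext h1 (by rw [h1] at hdet; simpa using hdet))
    · exact hM ⟨a, ha, by field_simp; linarith⟩
  have key : ∀ᶠ ε in 𝓝[>] (0 : ℝ), ∀ i ∈ {i | i < N}, ∀ j ∈ {j | j < N},
      ∀ a ∈ {a | C.IsDirection a}, (a ≠ 0 → planeDet a (C.offset (ε • (1, M)) i j) ≠ 0) ∧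
        (0 < planeDet a (C.pos j - C.pos i) → 0 < planeDet a (C.offset (ε • (1, M)) i j)) := by
    refine (eventually_all_finite (Set.finite_lt_nat N)).2 fun i _ =>
      (eventually_all_finite (Set.finite_lt_nat N)).2 fun j _ =>
      (eventually_all_finite C.finite_directions).2 fun a ha => ?_
    have hcont : Continuous fun ε : ℝ => planeDet a (C.pos j - C.pos i) - ε * planeDet a (1, M) := by
      fun_prop
    have hval : ∀ ε : ℝ, planeDet a (C.offset (ε • (1, M)) i j) =
        planeDet a (C.pos j - C.pos i) - ε * planeDet a (1, M) := by
      intro ε; rw [offset, planeDet_sub_right, planeDet_smul_right]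
    have hlim : Tendsto (fun ε : ℝ => planeDet a (C.pos j - C.pos i) - ε * planeDet a (1, M))
        (𝓝[>] 0) (𝓝 (planeDet a (C.pos j - C.pos i))) := by
      have := (hcont.tendsto 0).mono_left (nhdsWithin_le_nhds (s := Set.Ioi 0))
      simpa using this
    simp only [hval]
    rcases lt_trichotomy (planeDet a (C.pos j - C.pos i)) 0 with h | h | h
    · filter_upwards [hlim.eventually (gt_mem_nhds h)] with ε hε
      exact ⟨fun _ => hε.ne, fun h' => absurd h' h.not_gt⟩
    · filter_upwards [self_mem_nhdsWithin] with ε hε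
      rw [h]
      refine ⟨fun h0 => ?_, fun h' => absurd h' (lt_irrefl 0)⟩
      rw [zero_sub, neg_ne_zero]
      exact mul_ne_zero (ne_of_gt hε) (hdir a ha h0)
    · filter_upwards [hlim.eventually (lt_mem_nhds h)] with ε hε
      exact ⟨fun _ => hε.ne', fun _ => hε⟩
  obtain ⟨ε, hε⟩ := key.exists
  exact ⟨ε • (1, M), fun i hi j hj a ha => (hε i hi j hj a ha).1,
    fun i hi j hj a ha => (hε i hi j hj a ha).2⟩

/-- A plane caterpillar with `N` vertices whose directions span the plane has at most
`N.choose 2` points where disjoint edges meet. -/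
theorem encard_meeting_le (hspan : ∀ τ ≠ 0, ∃ k < N, ∃ κ, planeDet τ (C.edgeDir k κ) ≠ 0) :
    {a | C.IsMeeting a}.encard ≤ (N.choose 2 : ℕ) := by
  obtain ⟨ξ, hξ⟩ := C.exists_isGenericShift
  by_contra hcon
  push Not at hcon
  obtain ⟨S, hS, hcard⟩ := Set.exists_subset_encard_eq (Order.add_one_le_of_lt hcon)
  have hfin : S.Finite := Set.finite_of_encard_eq_coe (k := N.choose 2 + 1) (by rw [hcard]; norm_cast)
  have := card_meeting_le hξ hspan hfin.toFinset fun a ha => hS (hfin.mem_toFinset.1 ha)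
  rw [hfin.encard_eq_coe_toFinset_card] at hcard
  have : hfin.toFinset.card = N.choose 2 + 1 := by exact_mod_cast hcard
  omega

end PlaneCaterpillar

/-! ### The spine of a caterpillar -/

theorem injective_triple {α : Type*} {x y z : α} (hx : z ≠ x) (hy : z ≠ y) (hxy : x ≠ y) :
    Function.Injective ![x, z, y] := by
  intro a b hab
  fin_cases a <;> fin_cases b <;> simp_all [eq_comm]

namespace TropicalLine

variable {n : ℕ} {V : Type*} [Fintype V]

/-- The inner vertices of a caterpillar in their order along a longest path, and the three
neighbours of each of them: the previous one, the one off the path, and the next one. -/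
structure Spine (L : TropicalLine n V) where
  vert : ℕ → V
  nb : ℕ → Fin 3 → V ⊕ Fin (n + 1)
  surj : ∀ u, ∃ k < n - 1, vert k = u
  neighborSet_eq : ∀ k < n - 1, L.graph.neighborSet (Sum.inl (vert k)) = Set.range (nb k)
  nb_injective : ∀ k < n - 1, Function.Injective (nb k)
  nb_zero : ∀ k, k + 1 < n - 1 → nb (k + 1) 0 = Sum.inl (vert k)
  nb_two : ∀ k, k + 1 < n - 1 → nb k 2 = Sum.inl (vert (k + 1))
  first : ∃ a, nb 0 0 = Sum.inr a
  last : ∃ b, nb (n - 2) 2 = Sum.inr b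
  side : ∀ k < n - 1, ∃ c, nb k 1 = Sum.inr c

-- Counting edges by degrees, 3 * |V| + (n + 1) is twice the number |V| + n of edges of the tree.
open Classical in
theorem card_vertices_add_one (L : TropicalLine n V) : Fintype.card V + 1 = n := by
  have h1 := L.graph.sum_degrees_eq_twice_card_edges
  have h2 := L.isTree.card_edgeFinset
  have hl : ∀ u, L.graph.degree (Sum.inl u) = 3 := fun u => by
    rw [← L.trivalent u, ← SimpleGraph.card_neighborSet_eq_degree, Set.ncard_eq_toFinset_card',
      Set.toFinset_card]
  have hr : ∀ i, L.graph.degree (Sum.inr i) = 1 := fun u => by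
    refine Eq.trans ?_ (L.leaf u)
    rw [← SimpleGraph.card_neighborSet_eq_degree, Set.ncard_eq_toFinset_card', Set.toFinset_card]
  rw [Fintype.sum_sum_type] at h1
  simp only [hl, hr, Finset.sum_const, Finset.card_univ, Fintype.card_fin, smul_eq_mul] at h1
  rw [Fintype.card_sum, Fintype.card_fin] at h2
  omega

theorem exists_neighborSet_eq (L : TropicalLine n V) {u : V} {x y : V ⊕ Fin (n + 1)} (hxy : x ≠ y)
    (hx : L.graph.Adj (Sum.inl u) x) (hy : L.graph.Adj (Sum.inl u) y) :
    ∃ z, z ≠ x ∧ z ≠ y ∧ L.graph.neighborSet (Sum.inl u) = Set.range ![x, z, y] := by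
  have hsub : ({x, y} : Set (V ⊕ Fin (n + 1))) ⊆ L.graph.neighborSet (Sum.inl u) := by
    rintro _ (rfl | rfl)
    · exact hx
    · exact hy
  have h := Set.ncard_sdiff_add_ncard_of_subset hsub
  rw [L.trivalent, Set.ncard_pair hxy] at h
  obtain ⟨z, hz⟩ := Set.ncard_eq_one.1 (by omega :
    (L.graph.neighborSet (Sum.inl u) \ {x, y}).ncard = 1)
  have hz' : z ∈ L.graph.neighborSet (Sum.inl u) \ {x, y} := by rw [hz]; rfl
  refine ⟨z, fun h => hz'.2 (Or.inl h), fun h => hz'.2 (Or.inr h), ?_⟩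
  rw [← Set.sdiff_union_of_subset hsub, hz]
  ext w
  simp only [Set.mem_union, Set.mem_singleton_iff, Set.mem_insert_iff, Set.mem_range,
    Fin.exists_fin_succ]
  simp [eq_comm]
  tauto

/-- A geodesic of length n has n - 1 interior vertices. Having two neighbours they are not leaves,
and as there are only n - 1 inner vertices, they are all of them. A neighbour off the path has to be
a leaf, since another vertex of the path would give a shortcut. -/
theorem exists_spine (hn : 2 ≤ n) (L : TropicalLine n V) (hL : L.IsCaterpillar) :
    Nonempty L.Spine := by
  obtain ⟨x, y, hxy⟩ := L.graph.exists_dist_eq_diam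
  have hconn := L.isTree.connected
  obtain ⟨p, hp⟩ := hconn.exists_walk_length_eq_dist x y
  have hlen : p.length = n := by rw [hp, hxy, hL]
  set g := p.getVert with hg
  have hadj : ∀ i < n, L.graph.Adj (g i) (g (i + 1)) := fun i hi =>
    p.adj_getVert_succ (by omega)
  -- Subpaths of a geodesic are geodesics.
  have hfar : ∀ i ≤ n, ∀ j ≤ n, j ≤ i + L.graph.dist (g i) (g j) := by
    intro i hi j hj
    have h1 : L.graph.dist x (g i) ≤ i := by
      have := SimpleGraph.dist_le (p.take i)
      rw [SimpleGraph.Walk.take_length] at this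
      exact this.trans (min_le_left _ _)
    have h2 : L.graph.dist (g j) y ≤ n - j := by
      have := SimpleGraph.dist_le (p.drop j)
      rwa [SimpleGraph.Walk.drop_length, hlen] at this
    have h3 := hconn.dist_triangle (u := x) (v := g i) (w := y)
    have h4 := hconn.dist_triangle (u := g i) (v := g j) (w := y)
    omega
  have hinj : ∀ i ≤ n, ∀ j ≤ n, g i = g j → i = j := by
    intro i hi j hj h
    have h1 := hfar i hi j hj
    have h2 := hfar j hj i hi
    rw [h, SimpleGraph.dist_self] at h1 h2
    omega
  have hnear : ∀ i ≤ n, ∀ j ≤ n, L.graph.Adj (g i) (g j) → j ≤ i + 1 := by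
    intro i hi j hj h
    have h1 := hfar i hi j hj
    rwa [SimpleGraph.dist_eq_one_iff_adj.2 h] at h1
  have hinner : ∀ k < n - 1, ∃ u, g (k + 1) = Sum.inl u := by
    intro k hk
    rcases hc : g (k + 1) with u | i
    · exact ⟨u, rfl⟩
    · exfalso
      obtain ⟨z, hz⟩ := Set.ncard_eq_one.1 (L.leaf i)
      have h1 : g k ∈ L.graph.neighborSet (Sum.inr i) := by
        rw [← hc]; exact (hadj k (by omega)).symm
      have h2 : g (k + 2) ∈ L.graph.neighborSet (Sum.inr i) := by
        rw [← hc]; exact hadj (k + 1) (by omega)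
      rw [hz] at h1 h2
      have := hinj k (by omega) (k + 2) (by omega) (h1.trans h2.symm)
      omega
  have hV : Nonempty V := by
    obtain ⟨u, -⟩ := hinner 0 (by omega)
    exact ⟨u⟩
  choose! v hv using hinner
  have hcard := L.card_vertices_add_one
  have hsurj : ∀ u, ∃ k < n - 1, v k = u := by
    have hinj' : Function.Injective fun k : Fin (n - 1) => v k := by
      intro a b hab
      have h1 := hv a a.2
      rw [show v a = v b from hab, ← hv b b.2] at h1
      have := hinj _ (by omega) _ (by omega) h1
      exact Fin.ext (by omega)
    have hbij := (Fintype.bijective_iff_injective_and_card _).2 ⟨hinj', by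
      rw [Fintype.card_fin]; omega⟩
    intro u
    obtain ⟨k, hk⟩ := hbij.2 u
    exact ⟨k, k.2, hk⟩
  have hend : ∀ i ≤ n, i = 0 ∨ i = n → ∃ a, g i = Sum.inr a := by
    intro i hi hi'
    rcases hc : g i with u | a
    · exfalso
      obtain ⟨k, hk, rfl⟩ := hsurj u
      rw [← hv k hk] at hc
      have := hinj _ hi _ (by omega) hc
      omega
    · exact ⟨a, rfl⟩
  have hthird : ∀ k < n - 1, ∃ z, z ≠ g k ∧ z ≠ g (k + 2) ∧
      L.graph.neighborSet (Sum.inl (v k)) = Set.range ![g k, z, g (k + 2)] := by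
    intro k hk
    refine L.exists_neighborSet_eq ?_ ?_ ?_
    · intro h
      have := hinj _ (by omega) _ (by omega) h
      omega
    · rw [← hv k hk]; exact (hadj k (by omega)).symm
    · rw [← hv k hk]; exact hadj (k + 1) (by omega)
  choose! z hz1 hz2 hz3 using hthird
  refine ⟨⟨v, fun k => ![g k, z k, g (k + 2)], hsurj, hz3, ?_, fun k hk => ?_, fun k hk => ?_, ?_,
    ?_, ?_⟩⟩
  · intro k hk a b hab
    have h1 := hz1 k hk
    have h2 := hz2 k hk
    have h3 : g k ≠ g (k + 2) := by
      intro h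
      have := hinj _ (by omega) _ (by omega) h
      omega
    exact injective_triple h1 h2 h3 hab
  · exact hv k (by omega)
  · exact hv (k + 1) (by omega)
  · exact hend 0 (by omega) (Or.inl rfl)
  · exact hend (n - 2 + 2) (by omega) (Or.inr (by omega))
  · intro k hk
    show ∃ c, z k = Sum.inr c
    rcases hc : z k with u | c
    · exfalso
      obtain ⟨j, hj, rfl⟩ := hsurj u
      rw [← hv j hj] at hc
      have hadj' : L.graph.Adj (g (k + 1)) (g (j + 1)) := by
        rw [hv k hk, ← hc]
        change z k ∈ L.graph.neighborSet (Sum.inl (v k))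
        rw [hz3 k hk]
        exact ⟨1, rfl⟩
      have h1 := hnear _ (by omega) _ (by omega) hadj'
      have h2 := hnear _ (by omega) _ (by omega) hadj'.symm
      have h3 := hz1 k hk
      have h4 := hz2 k hk
      rw [hc] at h3 h4
      have h5 : j + 1 ≠ k := fun h => h3 (by rw [h])
      have h6 : j + 1 ≠ k + 2 := fun h => h4 (by rw [h])
      obtain rfl : j = k := by omega
      exact hadj'.ne rfl
    · exact ⟨c, rfl⟩

end TropicalLine

/-! ### The image of a caterpillar in the plane -/

/-- The map `x ↦ A x` with values in `ℝ × ℝ`. -/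
noncomputable def planeMap {n : ℕ} (A : Matrix (Fin 2) (Fin n) ℚ) : (Fin n → ℝ) →ₗ[ℝ] ℝ × ℝ :=
  ((LinearMap.proj 0).prod (LinearMap.proj 1)) ∘ₗ (A.map fun q : ℚ => (q : ℝ)).mulVecLin

theorem planeMap_apply {n : ℕ} (A : Matrix (Fin 2) (Fin n) ℚ) (x : Fin n → ℝ) :
    planeMap A x = (rationalMap A x 0, rationalMap A x 1) := rfl

theorem planeMap_single {n : ℕ} (A : Matrix (Fin 2) (Fin n) ℚ) (i : Fin n) :
    planeMap A (Pi.single i 1) = ((A 0 i : ℝ), (A 1 i : ℝ)) := by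
  simp [planeMap_apply, rationalMap]

theorem exists_planeDet_planeMap_ne_zero {n : ℕ} {A : Matrix (Fin 2) (Fin n) ℚ} (hA : A.rank = 2)
    {τ : ℝ × ℝ} (hτ : τ ≠ 0) : ∃ i, planeDet τ (planeMap A (Pi.single i 1)) ≠ 0 := by
  by_contra hcon
  push Not at hcon
  have hminor : ∀ i j, A 0 i * A 1 j - A 1 i * A 0 j = 0 := by
    intro i j
    have := planeDet_eq_zero_trans hτ (hcon i) (hcon j)
    rw [planeMap_single, planeMap_single] at this
    simp only [planeDet] at this
    exact_mod_cast this
  have hli : LinearIndependent ℚ ![A 0, A 1] := by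
    have e : ![A 0, A 1] = A.row := by
      ext i j; fin_cases i <;> rfl
    rw [e, linearIndependent_iff_card_eq_finrank_span, Fintype.card_fin]
    exact hA.symm.trans A.rank_eq_finrank_span_row
  rw [LinearIndependent.pair_iff] at hli
  have h0 : ∀ i, A 0 i = 0 := by
    intro i
    have := (hli (-A 1 i) (A 0 i) (by
      ext j
      simp only [Pi.add_apply, Pi.smul_apply, smul_eq_mul, Pi.zero_apply]
      linarith [hminor i j])).2
    exact this
  have := (hli 1 0 (by ext j; simp [h0])).1
  exact one_ne_zero this

namespace TropicalLine

variable {n : ℕ} {V : Type*} [Fintype V] {L : TropicalLine n V}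

/-- The direction of an edge as a real vector. -/
def direction (L : TropicalLine n V) (x y : V ⊕ Fin (n + 1)) : Fin n → ℝ :=
  fun k => (L.slope x y k : ℝ)

theorem direction_symm (x y : V ⊕ Fin (n + 1)) : L.direction y x = -L.direction x y := by
  ext k; simp [direction, L.slope_symm x y]

/-- Two adjacent leaves would form a connected component of their own. -/
theorem exists_adj_leaf [Nonempty V] (i : Fin (n + 1)) :
    ∃ u, L.graph.Adj (Sum.inl u) (Sum.inr i) := by
  obtain ⟨w, hw⟩ := Set.ncard_eq_one.1 (L.leaf i)
  have hwi : L.graph.Adj (Sum.inr i) w := by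
    change w ∈ L.graph.neighborSet _; rw [hw]; rfl
  rcases w with u | j
  · exact ⟨u, hwi.symm⟩
  · exfalso
    obtain ⟨w', hw'⟩ := Set.ncard_eq_one.1 (L.leaf j)
    have hclosed : ∀ x y, L.graph.Adj x y → (x = Sum.inr i ∨ x = Sum.inr j) →
        (y = Sum.inr i ∨ y = Sum.inr j) := by
      rintro x y h (rfl | rfl)
      · have : y ∈ L.graph.neighborSet (Sum.inr i) := h
        rw [hw] at this; exact Or.inr this
      · have h1 : y ∈ L.graph.neighborSet (Sum.inr j) := h
        have h2 : Sum.inr i ∈ L.graph.neighborSet (Sum.inr j) := hwi.symm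
        rw [hw'] at h1 h2
        exact Or.inl (h1.trans h2.symm)
    obtain ⟨u⟩ := ‹Nonempty V›
    obtain ⟨p⟩ := L.isTree.connected.preconnected (Sum.inr i) (Sum.inl u)
    have : ∀ {x y} (p : L.graph.Walk x y), (x = Sum.inr i ∨ x = Sum.inr j) →
        (y = Sum.inr i ∨ y = Sum.inr j) := by
      intro x y p
      induction p with
      | nil => exact id
      | cons h _ ih => exact fun hx => ih (hclosed _ _ h hx)
    simpa using this p (Or.inl rfl)

namespace Spine

variable (S : L.Spine)

theorem adj {k : ℕ} (hk : k < n - 1) (κ : Fin 3) :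
    L.graph.Adj (Sum.inl (S.vert k)) (S.nb k κ) := by
  change S.nb k κ ∈ L.graph.neighborSet _
  rw [S.neighborSet_eq k hk]; exact ⟨κ, rfl⟩

theorem exists_nb {k : ℕ} (hk : k < n - 1) {x : V ⊕ Fin (n + 1)}
    (h : L.graph.Adj (Sum.inl (S.vert k)) x) : ∃ κ, S.nb k κ = x := by
  have : x ∈ L.graph.neighborSet _ := h
  rwa [S.neighborSet_eq k hk] at this

theorem sum_direction {k : ℕ} (hk : k < n - 1) :
    ∑ κ, L.direction (Sum.inl (S.vert k)) (S.nb k κ) = 0 := by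
  classical
  have h := L.balanced (S.vert k)
  have hsupp : ∑ x, L.slope (Sum.inl (S.vert k)) x =
      ∑ x ∈ Finset.univ.image (S.nb k), L.slope (Sum.inl (S.vert k)) x := by
    symm
    refine Finset.sum_subset (Finset.subset_univ _) fun x _ hx => ?_
    refine L.slope_of_not_adj _ _ fun hadj => hx ?_
    obtain ⟨κ, hκ⟩ := S.exists_nb hk hadj
    exact Finset.mem_image.2 ⟨κ, Finset.mem_univ _, hκ⟩
  rw [hsupp, Finset.sum_image fun a _ b _ hab => S.nb_injective k hk hab] at h
  ext j
  have := congrFun h j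
  rw [Finset.sum_apply] at this ⊢
  simp only [direction, Pi.zero_apply] at this ⊢
  exact_mod_cast this

theorem exists_planeCaterpillar (A : Matrix (Fin 2) (Fin n) ℚ) : ∃ C : PlaneCaterpillar (n - 1),
    (∀ k, C.pos k = planeMap A (L.pos (S.vert k))) ∧
    (∀ k < n - 1, ∀ κ, C.edgeDir k κ = planeMap A (L.direction (Sum.inl (S.vert k)) (S.nb k κ))) ∧
    ∀ k, k + 1 < n - 1 → L.pos (S.vert (k + 1)) =
      L.pos (S.vert k) + C.len k • L.direction (Sum.inl (S.vert k)) (S.nb k 2) := by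
  have hlen : ∀ k, k + 1 < n - 1 → ∃ l : ℝ, 0 < l ∧ L.pos (S.vert (k + 1)) =
      L.pos (S.vert k) + l • L.direction (Sum.inl (S.vert k)) (S.nb k 2) := by
    intro k hk
    have h := S.adj (k := k) (by omega) 2
    rw [S.nb_two k hk] at h ⊢
    exact L.bounded_edge _ _ h
  choose! len hlen_pos hlen_eq using hlen
  set d : ℕ → Fin 3 → ℝ × ℝ := fun k κ =>
    planeMap A (L.direction (Sum.inl (S.vert k)) (S.nb k κ)) with hd
  have hsum : ∀ k < n - 1, d k 0 + d k 1 + d k 2 = 0 := by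
    intro k hk
    rw [← Fin.sum_univ_three, hd, ← map_sum, S.sum_direction hk, map_zero]
  set dir : ℕ → ℝ × ℝ := fun k => Nat.casesOn k (-d 0 0) fun j => d j 2 with hdir
  have hdir0 : ∀ k < n - 1, dir k = -d k 0 := by
    intro k hk
    rcases k with _ | k
    · rfl
    · show planeMap A _ = -planeMap A _
      rw [S.nb_zero k hk, S.nb_two k hk, direction_symm, map_neg]
  refine ⟨⟨fun k => planeMap A (L.pos (S.vert k)), dir, fun k => d k 1, len, ?_, hlen_pos, ?_⟩,
    fun k => rfl, ?_, hlen_eq⟩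
  · intro k hk
    rw [hdir0 k hk]
    show -d k 0 = d k 1 + d k 2
    have := hsum k hk
    rw [add_assoc] at this
    exact neg_eq_of_add_eq_zero_right this
  · intro k hk
    show planeMap A _ = planeMap A _ + len k • planeMap A _
    rw [hlen_eq k hk, map_add, map_smul]
  · intro k hk κ
    fin_cases κ
    · show -dir k = d k 0
      rw [hdir0 k hk, neg_neg]
    · rfl
    · rfl

variable (C : PlaneCaterpillar (n - 1))

/-- The edge `κ` at the vertex `k` as a subset of `ℝⁿ`. -/
def edge (k : ℕ) (κ : Fin 3) : Set (Fin n → ℝ) :=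
  {x | ∃ t : ℝ, 0 ≤ t ∧ (∀ l ∈ C.edgeLen k κ, t ≤ l) ∧
    x = L.pos (S.vert k) + t • L.direction (Sum.inl (S.vert k)) (S.nb k κ)}

variable {C}
variable (hlen : ∀ k, k + 1 < n - 1 → L.pos (S.vert (k + 1)) =
      L.pos (S.vert k) + C.len k • L.direction (Sum.inl (S.vert k)) (S.nb k 2))

include hlen in
theorem exists_end {k : ℕ} (hk : k < n - 1) (κ : Fin 3) : ∀ l ∈ C.edgeLen k κ, ∃ e < n - 1,
    L.pos (S.vert e) =
      L.pos (S.vert k) + l • L.direction (Sum.inl (S.vert k)) (S.nb k κ) := by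
  fin_cases κ
  · rcases k with _ | k
    · simp [PlaneCaterpillar.edgeLen]
    · intro l hl
      have hl' : l ∈ C.edgeLen (k + 1) 0 := hl
      rw [PlaneCaterpillar.edgeLen_backward] at hl'
      cases hl'
      refine ⟨k, by omega, ?_⟩
      show _ = _ + _ • L.direction _ (S.nb (k + 1) 0)
      rw [hlen k hk, S.nb_zero k hk, S.nb_two k hk, direction_symm (Sum.inl (S.vert k)), smul_neg]
      abel
  · simp [PlaneCaterpillar.edgeLen]
  · intro l hl
    have hl' : l ∈ C.edgeLen k 2 := hl
    by_cases h : k + 1 < n - 1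
    · rw [PlaneCaterpillar.edgeLen_forward h] at hl'
      cases hl'
      exact ⟨k + 1, h, hlen k h⟩
    · simp [PlaneCaterpillar.edgeLen, h] at hl'

include hlen in
theorem segment_eq {k : ℕ} (hk : k + 1 < n - 1) :
    segment ℝ (L.pos (S.vert k)) (L.pos (S.vert (k + 1))) = S.edge C k 2 := by
  have hpos := C.len_pos k hk
  rw [segment_eq_image']
  ext x
  simp only [edge, PlaneCaterpillar.edgeLen_forward hk, Set.mem_image, Set.mem_Icc,
    Set.mem_ofPred_eq, hlen k hk, add_sub_cancel_left]
  constructor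
  · rintro ⟨θ, ⟨h0, h1⟩, rfl⟩
    exact ⟨θ * C.len k, by positivity, by rintro _ ⟨⟩; nlinarith, by rw [smul_smul]⟩
  · rintro ⟨t, h0, h1, rfl⟩
    exact ⟨t / C.len k, ⟨by positivity, (div_le_one hpos).2 (h1 _ rfl)⟩, by
      rw [smul_smul, div_mul_cancel₀ _ hpos.ne']⟩

include hlen in
theorem isFace_cases {F : Set (Fin n → ℝ)} (hF : L.IsFace F) :
    (∃ k < n - 1, F = {L.pos (S.vert k)}) ∨ ∃ k < n - 1, ∃ κ, F = S.edge C k κ := by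
  cases hF with
  | vertex u =>
    obtain ⟨k, hk, rfl⟩ := S.surj u
    exact Or.inl ⟨k, hk, rfl⟩
  | boundedEdge u w h =>
    right
    obtain ⟨k, hk, rfl⟩ := S.surj u
    obtain ⟨κ, hκ⟩ := S.exists_nb hk h
    fin_cases κ
    · rcases k with _ | k
      · obtain ⟨a, ha⟩ := S.first
        rw [show S.nb 0 0 = Sum.inl w from hκ] at ha; cases ha
      · have := (S.nb_zero k hk).symm.trans hκ
        cases this
        exact ⟨k, by omega, 2, by rw [segment_symm, S.segment_eq hlen hk]⟩
    · obtain ⟨c, hc⟩ := S.side k hk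
      rw [show S.nb k 1 = Sum.inl w from hκ] at hc; cases hc
    · by_cases hk' : k + 1 < n - 1
      · have := (S.nb_two k hk').symm.trans hκ
        cases this
        exact ⟨k, hk, 2, S.segment_eq hlen hk'⟩
      · obtain rfl : k = n - 2 := by omega
        obtain ⟨b, hb⟩ := S.last
        rw [show S.nb (n - 2) 2 = Sum.inl w from hκ] at hb; cases hb
  | ray u i h =>
    right
    obtain ⟨k, hk, rfl⟩ := S.surj u
    obtain ⟨κ, hκ⟩ := S.exists_nb hk h
    refine ⟨k, hk, κ, ?_⟩
    have hnone : C.edgeLen k κ = none := by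
      fin_cases κ
      · rcases k with _ | k
        · simp [PlaneCaterpillar.edgeLen]
        · have := (S.nb_zero k hk).symm.trans hκ
          cases this
      · simp [PlaneCaterpillar.edgeLen]
      · by_cases hk' : k + 1 < n - 1
        · have := (S.nb_two k hk').symm.trans hκ
          cases this
        · simp [PlaneCaterpillar.edgeLen, hk']
    ext x
    have hd : L.direction (Sum.inl (S.vert k)) (Sum.inr i) = fun k => (rayDirection i k : ℝ) := by
      ext j; rw [direction, L.slope_ray _ _ h]
    simp only [halfRay, edge, hnone, hκ, hd, Set.mem_ofPred_eq]
    simp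

include hlen in
theorem mem_face_cases {A : Matrix (Fin 2) (Fin n) ℚ}
    (hpos : ∀ k, C.pos k = planeMap A (L.pos (S.vert k)))
    (hdir : ∀ k < n - 1, ∀ κ, C.edgeDir k κ =
      planeMap A (L.direction (Sum.inl (S.vert k)) (S.nb k κ)))
    {F : Set (Fin n → ℝ)} (hF : L.IsFace F) {x : Fin n → ℝ} (hx : x ∈ F) :
    (∃ k < n - 1, L.pos (S.vert k) ∈ F ∧ planeMap A x = C.pos k) ∨
      ∃ k < n - 1, ∃ κ, F = S.edge C k κ ∧ C.OnEdge k κ (planeMap A x) := by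
  rcases S.isFace_cases hlen hF with ⟨k, hk, rfl⟩ | ⟨k, hk, κ, rfl⟩
  · rw [Set.mem_singleton_iff] at hx
    exact Or.inl ⟨k, hk, rfl, by rw [hx, hpos]⟩
  · obtain ⟨t, ht, htl, hxt⟩ := id hx
    rcases ht.eq_or_lt with rfl | ht
    · rw [zero_smul, add_zero] at hxt
      exact Or.inl ⟨k, hk, hxt ▸ hx, by rw [hxt, hpos]⟩
    · by_cases hl : ∀ l ∈ C.edgeLen k κ, t < l
      · refine Or.inr ⟨k, hk, κ, rfl, t, ht, hl, ?_⟩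
        rw [hxt, map_add, map_smul, hpos, hdir k hk]
      · push Not at hl
        obtain ⟨l, hl, hlt⟩ := hl
        obtain rfl : t = l := le_antisymm (htl l hl) hlt
        obtain ⟨e, he, hpe⟩ := S.exists_end hlen hk κ t hl
        have hxe := hxt.trans hpe.symm
        exact Or.inl ⟨e, he, hxe ▸ hx, by rw [hxe, hpos]⟩

end Spine
end TropicalLine

/-! ### Self-intersection points as meeting points of the plane chain -/

namespace PlaneCaterpillar

variable {N : ℕ} {C : PlaneCaterpillar N}

open Filter Topology in
/-- A point inside an edge can be moved along the edge. -/
theorem OnEdge.eventually {k : ℕ} {κ : Fin 3} {a : ℝ × ℝ} (h : C.OnEdge k κ a) (x : ℝ) :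
    ∀ᶠ ε in 𝓝[>] (0 : ℝ), ∃ t : ℝ, 0 ≤ t ∧ (∀ l ∈ C.edgeLen k κ, t ≤ l) ∧
      a + (ε * x) • C.edgeDir k κ = C.pos k + t • C.edgeDir k κ := by
  obtain ⟨s, hs, hl, rfl⟩ := h
  have hlim : Tendsto (fun ε : ℝ => s + ε * x) (𝓝[>] 0) (𝓝 s) := by
    have hc : Continuous fun ε : ℝ => s + ε * x := by fun_prop
    have := (hc.tendsto 0).mono_left (nhdsWithin_le_nhds (s := Set.Ioi 0))
    simpa using this
  have hl' : ∀ᶠ ε in 𝓝[>] (0 : ℝ), ∀ l ∈ C.edgeLen k κ, s + ε * x ≤ l := by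
    cases hc : C.edgeLen k κ with
    | none => simp
    | some l =>
      filter_upwards [hlim.eventually (gt_mem_nhds (hl l hc))] with ε hε
      rintro _ ⟨⟩; exact hε.le
  filter_upwards [hlim.eventually (lt_mem_nhds hs), hl'] with ε h1 h2
  exact ⟨s + ε * x, h1.le, h2, by rw [add_smul, add_assoc]⟩

theorem IsMeeting.of_coincident {k k' : ℕ} (hk : k < N) (hk' : k' < N) (hne : k ≠ k') {a : ℝ × ℝ}
    (h : a = C.pos k) (h' : a = C.pos k') : C.IsMeeting a := by
  rcases lt_or_gt_of_ne hne with hlt | hlt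
  · exact Or.inl ⟨k, hk, k', hk', hlt, h, h'⟩
  · exact Or.inl ⟨k', hk', k, hk, hlt, h', h⟩

theorem IsMeeting.of_transversal {k k' : ℕ} (hk : k < N) (hk' : k' < N) (hne : k ≠ k') {κ κ' : Fin 3}
    (hdet : planeDet (C.edgeDir k κ) (C.edgeDir k' κ') ≠ 0) {a : ℝ × ℝ}
    (h : C.OnEdge k κ a) (h' : C.OnEdge k' κ' a) : C.IsMeeting a := by
  rcases lt_or_gt_of_ne hne with hlt | hlt
  · exact Or.inr (Or.inr ⟨k, k', hk', κ, κ', hlt, hdet, h, h'⟩)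
  · refine Or.inr (Or.inr ⟨k', k, hk, κ', κ, hlt, ?_, h', h⟩)
    rw [planeDet_swap]; exact neg_ne_zero.2 hdet

end PlaneCaterpillar

namespace TropicalLine

variable {n : ℕ} {V : Type*} [Fintype V] {L : TropicalLine n V}

namespace Spine

variable (S : L.Spine) {C : PlaneCaterpillar (n - 1)} {A : Matrix (Fin 2) (Fin n) ℚ}
  (hlen : ∀ k, k + 1 < n - 1 → L.pos (S.vert (k + 1)) =
      L.pos (S.vert k) + C.len k • L.direction (Sum.inl (S.vert k)) (S.nb k 2))
  (hpos : ∀ k, C.pos k = planeMap A (L.pos (S.vert k)))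
  (hdir : ∀ k < n - 1, ∀ κ, C.edgeDir k κ =
    planeMap A (L.direction (Sum.inl (S.vert k)) (S.nb k κ)))

theorem vert_mem_edge {k : ℕ} (hk : k < n - 1) (κ : Fin 3) :
    L.pos (S.vert k) ∈ S.edge C k κ :=
  ⟨0, le_rfl, fun l hl => (C.edgeLen_pos hk κ l hl).le, by rw [zero_smul, add_zero]⟩

include hpos hdir in
theorem mem_image_edge {k : ℕ} (hk : k < n - 1) {κ : Fin 3} {t : ℝ} (ht : 0 ≤ t)
    (htl : ∀ l ∈ C.edgeLen k κ, t ≤ l) :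
    C.pos k + t • C.edgeDir k κ ∈ planeMap A '' S.edge C k κ :=
  ⟨_, ⟨t, ht, htl, rfl⟩, by rw [map_add, map_smul, hpos, hdir k hk]⟩

-- If a is interior to two parallel edges with non-zero images, these share a short segment around
-- a, so the intersection is not a single point. An edge with zero image counts as a vertex.
open Filter Topology in
include hlen hpos hdir in
theorem isMeeting_of_inter_eq_singleton {F G : Set (Fin n → ℝ)} (hF : L.IsFace F) (hG : L.IsFace G)
    (hFG : Disjoint F G) {a : ℝ × ℝ} (h : planeMap A '' F ∩ planeMap A '' G = {a}) :
    C.IsMeeting a := by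
  have ha : a ∈ planeMap A '' F ∩ planeMap A '' G := by rw [h]; rfl
  obtain ⟨⟨x, hx, rfl⟩, y, hy, hxy⟩ := ha
  have hne : ∀ {k k'}, L.pos (S.vert k) ∈ F → L.pos (S.vert k') ∈ G → k ≠ k' := by
    rintro k _ h1 h2 rfl
    exact Set.disjoint_left.1 hFG h1 h2
  rcases S.mem_face_cases hlen hpos hdir hF hx with ⟨k, hk, hkF, hxk⟩ | ⟨k, hk, κ, rfl, hon⟩
  · rcases S.mem_face_cases hlen hpos hdir hG hy with ⟨k', hk', hkG, hyk⟩ | ⟨k', hk', κ', rfl, hon'⟩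
    · rw [hxy] at hyk
      exact .of_coincident hk hk' (hne hkF hkG) hxk hyk
    · rw [hxy] at hon'
      exact Or.inr (Or.inl ⟨k, hk, k', hk', κ', hne hkF (S.vert_mem_edge hk' κ'), hxk,
        hon'⟩)
  · rcases S.mem_face_cases hlen hpos hdir hG hy with ⟨k', hk', hkG, hyk⟩ | ⟨k', hk', κ', rfl, hon'⟩
    · rw [hxy] at hyk
      exact Or.inr (Or.inl ⟨k', hk', k, hk, κ, (hne (S.vert_mem_edge hk κ) hkG).symm, hyk,
        hon⟩)
    · rw [hxy] at hon'
      have hkk := hne (S.vert_mem_edge hk κ) (S.vert_mem_edge hk' κ')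
      by_cases hdet : planeDet (C.edgeDir k κ) (C.edgeDir k' κ') = 0
      · have degenerate : ∀ {k : ℕ} {κ : Fin 3} {b : ℝ × ℝ}, C.edgeDir k κ = 0 →
            C.OnEdge k κ b → b = C.pos k := by
          rintro k κ b h0 ⟨s, -, -, rfl⟩
          rw [h0, smul_zero, add_zero]
        by_cases h0 : C.edgeDir k κ = 0
        · exact Or.inr (Or.inl ⟨k, hk, k', hk', κ', hkk, degenerate h0 hon, hon'⟩)
        by_cases h0' : C.edgeDir k' κ' = 0
        · exact Or.inr (Or.inl ⟨k', hk', k, hk, κ, hkk.symm, degenerate h0' hon', hon⟩)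
        exfalso
        obtain ⟨ρ, hρ, hr⟩ := PlaneCaterpillar.exists_smul_ne_zero h0' h0 hdet
        obtain ⟨ε, hε, ⟨t, ht, htl, hteq⟩, t', ht', htl', hteq'⟩ :=
          ((eventually_mem_nhdsWithin (a := (0 : ℝ)) (s := Set.Ioi 0)).and
            ((hon.eventually ρ).and (hon'.eventually 1))).exists
        have hmem : planeMap A x + (ε * ρ) • C.edgeDir k κ ∈ ({planeMap A x} : Set (ℝ × ℝ)) := by
          rw [← h]
          refine ⟨hteq ▸ S.mem_image_edge hpos hdir hk ht htl, ?_⟩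
          have e : (ε * ρ) • C.edgeDir k κ = (ε * 1) • C.edgeDir k' κ' := by
            rw [hr, smul_smul, mul_one]
          rw [e]
          exact hteq' ▸ S.mem_image_edge hpos hdir hk' ht' htl'
        have h1 : (ε * ρ) • C.edgeDir k κ = 0 := by
          rwa [Set.mem_singleton_iff, add_eq_left] at hmem
        exact smul_ne_zero (mul_ne_zero (ne_of_gt hε) hρ) h0 h1
      · exact .of_transversal hk hk' hkk hdet hon hon'

end Spine

theorem encard_selfIntersectionPoints_le (hn : 2 ≤ n) (hL : L.IsCaterpillar)
    {A : Matrix (Fin 2) (Fin n) ℚ} (hA : A.rank = 2) :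
    (L.selfIntersectionPoints A).encard ≤ ((n - 1).choose 2 : ℕ) := by
  obtain ⟨S⟩ := L.exists_spine hn hL
  obtain ⟨C, hpos, hdir, hlen⟩ := S.exists_planeCaterpillar A
  -- The half-ray with label i projects to the column i of A, and the columns of a matrix of rank 2
  -- are not all parallel to τ.
  have hspan : ∀ τ ≠ 0, ∃ k < n - 1, ∃ κ, planeDet τ (C.edgeDir k κ) ≠ 0 := by
    intro τ hτ
    obtain ⟨i, hi⟩ := exists_planeDet_planeMap_ne_zero hA hτ
    have : Nonempty V := ⟨S.vert 0⟩
    obtain ⟨u, hu⟩ := L.exists_adj_leaf i.castSucc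
    obtain ⟨k, hk, rfl⟩ := S.surj u
    obtain ⟨κ, hκ⟩ := S.exists_nb hk hu
    refine ⟨k, hk, κ, ?_⟩
    have e : L.direction (Sum.inl (S.vert k)) (Sum.inr i.castSucc) = Pi.single i 1 := by
      ext j
      rw [direction, L.slope_ray _ _ hu]
      simp only [rayDirection, Fin.lastCases_castSucc, Pi.single_apply]
      split_ifs <;> simp
    rwa [hdir k hk, hκ, e]
  set f : (Fin 2 → ℝ) → ℝ × ℝ := fun p => (p 0, p 1) with hf
  have hinj : Function.Injective f := by
    intro p q hpq
    simp only [hf, Prod.mk.injEq] at hpq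
    ext i; fin_cases i
    · exact hpq.1
    · exact hpq.2
  rw [← hinj.encard_image]
  refine (Set.encard_le_encard ?_).trans (PlaneCaterpillar.encard_meeting_le hspan)
  rintro _ ⟨p, ⟨F, G, hF, hG, hFG, hp⟩, rfl⟩
  refine S.isMeeting_of_inter_eq_singleton hlen hpos hdir hF hG hFG ?_
  have e : ∀ X : Set (Fin n → ℝ), planeMap A '' X = f '' (rationalMap A '' X) := by
    intro X; rw [Set.image_image]; rfl
  rw [e, e, ← Set.image_inter hinj, hp, Set.image_singleton]

end TropicalLine

/-! ### Tropicalizations of lines -/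

section Valuation

variable {n : ℕ} {K : Type*} [Field K] (v : AddValuation K (WithTop ℝ))

theorem addValuation_prod_pow {ι : Type*} (s : Finset ι) (α : ι → ℕ) {y : ι → K} {w : ι → ℝ}
    (h : ∀ i, v (y i) = (w i : WithTop ℝ)) :
    v (∏ i ∈ s, y i ^ α i) = ((∑ i ∈ s, (α i : ℝ) * w i : ℝ) : WithTop ℝ) := by
  classical
  induction s using Finset.induction_on with
  | empty => simp
  | insert i s hi ih =>
    rw [Finset.prod_insert hi, Finset.sum_insert hi, v.map_mul, ih, v.map_pow, h,
      WithTop.coe_add, ← nsmul_eq_mul, WithTop.coe_nsmul]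

/-- The coordinatewise valuation of a point of the line is in the tropical variety. -/
theorem mem_tropicalVariety_lineIdeal {a b : Fin n → K} {w : Fin n → ℝ} (s : K)
    (h : ∀ i, v (a i + b i * s) = (w i : WithTop ℝ)) : w ∈ tropicalVariety v (lineIdeal a b) := by
  classical
  simp only [tropicalVariety, Set.mem_iInter]
  intro f hf hf0
  have heval : MvPolynomial.eval (fun i => a i + b i * s) f = 0 := by
    have h1 : MvPolynomial.aeval (R := K)
        (fun i => (Polynomial.C (a i) + Polynomial.C (b i) * Polynomial.X : K[X])) f = 0 := hf
    have h2 := congrArg (Polynomial.evalRingHom s) h1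
    rw [map_zero, MvPolynomial.aeval_def, MvPolynomial.hom_eval₂] at h2
    rw [← h2, MvPolynomial.eval, MvPolynomial.coe_eval₂Hom]
    congr 1
    · ext x; simp
    · ext i; simp
  rw [MvPolynomial.eval_eq'] at heval
  set T : (Fin n →₀ ℕ) → WithTop ℝ := fun γ =>
    v (f.coeff γ) + ((∑ i, (γ i : ℝ) * w i : ℝ) : WithTop ℝ) with hT
  have hval : ∀ γ, v (f.coeff γ * ∏ i, (a i + b i * s) ^ γ i) = T γ := fun γ => by
    rw [v.map_mul, addValuation_prod_pow v _ _ h]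
  obtain ⟨α, hα, hmin⟩ := Finset.exists_min_image f.support T (MvPolynomial.support_nonempty.2 hf0)
  have hαtop : T α ≠ ⊤ := by
    rw [hT]
    refine WithTop.add_ne_top.2 ⟨?_, WithTop.coe_ne_top⟩
    rw [v.ne_top_iff]
    exact MvPolynomial.mem_support_iff.1 hα
  by_contra hcon
  -- Were the minimum attained only at α, the other terms of f(a + s b) = 0 would all have larger
  -- valuation, although their sum is the negative of the term at α.
  have hlt : ∀ β ∈ f.support.erase α, T α < v (f.coeff β * ∏ i, (a i + b i * s) ^ β i) := by
    intro β hβ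
    rw [hval]
    obtain ⟨hne, hβ⟩ := Finset.mem_erase.1 hβ
    refine lt_of_not_ge fun hle => hcon ⟨α, hα, β, hβ, hne.symm, hmin, fun γ hγ => ?_⟩
    exact hle.trans (hmin γ hγ)
  have hsum := v.map_lt_sum hαtop hlt
  rw [← Finset.add_sum_erase _ _ hα] at heval
  rw [← neg_eq_of_add_eq_zero_right heval, v.map_neg, hval] at hsum
  exact lt_irrefl _ hsum

/-- On the tropical variety, the minimum of two coordinates and the valuation of their difference
on the line is attained twice. -/
theorem min_attained_twice {a b : Fin n → K} {w : Fin n → ℝ}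
    (hw : w ∈ tropicalVariety v (lineIdeal a b)) {i j : Fin n} (hij : i ≠ j) (hb : b i = b j)
    {c : ℝ} (hc : v (a i - a j) = (c : WithTop ℝ)) :
    (w i = w j ∧ w i ≤ c) ∨ (w i = c ∧ c ≤ w j) ∨ (w j = c ∧ c ≤ w i) := by
  classical
  -- As b i = b j, this linear polynomial vanishes on the line. Its three monomials give the three
  -- quantities compared.
  set f : MvPolynomial (Fin n) K :=
    MvPolynomial.X i - MvPolynomial.X j - MvPolynomial.C (a i - a j) with hf
  have hmem : f ∈ lineIdeal a b := by
    show MvPolynomial.aeval _ f = 0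
    simp only [hf, map_sub, MvPolynomial.aeval_X, MvPolynomial.aeval_C, hb,
      Polynomial.algebraMap_eq]
    ring
  have hne : (Finsupp.single i 1 : Fin n →₀ ℕ) ≠ Finsupp.single j 1 := by
    rw [Ne, Finsupp.single_left_inj one_ne_zero]; exact hij
  have h0 : ∀ k, (Finsupp.single k 1 : Fin n →₀ ℕ) ≠ 0 := fun k => by simp
  have hu : a i - a j ≠ 0 := by
    rw [← v.ne_top_iff, hc]; exact WithTop.coe_ne_top
  have c1 : f.coeff (Finsupp.single i 1) = 1 := by
    simp [hf, MvPolynomial.coeff_X, MvPolynomial.coeff_C, hne.symm, (h0 i).symm]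
  have c2 : f.coeff (Finsupp.single j 1) = -1 := by
    simp [hf, MvPolynomial.coeff_X, MvPolynomial.coeff_C, hne, (h0 j).symm]
  have c3 : f.coeff 0 = -(a i - a j) := by
    simp [hf, MvPolynomial.coeff_X, MvPolynomial.coeff_C, h0]
  have hsupp : ∀ γ ∈ f.support, γ = Finsupp.single i 1 ∨ γ = Finsupp.single j 1 ∨ γ = 0 := by
    intro γ hγ
    by_contra hcon
    push Not at hcon
    refine MvPolynomial.mem_support_iff.1 hγ ?_
    simp [hf, MvPolynomial.coeff_X, MvPolynomial.coeff_C, hcon.1.symm, hcon.2.1.symm,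
      hcon.2.2.symm]
  have m1 : Finsupp.single i 1 ∈ f.support := MvPolynomial.mem_support_iff.2 (by rw [c1]; simp)
  have m2 : Finsupp.single j 1 ∈ f.support := MvPolynomial.mem_support_iff.2 (by rw [c2]; simp)
  have m3 : 0 ∈ f.support := MvPolynomial.mem_support_iff.2 (by rw [c3]; exact neg_ne_zero.2 hu)
  have hsingle : ∀ k, ∑ l, ((Finsupp.single k 1 : Fin n →₀ ℕ) l : ℝ) * w l = w k := fun k => by
    simp [Finsupp.single_apply]
  have v1 : v (f.coeff (Finsupp.single i 1)) +
      ((∑ l, ((Finsupp.single i 1 : Fin n →₀ ℕ) l : ℝ) * w l : ℝ) : WithTop ℝ) = (w i : WithTop ℝ) := by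
    rw [c1, v.map_one, zero_add, hsingle]
  have v2 : v (f.coeff (Finsupp.single j 1)) +
      ((∑ l, ((Finsupp.single j 1 : Fin n →₀ ℕ) l : ℝ) * w l : ℝ) : WithTop ℝ) = (w j : WithTop ℝ) := by
    rw [c2, v.map_neg, v.map_one, zero_add, hsingle]
  have v3 : v (f.coeff 0) +
      ((∑ l, ((0 : Fin n →₀ ℕ) l : ℝ) * w l : ℝ) : WithTop ℝ) = (c : WithTop ℝ) := by
    rw [c3, v.map_neg, hc]; simp
  simp only [tropicalVariety, Set.mem_iInter] at hw
  obtain ⟨α, hα, β, hβ, hαβ, hmin, hmin'⟩ := hw f hmem (fun h => by rw [h] at m1; simp at m1)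
  have a1 := hmin _ m1
  have a2 := hmin _ m2
  have a3 := hmin _ m3
  have b1 := hmin' _ m1
  have b2 := hmin' _ m2
  have b3 := hmin' _ m3
  rw [v1] at a1 b1
  rw [v2] at a2 b2
  rw [v3] at a3 b3
  rcases hsupp α hα with rfl | rfl | rfl <;> rcases hsupp β hβ with rfl | rfl | rfl <;>
    first
    | exact absurd rfl hαβ
    | (simp only [v1, v2, v3, WithTop.coe_le_coe] at a1 a2 a3 b1 b2 b3
       first
       | exact Or.inl ⟨by linarith, by linarith⟩
       | exact Or.inr (Or.inl ⟨by linarith, by linarith⟩)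
       | exact Or.inr (Or.inr ⟨by linarith, by linarith⟩))

end Valuation

/-! ### Hahn series -/

open HahnSeries in
-- In the case x = y the coefficient 1 + 1 is not zero in ℚ, so there is no cancellation.
theorem addVal_single_add_single (x y : ℝ) :
    addVal ℝ ℚ (single x 1 + single y 1) = ((min x y : ℝ) : WithTop ℝ) := by
  have hv : ∀ z : ℝ, addVal ℝ ℚ (single z 1) = (z : WithTop ℝ) := fun z => by
    rw [addVal_apply, orderTop_single one_ne_zero]
  rcases lt_trichotomy x y with h | rfl | h
  · rw [AddValuation.map_add_eq_of_lt_left _ (by rw [hv, hv]; exact WithTop.coe_lt_coe.2 h), hv,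
      min_eq_left h.le]
  · rw [← single_add, addVal_apply, orderTop_single (by norm_num), min_self]
  · rw [AddValuation.map_add_eq_of_lt_right _ (by rw [hv, hv]; exact WithTop.coe_lt_coe.2 h), hv,
      min_eq_right h.le]

open HahnSeries in
-- The coefficient 2 takes care of the case y = z, where 2 - 1 is left.
theorem addVal_single_sub_single {y z : ℝ} (h : y ≤ z) :
    addVal ℝ ℚ (single z 2 - single y 1) = (y : WithTop ℝ) := by
  rcases h.eq_or_lt with rfl | h
  · rw [← single_sub, addVal_apply, orderTop_single (by norm_num)]
  · rw [AddValuation.map_sub_eq_of_lt_right, addVal_apply, orderTop_single one_ne_zero]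
    rw [addVal_apply, addVal_apply, orderTop_single one_ne_zero, orderTop_single two_ne_zero]
    exact WithTop.coe_lt_coe.2 h

open HahnSeries in
theorem addVal_single_add_single_sub_single {x y z : ℝ} (h : y ≤ z) (hxy : x ≠ y) :
    addVal ℝ ℚ (single x 1 + (single z 2 - single y 1)) = ((min x y : ℝ) : WithTop ℝ) := by
  have hx : addVal ℝ ℚ (single x 1) = (x : WithTop ℝ) := by
    rw [addVal_apply, orderTop_single one_ne_zero]
  have hy := addVal_single_sub_single h
  rw [AddValuation.map_add_of_distinct_val, hx, hy]
  · norm_cast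
  · rw [hx, hy]; exact_mod_cast hxy

/-! ### A caterpillar line -/

/-- The index of the inner vertex at which the half-ray `i` is attached. -/
def attachIndex (N : ℕ) (i : Fin (N + 2)) : ℕ :=
  if i.val < N then i.val else if i.val = N then N - 1 else 0

/-- The caterpillar with the path of inner vertices `0, …, N - 1`. -/
def caterpillarGraph (N : ℕ) : SimpleGraph (Fin N ⊕ Fin (N + 2)) where
  Adj x y := match x, y with
    | Sum.inl j, Sum.inl k => j.val + 1 = k.val ∨ k.val + 1 = j.val
    | Sum.inl k, Sum.inr i => attachIndex N i = k.val
    | Sum.inr i, Sum.inl k => attachIndex N i = k.val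
    | Sum.inr _, Sum.inr _ => False
  symm := ⟨by
    rintro (x | x) (y | y) h
    · exact h.symm
    · exact h
    · exact h
    · exact h⟩
  loopless := ⟨by
    rintro (x | x) h
    · rcases h with h | h <;> omega
    · exact h⟩

/-- The directions of the edges of the caterpillar line. -/
def caterpillarSlope (N : ℕ) : Fin N ⊕ Fin (N + 2) → Fin N ⊕ Fin (N + 2) → Fin (N + 1) → ℤ
  | Sum.inl j, Sum.inl k => fun i =>
      if j.val + 1 = k.val then (if j.val < i.val then 1 else 0)
      else if k.val + 1 = j.val then -(if k.val < i.val then 1 else 0) else 0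
  | Sum.inl k, Sum.inr i => if attachIndex N i = k.val then rayDirection i else 0
  | Sum.inr i, Sum.inl k => if attachIndex N i = k.val then -rayDirection i else 0
  | Sum.inr _, Sum.inr _ => 0

section
variable {N : ℕ}

theorem caterpillarGraph_adj_inl {j k : Fin N} :
    (caterpillarGraph N).Adj (Sum.inl j) (Sum.inl k) ↔ j.val + 1 = k.val ∨ k.val + 1 = j.val :=
  Iff.rfl

theorem caterpillarGraph_adj_inr {k : Fin N} {i : Fin (N + 2)} :
    (caterpillarGraph N).Adj (Sum.inl k) (Sum.inr i) ↔ attachIndex N i = k.val := Iff.rfl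

theorem attachIndex_lt (hN : 0 < N) (i : Fin (N + 2)) : attachIndex N i < N := by
  unfold attachIndex; split_ifs <;> omega

/-- The neighbours of the inner vertex `k`: the previous one, the one off the path, the next one. -/
def caterpillarNeighbor (k : Fin N) : Fin 3 → Fin N ⊕ Fin (N + 2) :=
  ![if k.val = 0 then Sum.inr (Fin.last _) else Sum.inl ⟨k.val - 1, by omega⟩,
    Sum.inr ⟨k.val, by omega⟩,
    if h : k.val + 1 < N then Sum.inl ⟨k.val + 1, h⟩ else Sum.inr ⟨N, by omega⟩]

theorem caterpillarNeighbor_injective (k : Fin N) :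
    Function.Injective (caterpillarNeighbor k) := by
  refine injective_triple ?_ ?_ ?_
  · split_ifs with h
    · intro h'
      have := congrArg Fin.val (Sum.inr_injective h')
      simp at this; omega
    · simp
  · split_ifs with h
    · simp
    · intro h'
      have := congrArg Fin.val (Sum.inr_injective h')
      simp at this; omega
  · split_ifs with h h' h'
    · simp
    · intro h''
      have := congrArg Fin.val (Sum.inr_injective h'')
      simp at this
    · intro h''
      have := congrArg Fin.val (Sum.inl_injective h'')
      simp at this
    · simp

theorem caterpillarGraph_neighborSet (k : Fin N) :
    (caterpillarGraph N).neighborSet (Sum.inl k) = Set.range (caterpillarNeighbor k) := by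
  have hk := k.2
  ext x
  simp only [Set.mem_range, Fin.exists_fin_succ, caterpillarNeighbor]
  simp only [SimpleGraph.mem_neighborSet, Matrix.cons_val_zero, Matrix.cons_val_succ,
    IsEmpty.exists_iff, or_false]
  rcases x with j | i
  · rw [caterpillarGraph_adj_inl]
    have hj := j.2
    constructor
    · rintro (h | h)
      · refine Or.inr (Or.inr ?_)
        rw [dif_pos (by omega)]
        congr 1; exact Fin.ext h
      · refine Or.inl ?_
        rw [if_neg (by omega)]
        congr 1; exact Fin.ext (by simp; omega)
    · rintro (h | h | h)
      · split_ifs at h with h0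
        have := congrArg Fin.val (Sum.inl_injective h)
        simp at this; omega
      · cases h
      · split_ifs at h with h0
        have := congrArg Fin.val (Sum.inl_injective h)
        simp at this; omega
  · rw [caterpillarGraph_adj_inr, attachIndex]
    have hi := i.2
    constructor
    · intro h
      split_ifs at h with h1 h2
      · refine Or.inr (Or.inl ?_)
        congr 1; exact Fin.ext h.symm
      · refine Or.inr (Or.inr ?_)
        rw [dif_neg (by omega)]
        congr 1; exact Fin.ext h2.symm
      · refine Or.inl ?_
        rw [if_pos h.symm]
        congr 1; exact Fin.ext (by simp; omega)
    · rintro (h | h | h)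
      · split_ifs at h with h0
        have := congrArg Fin.val (Sum.inr_injective h)
        simp at this
        rw [if_neg (by omega), if_neg (by omega), h0]
      · have := congrArg Fin.val (Sum.inr_injective h)
        simp at this
        rw [if_pos (by omega), this]
      · split_ifs at h with h0
        have := congrArg Fin.val (Sum.inr_injective h)
        simp at this
        rw [if_neg (by omega), if_pos (by omega)]; omega

theorem caterpillarGraph_ncard_inl (k : Fin N) :
    ((caterpillarGraph N).neighborSet (Sum.inl k)).ncard = 3 := by
  rw [caterpillarGraph_neighborSet, ← Set.image_univ,
    Set.ncard_image_of_injective _ (caterpillarNeighbor_injective k), Set.ncard_univ, Nat.card_fin]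

theorem caterpillarGraph_ncard_inr (hN : 0 < N) (i : Fin (N + 2)) :
    ((caterpillarGraph N).neighborSet (Sum.inr i)).ncard = 1 := by
  rw [Set.ncard_eq_one]
  refine ⟨Sum.inl ⟨attachIndex N i, attachIndex_lt hN i⟩, ?_⟩
  ext (k | j)
  · simp only [SimpleGraph.mem_neighborSet, Set.mem_singleton_iff, Sum.inl.injEq]
    rw [SimpleGraph.adj_comm, caterpillarGraph_adj_inr, Fin.ext_iff, eq_comm]
  · simp only [SimpleGraph.mem_neighborSet, Set.mem_singleton_iff, reduceCtorEq, iff_false]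
    exact id

theorem caterpillarGraph_exists_walk (j k : ℕ) (hj : j < N) (hjk : j + k < N) :
    ∃ p : (caterpillarGraph N).Walk (Sum.inl ⟨j, hj⟩) (Sum.inl ⟨j + k, hjk⟩), p.length = k := by
  induction k with
  | zero => exact ⟨.nil, rfl⟩
  | succ k ih =>
    obtain ⟨p, hp⟩ := ih (by omega)
    have hadj : (caterpillarGraph N).Adj (Sum.inl ⟨j + k, by omega⟩)
        (Sum.inl ⟨j + (k + 1), hjk⟩) := Or.inl (by simp; omega)
    exact ⟨p.concat hadj, by rw [SimpleGraph.Walk.length_concat, hp]⟩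

theorem caterpillarGraph_exists_walk_le (j k : Fin N) :
    ∃ p : (caterpillarGraph N).Walk (Sum.inl j) (Sum.inl k), p.length + 1 ≤ N := by
  wlog h : j ≤ k generalizing j k
  · obtain ⟨p, hp⟩ := this k j (by omega)
    exact ⟨p.reverse, by rwa [SimpleGraph.Walk.length_reverse]⟩
  · obtain ⟨d, hd⟩ := Nat.exists_eq_add_of_le (Fin.le_def.1 h)
    obtain ⟨p, hp⟩ := caterpillarGraph_exists_walk j.val d j.2 (by have := k.2; omega)
    have e : k = ⟨j.val + d, by have := k.2; omega⟩ := Fin.ext hd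
    rw [e]
    exact ⟨p, by have := k.2; omega⟩

theorem caterpillarGraph_exists_inl (hN : 0 < N) (x : Fin N ⊕ Fin (N + 2)) :
    ∃ k, ∃ p : (caterpillarGraph N).Walk x (Sum.inl k), p.length ≤ 1 := by
  rcases x with k | i
  · exact ⟨k, .nil, by simp⟩
  · have hadj : (caterpillarGraph N).Adj (Sum.inr i)
        (Sum.inl ⟨attachIndex N i, attachIndex_lt hN i⟩) := rfl
    exact ⟨_, .cons hadj .nil, by simp⟩

theorem caterpillarGraph_exists_walk_length_le (hN : 0 < N) (x y : Fin N ⊕ Fin (N + 2)) :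
    ∃ p : (caterpillarGraph N).Walk x y, p.length ≤ N + 1 := by
  obtain ⟨j, p, hp⟩ := caterpillarGraph_exists_inl hN x
  obtain ⟨k, q, hq⟩ := caterpillarGraph_exists_inl hN y
  obtain ⟨r, hr⟩ := caterpillarGraph_exists_walk_le j k
  refine ⟨(p.append r).append q.reverse, ?_⟩
  rw [SimpleGraph.Walk.length_append, SimpleGraph.Walk.length_append,
    SimpleGraph.Walk.length_reverse]
  omega

theorem caterpillarGraph_connected (hN : 0 < N) : (caterpillarGraph N).Connected :=
  have : Nonempty (Fin N ⊕ Fin (N + 2)) := ⟨Sum.inr 0⟩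
  ⟨fun x y => ⟨(caterpillarGraph_exists_walk_length_le hN x y).choose⟩⟩

open Classical in
theorem caterpillarGraph_isTree (hN : 0 < N) : (caterpillarGraph N).IsTree := by
  rw [SimpleGraph.isTree_iff_connected_and_card]
  refine ⟨caterpillarGraph_connected hN, ?_⟩
  have h1 := (caterpillarGraph N).sum_degrees_eq_twice_card_edges
  have hl : ∀ u, (caterpillarGraph N).degree (Sum.inl u) = 3 := fun u => by
    refine Eq.trans ?_ (caterpillarGraph_ncard_inl u)
    rw [← SimpleGraph.card_neighborSet_eq_degree, Set.ncard_eq_toFinset_card', Set.toFinset_card]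
  have hr : ∀ i, (caterpillarGraph N).degree (Sum.inr i) = 1 := fun i => by
    refine Eq.trans ?_ (caterpillarGraph_ncard_inr hN i)
    rw [← SimpleGraph.card_neighborSet_eq_degree, Set.ncard_eq_toFinset_card', Set.toFinset_card]
  rw [Fintype.sum_sum_type] at h1
  simp only [hl, hr, Finset.sum_const, Finset.card_univ, Fintype.card_fin, smul_eq_mul] at h1
  rw [Nat.card_eq_fintype_card, Nat.card_eq_fintype_card, Fintype.card_sum, Fintype.card_fin,
    Fintype.card_fin, ← SimpleGraph.edgeFinset_card]
  omega

/-- The position of a vertex along the path. -/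
def caterpillarHeight (N : ℕ) : Fin N ⊕ Fin (N + 2) → ℤ
  | Sum.inl k => k.val
  | Sum.inr i => if i.val < N then i.val else if i.val = N then N else -1

theorem caterpillarHeight_le (hN : 0 < N) {x y : Fin N ⊕ Fin (N + 2)} (p : (caterpillarGraph N).Walk x y) :
    caterpillarHeight N y ≤ caterpillarHeight N x + p.length := by
  induction p with
  | nil => simp
  | @cons x z y h p ih =>
    have hstep : caterpillarHeight N z ≤ caterpillarHeight N x + 1 := by
      have aux : ∀ (k : Fin N) (i : Fin (N + 2)), attachIndex N i = k.val →
          caterpillarHeight N (Sum.inr i) ≤ caterpillarHeight N (Sum.inl k) + 1 ∧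
            caterpillarHeight N (Sum.inl k) ≤ caterpillarHeight N (Sum.inr i) + 1 := by
        intro k i h
        unfold attachIndex at h
        simp only [caterpillarHeight]
        split_ifs at h ⊢ <;> omega
      rcases x with j | i <;> rcases z with k | i'
      · simp only [caterpillarHeight]
        rcases h with h | h <;> omega
      · exact (aux j i' h).1
      · exact (aux k i h).2
      · exact h.elim
    rw [SimpleGraph.Walk.length_cons]
    push_cast
    linarith

/-- `caterpillarHeight` changes by at most 1 along an edge and takes the values -1 and N at the two
extreme leaves. -/
theorem caterpillarGraph_diam (hN : 0 < N) : (caterpillarGraph N).diam = N + 1 := by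
  have : Nonempty (Fin N ⊕ Fin (N + 2)) := ⟨Sum.inr 0⟩
  have hconn := caterpillarGraph_connected hN
  apply le_antisymm
  · obtain ⟨x, y, hxy⟩ := (caterpillarGraph N).exists_dist_eq_diam
    obtain ⟨p, hp⟩ := caterpillarGraph_exists_walk_length_le hN x y
    rw [← hxy]
    exact (SimpleGraph.dist_le p).trans hp
  · have hle := SimpleGraph.dist_le_diam (SimpleGraph.connected_iff_ediam_ne_top.1 hconn)
      (u := Sum.inr (Fin.last (N + 1))) (v := Sum.inr ⟨N, by omega⟩)
    obtain ⟨p, hp⟩ := hconn.exists_walk_length_eq_dist (Sum.inr (Fin.last (N + 1)))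
      (Sum.inr ⟨N, by omega⟩)
    have := caterpillarHeight_le hN p
    simp [caterpillarHeight] at this
    omega

theorem caterpillarSlope_of_not_adj (x y : Fin N ⊕ Fin (N + 2))
    (h : ¬ (caterpillarGraph N).Adj x y) : caterpillarSlope N x y = 0 := by
  rcases x with j | i <;> rcases y with k | i'
  · rw [caterpillarGraph_adj_inl, not_or] at h
    ext l; simp [caterpillarSlope, h.1, h.2]
  · exact if_neg h
  · exact if_neg h
  · rfl

theorem caterpillarSlope_symm (x y : Fin N ⊕ Fin (N + 2)) :
    caterpillarSlope N y x = -caterpillarSlope N x y := by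
  rcases x with j | i <;> rcases y with k | i'
  · ext l
    simp only [caterpillarSlope, Pi.neg_apply]
    by_cases h1 : j.val + 1 = k.val
    · have h2 : ¬ k.val + 1 = j.val := by omega
      simp [h1, h2]
    · by_cases h2 : k.val + 1 = j.val <;> simp [h1, h2]
  · simp only [caterpillarSlope]; split_ifs <;> simp
  · simp only [caterpillarSlope]; split_ifs <;> simp
  · simp [caterpillarSlope]

theorem rayDirection_of_lt (i : Fin (N + 2)) (hi : i.val < N + 1) (l : Fin (N + 1)) :
    rayDirection i l = if l.val = i.val then 1 else 0 := by
  have e : i = Fin.castSucc ⟨i.val, hi⟩ := Fin.ext rfl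
  rw [e, rayDirection, Fin.lastCases_castSucc, Pi.single_apply]
  simp [Fin.ext_iff]

theorem rayDirection_last (l : Fin (N + 1)) : rayDirection (Fin.last (N + 1)) l = -1 := by
  rw [rayDirection, Fin.lastCases_last]

theorem caterpillarSlope_balanced (k : Fin N) :
    ∑ x, caterpillarSlope N (Sum.inl k) x = 0 := by
  classical
  have hk := k.2
  have hsupp : ∑ x, caterpillarSlope N (Sum.inl k) x =
      ∑ x ∈ Finset.univ.image (caterpillarNeighbor k), caterpillarSlope N (Sum.inl k) x := by
    symm
    refine Finset.sum_subset (Finset.subset_univ _) fun x _ hx => ?_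
    refine caterpillarSlope_of_not_adj _ _ fun hadj => hx ?_
    have : x ∈ (caterpillarGraph N).neighborSet (Sum.inl k) := hadj
    rw [caterpillarGraph_neighborSet] at this
    obtain ⟨κ, hκ⟩ := this
    exact Finset.mem_image.2 ⟨κ, Finset.mem_univ _, hκ⟩
  rw [hsupp, Finset.sum_image fun a _ b _ hab => caterpillarNeighbor_injective k hab,
    Fin.sum_univ_three]
  ext l
  have hl := l.2
  have e0 : caterpillarSlope N (Sum.inl k) (caterpillarNeighbor k 0) l =
      if k.val ≤ l.val then -1 else 0 := by
    by_cases h : k.val = 0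
    · simp [caterpillarNeighbor, caterpillarSlope, attachIndex, h, rayDirection_last]
    · have h1 : ¬ k.val + 1 = k.val - 1 := by omega
      have h2 : k.val - 1 + 1 = k.val := by omega
      have h3 : k.val - 1 < l.val ↔ k.val ≤ l.val := by omega
      simp [caterpillarNeighbor, caterpillarSlope, h, h1, h2, h3]
      split_ifs <;> rfl
  have e1 : caterpillarSlope N (Sum.inl k) (caterpillarNeighbor k 1) l =
      if l.val = k.val then 1 else 0 := by
    simp [caterpillarNeighbor, caterpillarSlope, attachIndex]
    rw [rayDirection_of_lt _ (by simp)]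
  have e2 : caterpillarSlope N (Sum.inl k) (caterpillarNeighbor k 2) l =
      if k.val < l.val then 1 else 0 := by
    by_cases h : k.val + 1 < N
    · simp [caterpillarNeighbor, caterpillarSlope, h]
    · have h1 : N - 1 = k.val := by omega
      simp [caterpillarNeighbor, caterpillarSlope, h, attachIndex, h1]
      rw [rayDirection_of_lt _ (by simp)]
      simp only
      have : l.val = N ↔ k.val < l.val := by omega
      simp [this]
  simp only [Pi.add_apply, Pi.zero_apply, e0, e1, e2]
  split_ifs <;> omega

/-- The positions of the inner vertices of the caterpillar line. -/
def caterpillarPos (N : ℕ) (k : ℕ) : Fin (N + 1) → ℝ := fun i => ((min i.val k : ℕ) : ℝ)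

theorem caterpillarPos_succ {k : Fin N} {j : Fin N} (h : k.val + 1 = j.val) :
    caterpillarPos N j.val = caterpillarPos N k.val +
      (1 : ℝ) • fun i => (caterpillarSlope N (Sum.inl k) (Sum.inl j) i : ℝ) := by
  ext i
  simp only [caterpillarPos, caterpillarSlope, h, if_true, one_smul, Pi.add_apply]
  split_ifs with hi
  · rw [min_eq_right (by omega), min_eq_right (by omega), ← h]; push_cast; ring
  · rw [min_eq_left (by omega), min_eq_left (by omega)]; simp

/-- A caterpillar line in `ℝ^(N + 1)`. -/
def caterpillarLine (N : ℕ) (hN : 0 < N) : TropicalLine (N + 1) (Fin N) where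
  graph := caterpillarGraph N
  isTree := caterpillarGraph_isTree hN
  trivalent := caterpillarGraph_ncard_inl
  leaf := caterpillarGraph_ncard_inr hN
  pos k := caterpillarPos N k.val
  slope := caterpillarSlope N
  slope_of_not_adj := caterpillarSlope_of_not_adj
  slope_symm := caterpillarSlope_symm
  slope_ray u i h := if_pos h
  balanced := caterpillarSlope_balanced
  bounded_edge u w h := by
    refine ⟨1, one_pos, ?_⟩
    rcases h with h | h
    · exact caterpillarPos_succ h
    · have := caterpillarPos_succ h
      rw [this, caterpillarSlope_symm (Sum.inl u) (Sum.inl w)]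
      ext i; simp
end

/-! ### The caterpillar line as a tropical variety -/

section
variable {N : ℕ}

/-- The points of the caterpillar line on the path between its last two half-rays. -/
noncomputable def spinePoint (N : ℕ) (σ : ℝ) : Fin (N + 1) → ℝ :=
  fun i => if i.val < N then min (i.val : ℝ) σ else σ

open HahnSeries in
/-- A point of the line over the Hahn series whose tropicalization is the caterpillar line. -/
noncomputable def caterpillarBase (N : ℕ) : Fin (N + 1) → HahnSeries ℝ ℚ :=
  fun i => if i.val < N then single (i.val : ℝ) 1 else 0

open HahnSeries in
-- This is the valuation of the point of the line with parameter t = T^σ.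
theorem spinePoint_mem_tropicalVariety (σ : ℝ) :
    spinePoint N σ ∈ tropicalVariety (addVal ℝ ℚ) (lineIdeal (caterpillarBase N) fun _ => 1) := by
  refine mem_tropicalVariety_lineIdeal _ (single σ 1) fun i => ?_
  rw [one_mul]
  unfold spinePoint caterpillarBase
  split_ifs with h
  · exact addVal_single_add_single _ _
  · rw [zero_add, addVal_apply, orderTop_single one_ne_zero]

open HahnSeries in
-- The parameter 2 T^(k + t) - T^k cancels the term T^k in the coordinate k and raises its valuation
-- to k + t. The other coordinates only see the valuation k of the parameter.
theorem side_mem_tropicalVariety (k : Fin N) {t : ℝ} (ht : 0 ≤ t) :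
    (caterpillarPos N k.val + t • fun i : Fin (N + 1) => if i.val = k.val then (1 : ℝ) else 0) ∈
      tropicalVariety (addVal ℝ ℚ) (lineIdeal (caterpillarBase N) fun _ => 1) := by
  have hk := k.2
  refine mem_tropicalVariety_lineIdeal _ (single (k.val + t) 2 - single (k.val : ℝ) 1) fun i => ?_
  rw [one_mul]
  simp only [Pi.add_apply, Pi.smul_apply, smul_eq_mul, caterpillarPos, caterpillarBase]
  have hle : (k.val : ℝ) ≤ k.val + t := by linarith
  by_cases hik : i.val = k.val
  · rw [if_pos (by omega), if_pos hik, hik, add_sub_cancel, addVal_apply,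
      orderTop_single two_ne_zero]
    simp
  · rw [if_neg hik, mul_zero, add_zero]
    split_ifs with h
    · rw [addVal_single_add_single_sub_single hle (by exact_mod_cast hik)]
      push_cast; rfl
    · rw [zero_add, addVal_single_sub_single hle, min_eq_right (by omega)]

theorem caterpillarPos_eq_spinePoint {k : ℕ} (hk : k < N) :
    caterpillarPos N k = spinePoint N k := by
  ext i
  unfold caterpillarPos spinePoint
  split_ifs with h
  · push_cast; rfl
  · rw [min_eq_right (by omega)]

theorem caterpillarPos_add_smul {k : ℕ} (hk : k + 1 < N) {θ : ℝ} (h0 : 0 ≤ θ) (h1 : θ ≤ 1) :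
    caterpillarPos N k + θ • (caterpillarPos N (k + 1) - caterpillarPos N k) =
      spinePoint N (k + θ) := by
  ext i
  simp only [Pi.add_apply, Pi.smul_apply, Pi.sub_apply, smul_eq_mul, caterpillarPos, spinePoint]
  have hi := i.2
  rcases Nat.lt_or_ge k i.val with h | h
  · have h' : (k : ℝ) + 1 ≤ i.val := by exact_mod_cast h
    have e : (if i.val < N then min (i.val : ℝ) (k + θ) else k + θ) = k + θ := by
      split_ifs
      · rw [min_eq_right (by linarith)]
      · rfl
    rw [e, min_eq_right (by omega), min_eq_right (by omega)]
    push_cast; ring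
  · have h' : (i.val : ℝ) ≤ k := by exact_mod_cast h
    rw [if_pos (by omega), min_eq_left (by omega), min_eq_left (by omega),
      min_eq_left (by linarith)]
    ring

theorem first_ray_eq_spinePoint {t : ℝ} (ht : 0 ≤ t) :
    (caterpillarPos N 0 + t • fun i => ((rayDirection (Fin.last (N + 1)) i : ℤ) : ℝ)) =
      spinePoint N (-t) := by
  ext i
  simp only [Pi.add_apply, Pi.smul_apply, smul_eq_mul, caterpillarPos, spinePoint, rayDirection_last]
  have : min (i.val : ℝ) (-t) = -t := min_eq_right (by have := i.val.cast_nonneg (α := ℝ); linarith)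
  rw [this]
  simp

theorem last_ray_eq_spinePoint (hN : 0 < N) {t : ℝ} (ht : 0 ≤ t) :
    (caterpillarPos N (N - 1) + t • fun i => ((rayDirection (⟨N, by omega⟩ : Fin (N + 2)) i : ℤ) : ℝ)) =
      spinePoint N ((N - 1 : ℕ) + t) := by
  ext i
  simp only [Pi.add_apply, Pi.smul_apply, smul_eq_mul, caterpillarPos, spinePoint]
  rw [rayDirection_of_lt _ (by simp)]
  have hi := i.2
  simp only
  by_cases h : i.val < N
  · have h' : (i.val : ℝ) ≤ (N - 1 : ℕ) := by exact_mod_cast (by omega)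
    rw [if_neg (by omega), if_pos h, min_eq_left (by omega), min_eq_left (by linarith)]
    simp
  · rw [if_pos (by omega), if_neg h, min_eq_right (by omega)]
    simp

theorem side_ray_eq (k : Fin N) (t : ℝ) :
    (caterpillarPos N k.val + t • fun i => ((rayDirection (⟨k.val, by omega⟩ : Fin (N + 2)) i : ℤ) : ℝ)) =
      caterpillarPos N k.val + t • fun i : Fin (N + 1) => if i.val = k.val then (1 : ℝ) else 0 := by
  ext i
  simp only [Pi.add_apply, Pi.smul_apply]
  rw [rayDirection_of_lt _ (by simp)]
  split_ifs <;> simp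

variable (hN : 0 < N)

open HahnSeries in
theorem support_caterpillarLine_subset : (caterpillarLine N hN).support ⊆
    tropicalVariety (addVal ℝ ℚ) (lineIdeal (caterpillarBase N) fun _ => 1) := by
  rintro x ⟨F, hF, hx⟩
  cases hF with
  | vertex u =>
    rw [Set.mem_singleton_iff] at hx
    rw [hx]
    show caterpillarPos N u.val ∈ _
    rw [caterpillarPos_eq_spinePoint u.2]
    exact spinePoint_mem_tropicalVariety _
  | boundedEdge u w h =>
    have key : ∀ u w : Fin N, u.val + 1 = w.val →
        x ∈ segment ℝ (caterpillarPos N u.val) (caterpillarPos N w.val) →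
        x ∈ tropicalVariety (addVal ℝ ℚ) (lineIdeal (caterpillarBase N) fun _ => 1) := by
      intro u w huw hx
      rw [segment_eq_image', ← huw] at hx
      obtain ⟨θ, ⟨h0, h1⟩, rfl⟩ := hx
      simp only
      rw [caterpillarPos_add_smul (by have := w.2; omega) h0 h1]
      exact spinePoint_mem_tropicalVariety _
    rcases h with h | h
    · exact key u w h hx
    · exact key w u h (by rw [segment_symm]; exact hx)
  | ray u i h =>
    obtain ⟨t, ht, rfl⟩ := hx
    have hatt : attachIndex N i = u.val := h
    show (caterpillarPos N u.val + t • fun l => ((rayDirection i l : ℤ) : ℝ)) ∈ _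
    rw [← hatt]
    unfold attachIndex at hatt ⊢
    split_ifs at hatt ⊢ with h1 h2
    · have := side_ray_eq ⟨i.val, h1⟩ t
      simp only [Fin.eta] at this
      rw [this]
      exact side_mem_tropicalVariety ⟨i.val, h1⟩ ht
    · have e : i = ⟨N, by omega⟩ := Fin.ext h2
      rw [e, last_ray_eq_spinePoint hN ht]
      exact spinePoint_mem_tropicalVariety _
    · have e : i = Fin.last (N + 1) := Fin.ext (by have := i.2; simp; omega)
      rw [e, first_ray_eq_spinePoint ht]
      exact spinePoint_mem_tropicalVariety _

theorem mem_support_ray (i : Fin (N + 2)) {t : ℝ} (ht : 0 ≤ t) :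
    (caterpillarPos N (attachIndex N i) + t • fun l => ((rayDirection i l : ℤ) : ℝ)) ∈
      (caterpillarLine N hN).support :=
  ⟨_, TropicalLine.IsFace.ray (⟨attachIndex N i, attachIndex_lt hN i⟩ : Fin N) i rfl, t, ht, rfl⟩

theorem spinePoint_mem_support (σ : ℝ) : spinePoint N σ ∈ (caterpillarLine N hN).support := by
  rcases le_or_gt σ 0 with h | h
  · have := mem_support_ray hN (Fin.last (N + 1)) (t := -σ) (by linarith)
    rwa [show attachIndex N (Fin.last (N + 1)) = 0 by simp [attachIndex],
      first_ray_eq_spinePoint (by linarith), neg_neg] at this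
  rcases le_or_gt ((N - 1 : ℕ) : ℝ) σ with h' | h'
  · have := mem_support_ray hN ⟨N, by omega⟩ (t := σ - (N - 1 : ℕ)) (by linarith)
    rwa [show attachIndex N ⟨N, by omega⟩ = N - 1 by simp [attachIndex],
      last_ray_eq_spinePoint hN (by linarith), add_sub_cancel] at this
  · have h1 := Nat.floor_le h.le
    have h2 := Nat.lt_floor_add_one σ
    have h3 : ⌊σ⌋₊ < N - 1 := by exact_mod_cast h1.trans_lt h'
    refine ⟨_, TropicalLine.IsFace.boundedEdge (⟨⌊σ⌋₊, by omega⟩ : Fin N) ⟨⌊σ⌋₊ + 1, by omega⟩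
      (Or.inl rfl), ?_⟩
    show _ ∈ segment ℝ (caterpillarPos N ⌊σ⌋₊) (caterpillarPos N (⌊σ⌋₊ + 1))
    rw [segment_eq_image']
    refine ⟨σ - ⌊σ⌋₊, ⟨by linarith, by linarith⟩, ?_⟩
    simp only
    rw [caterpillarPos_add_smul (by omega) (by linarith) (by linarith), add_sub_cancel]

-- The linear polynomials x_i - x_N - T^i suffice. Each of them forces w i = min i σ or σ = i < w i,
-- where σ is the last coordinate of w. The second alternative holds for at most one i, and then w
-- lies on the half-ray with this label.
open HahnSeries in
theorem tropicalVariety_subset_support :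
    tropicalVariety (addVal ℝ ℚ) (lineIdeal (caterpillarBase N) fun _ => 1) ⊆
      (caterpillarLine N hN).support := by
  intro w hw
  set σ := w (Fin.last N) with hσ
  have htwice : ∀ i : Fin (N + 1), i.val < N → w i = min (i.val : ℝ) σ ∨ (σ = i.val ∧ σ < w i) := by
    intro i hi
    have hv : addVal ℝ ℚ (caterpillarBase N i - caterpillarBase N (Fin.last N)) =
        ((i.val : ℝ) : WithTop ℝ) := by
      simp [caterpillarBase, hi]
    have hne : i ≠ Fin.last N := by
      rintro rfl; simp at hi
    rcases min_attained_twice _ hw hne rfl hv with ⟨h1, h2⟩ | ⟨h1, h2⟩ | ⟨h1, h2⟩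
    · left; rw [min_eq_right (by rw [hσ, ← h1]; exact h2), h1]
    · left; rw [min_eq_left h2, h1]
    · rcases h2.eq_or_lt with h | h
      · left; rw [min_eq_left (by rw [hσ, h1]), h]
      · right; exact ⟨h1, by rw [hσ, h1]; exact h⟩
  by_cases hall : ∀ i : Fin (N + 1), i.val < N → w i = min (i.val : ℝ) σ
  · have e : w = spinePoint N σ := by
      ext i
      unfold spinePoint
      split_ifs with h
      · exact hall i h
      · rw [hσ]; congr 1; exact Fin.ext (by have := i.2; simp; omega)
    rw [e]
    exact spinePoint_mem_support hN σ
  · push Not at hall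
    obtain ⟨k, hk, hne⟩ := hall
    obtain ⟨h1, h2⟩ := (htwice k hk).resolve_left hne
    have hside := mem_support_ray hN ⟨k.val, by omega⟩ (t := w k - k.val) (by linarith)
    have e : attachIndex N ⟨k.val, by omega⟩ = k.val := by simp [attachIndex, hk]
    rw [e, side_ray_eq ⟨k.val, hk⟩] at hside
    convert hside using 1
    ext i
    simp only [Pi.add_apply, Pi.smul_apply, smul_eq_mul, caterpillarPos]
    by_cases hik : i.val = k.val
    · rw [if_pos hik, hik, min_self, show i = k from Fin.ext hik]; ring
    · rw [if_neg hik, mul_zero, add_zero]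
      by_cases hi : i.val < N
      · rcases htwice i hi with h | ⟨h, -⟩
        · rw [h, h1]; push_cast; rfl
        · exact absurd (by exact_mod_cast h.symm.trans h1) hik
      · have : i = Fin.last N := Fin.ext (by have := i.2; simp; omega)
        rw [this, ← hσ, h1, min_eq_right (by simp; omega)]

theorem isTropicalization_caterpillarLine : (caterpillarLine N hN).IsTropicalization :=
  ⟨HahnSeries ℝ ℚ, inferInstance, HahnSeries.addVal ℝ ℚ, caterpillarBase N, fun _ => 1,
    fun h => one_ne_zero (congrFun h 0),
    (support_caterpillarLine_subset hN).antisymm (tropicalVariety_subset_support hN)⟩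

theorem isCaterpillar_caterpillarLine : (caterpillarLine N hN).IsCaterpillar :=
  caterpillarGraph_diam hN
end

/-! ### A projection with many self-intersections -/

section
variable {N : ℕ}

/-- The function x ↦ (x - l) * min l x is convex and continuously differentiable: a parabola up to
l, continued by its tangent there. The factor of x - j is its derivative at j. -/
theorem mul_min_tangent (l j x : ℝ) : (j - l) * min l j + (if j < l then 2 * j - l else l) * (x - j) ≤
    (x - l) * min l x := by
  split_ifs with h
  · rw [min_eq_right h.le]
    rcases le_total l x with h' | h'
    · rw [min_eq_left h']; nlinarith [mul_nonneg (sub_nonneg.2 h.le) (sub_nonneg.2 h')]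
    · rw [min_eq_right h']; nlinarith [sq_nonneg (x - j)]
  · rw [min_eq_left (not_lt.1 h)]
    rcases le_total l x with h' | h'
    · rw [min_eq_left h']; nlinarith
    · rw [min_eq_right h']; nlinarith [sq_nonneg (x - l)]

theorem mul_min_tangent_lt {l j x : ℝ} (hj : j < l) (hx : x < j) :
    (j - l) * min l j + (if j < l then 2 * j - l else l) * (x - j) < (x - l) * min l x := by
  rw [if_pos hj, min_eq_right hj.le, min_eq_right (hx.trans hj).le]
  nlinarith [mul_pos (sub_pos.2 hx) (sub_pos.2 hx)]

/-- The image of the half-ray at the vertex `x` lies in the line `p 0 + x * p 1 = rayOffset N x`. -/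
noncomputable def rayOffset (N : ℕ) (x : ℝ) : ℝ :=
  (2 * N ^ 2 + 1) * x + ∑ l : Fin N, (x - l.val) * min (l.val : ℝ) x

/-- The derivative of `rayOffset N` at j. -/
noncomputable def rayOffsetSlope (N : ℕ) (j : ℝ) : ℝ :=
  (2 * N ^ 2 + 1) + ∑ l : Fin N, (if j < l.val then 2 * j - l.val else (l.val : ℝ))

theorem rayOffset_tangent (j x : ℝ) :
    rayOffset N j + rayOffsetSlope N j * (x - j) ≤ rayOffset N x := by
  have h := Finset.sum_le_sum fun (l : Fin N) (_ : l ∈ Finset.univ) => mul_min_tangent (l.val : ℝ) j x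
  rw [Finset.sum_add_distrib, ← Finset.sum_mul] at h
  unfold rayOffset rayOffsetSlope
  linarith

/-- To the left of m the summand of m is a proper parabola, which makes the inequality strict. -/
theorem rayOffset_tangent_lt {j x : ℝ} {m : Fin N} (hj : j < m.val) (hx : x < j) :
    rayOffset N j + rayOffsetSlope N j * (x - j) < rayOffset N x := by
  have h := Finset.sum_lt_sum (fun (l : Fin N) (_ : l ∈ Finset.univ) =>
    mul_min_tangent (l.val : ℝ) j x) ⟨m, Finset.mem_univ _, mul_min_tangent_lt hj hx⟩
  rw [Finset.sum_add_distrib, ← Finset.sum_mul] at h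
  unfold rayOffset rayOffsetSlope
  linarith

/-- Each of the N summands is at least -N, so of 2 * N ^ 2 + 1 more than N ^ 2 is left. This is the
purpose of the last column of the projection. -/
theorem lt_rayOffsetSlope {j : ℝ} (hj : 0 ≤ j) : (N : ℝ) ^ 2 < rayOffsetSlope N j := by
  have h : ∑ l : Fin N, -(N : ℝ) ≤
      ∑ l : Fin N, (if j < l.val then 2 * j - l.val else (l.val : ℝ)) := by
    refine Finset.sum_le_sum fun l _ => ?_
    have h1 : (l.val : ℝ) ≤ N := by exact_mod_cast l.2.le
    have h2 : (0 : ℝ) ≤ l.val := l.val.cast_nonneg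
    split_ifs <;> linarith
  rw [Finset.sum_const, Finset.card_univ, Fintype.card_fin, nsmul_eq_mul] at h
  unfold rayOffsetSlope
  nlinarith

/-- No three of the lines containing images of half-rays are concurrent. -/
theorem not_concurrent {x y : ℝ} {a b c : ℕ} (hab : a < b) (hbc : b < c) (hc : c < N)
    (ha : x + a * y = rayOffset N a) (hb : x + b * y = rayOffset N b)
    (hc' : x + c * y = rayOffset N c) : False := by
  -- A common point (x, y) would put the points (k, `rayOffset N k`), k = a, b, c, on a line of
  -- slope y. The tangent at b lies strictly below the graph at a and not above it at c.
  have h1 := rayOffset_tangent_lt (m := ⟨c, hc⟩) (j := b) (x := a) (by exact_mod_cast hbc)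
    (by exact_mod_cast hab)
  have h2 := rayOffset_tangent (N := N) b c
  have hab' : (a : ℝ) < b := by exact_mod_cast hab
  have hbc' : (b : ℝ) < c := by exact_mod_cast hbc
  nlinarith

/-- The projection of the caterpillar line. -/
def caterpillarProjection (N : ℕ) : Matrix (Fin 2) (Fin (N + 1)) ℚ :=
  Matrix.of ![fun i => if i.val < N then -(i.val : ℚ) else 2 * N ^ 2 + 1,
    fun i => if i.val < N then 1 else 0]

theorem rank_caterpillarProjection (hN : 0 < N) : (caterpillarProjection N).rank = 2 := by
  have hli : LinearIndependent ℚ (caterpillarProjection N).row := by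
    have e : (caterpillarProjection N).row = ![(caterpillarProjection N) 0,
        (caterpillarProjection N) 1] := by
      ext i j; fin_cases i <;> rfl
    rw [e, LinearIndependent.pair_iff]
    intro s t h
    have h0 := congrFun h 0
    have hl := congrFun h (Fin.last N)
    simp [caterpillarProjection, hN] at h0 hl
    refine ⟨hl.resolve_right ?_, h0⟩
    positivity
  have := hli.rank_matrix
  rwa [Fintype.card_fin] at this

/-- The half-ray at k has the image direction (-k, 1), so p 0 + k * p 1 is constant on it and p 1
serves as parameter. -/
theorem rationalMap_side_ray {k : ℕ} (hk : k < N) (t : ℝ) :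
    rationalMap (caterpillarProjection N) (caterpillarPos N k +
      t • fun i : Fin (N + 1) => if i.val = k then (1 : ℝ) else 0) =
      ![rayOffset N k - k * (∑ l : Fin N, min (l.val : ℝ) k + t),
        ∑ l : Fin N, min (l.val : ℝ) k + t] := by
  have hsum : ∀ f : Fin N → ℝ, ∑ l : Fin N, f l * (if l.val = k then (1 : ℝ) else 0) = f ⟨k, hk⟩ := by
    intro f
    rw [Finset.sum_eq_single (⟨k, hk⟩ : Fin N)]
    · simp
    · intro l _ hl
      rw [if_neg (fun h => hl (Fin.ext h)), mul_zero]
    · simp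
  ext r
  fin_cases r
  · simp only [rationalMap, Matrix.mulVec, dotProduct, caterpillarProjection, Matrix.map_apply,
      Matrix.of_apply, Fin.zero_eta, Matrix.cons_val_zero, Pi.add_apply, Pi.smul_apply,
      smul_eq_mul, caterpillarPos, rayOffset]
    rw [Fin.sum_univ_castSucc]
    simp only [Fin.val_castSucc, Fin.is_lt, if_true, Fin.val_last, lt_irrefl, if_false,
      hk.ne', min_eq_right hk.le]
    have e : ∀ l : Fin N, ((-(l.val : ℚ) : ℚ) : ℝ) * (((min l.val k : ℕ) : ℝ) +
        t * if l.val = k then (1 : ℝ) else 0) =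
        ((k : ℝ) - l.val) * min (l.val : ℝ) k - k * min (l.val : ℝ) k +
          (-(l.val : ℝ) * t) * (if l.val = k then (1 : ℝ) else 0) := by
      intro l; push_cast; ring
    rw [Finset.sum_congr rfl fun l _ => e l, Finset.sum_add_distrib, Finset.sum_sub_distrib,
      hsum fun l => -(l.val : ℝ) * t, ← Finset.mul_sum]
    push_cast
    ring
  · simp only [rationalMap, Matrix.mulVec, dotProduct, caterpillarProjection, Matrix.map_apply,
      Matrix.of_apply, Fin.mk_one, Matrix.cons_val_one, Matrix.cons_val_zero, Pi.add_apply, Pi.smul_apply,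
      smul_eq_mul, caterpillarPos]
    rw [Fin.sum_univ_castSucc]
    simp only [Fin.val_castSucc, Fin.is_lt, if_true, Fin.val_last, lt_irrefl, if_false]
    have e : ∀ l : Fin N, ((1 : ℚ) : ℝ) * (((min l.val k : ℕ) : ℝ) +
        t * if l.val = k then (1 : ℝ) else 0) =
        min (l.val : ℝ) k + t * (if l.val = k then (1 : ℝ) else 0) := by
      intro l; push_cast; ring
    rw [Finset.sum_congr rfl fun l _ => e l, Finset.sum_add_distrib, hsum fun _ => t]
    simp

theorem mem_image_side_ray {k : ℕ} (hk : k < N) {p : Fin 2 → ℝ} :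
    p ∈ rationalMap (caterpillarProjection N) '' {x | ∃ t : ℝ, 0 ≤ t ∧ x = caterpillarPos N k +
      t • fun i : Fin (N + 1) => if i.val = k then (1 : ℝ) else 0} ↔
      p 0 + k * p 1 = rayOffset N k ∧ ∑ l : Fin N, min (l.val : ℝ) k ≤ p 1 := by
  constructor
  · rintro ⟨_, ⟨t, ht, rfl⟩, rfl⟩
    rw [rationalMap_side_ray hk]
    simp only [Matrix.cons_val_zero, Matrix.cons_val_one]
    exact ⟨by ring, by linarith⟩
  · rintro ⟨h1, h2⟩
    refine ⟨_, ⟨p 1 - ∑ l : Fin N, min (l.val : ℝ) k, by linarith, rfl⟩, ?_⟩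
    rw [rationalMap_side_ray hk]
    ext r
    fin_cases r
    · simp only [Fin.zero_eta, Matrix.cons_val_zero]; linarith
    · simp

/-- The intersection point of the images of the half-rays at the vertices `i` and `j`. -/
noncomputable def crossingPoint (N i j : ℕ) : Fin 2 → ℝ :=
  ![rayOffset N i - i * ((rayOffset N j - rayOffset N i) / (j - i)),
    (rayOffset N j - rayOffset N i) / (j - i)]

theorem crossingPoint_left (i j : ℕ) :
    crossingPoint N i j 0 + i * crossingPoint N i j 1 = rayOffset N i := by
  simp [crossingPoint]

theorem crossingPoint_right {i j : ℕ} (h : i < j) :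
    crossingPoint N i j 0 + j * crossingPoint N i j 1 = rayOffset N j := by
  have : (j : ℝ) - i ≠ 0 := sub_ne_zero.2 (by exact_mod_cast h.ne')
  simp only [crossingPoint, Matrix.cons_val_zero, Matrix.cons_val_one]
  field_simp
  ring

/-- The images of the half-rays start at heights of at most N ^ 2. The lines i and j meet at the
height of the secant slope of `rayOffset N`, which by convexity is at least the tangent slope at i
and thus exceeds N ^ 2. -/
theorem sum_min_le_crossingPoint {i j : ℕ} (h : i < j) (k : ℝ) :
    ∑ l : Fin N, min (l.val : ℝ) k ≤ crossingPoint N i j 1 := by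
  have h1 : ∑ l : Fin N, min (l.val : ℝ) k ≤ ∑ l : Fin N, (N : ℝ) :=
    Finset.sum_le_sum fun l _ => (min_le_left _ _).trans (by exact_mod_cast l.2.le)
  rw [Finset.sum_const, Finset.card_univ, Fintype.card_fin, nsmul_eq_mul] at h1
  have hij : (0 : ℝ) < j - i := sub_pos.2 (by exact_mod_cast h)
  have h2 := rayOffset_tangent (N := N) i j
  have h3 := lt_rayOffsetSlope (N := N) (j := i) i.cast_nonneg
  refine h1.trans ?_
  simp only [crossingPoint, Matrix.cons_val_one, Matrix.cons_val_zero]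
  rw [le_div_iff₀ hij]
  nlinarith

theorem halfRay_caterpillarLine (hN : 0 < N) (k : Fin N) :
    (caterpillarLine N hN).halfRay k ⟨k.val, by omega⟩ = {x | ∃ t : ℝ, 0 ≤ t ∧
      x = caterpillarPos N k.val + t • fun i : Fin (N + 1) => if i.val = k.val then (1 : ℝ) else 0} := by
  ext x
  refine exists_congr fun t => and_congr_right fun _ => ?_
  rw [← side_ray_eq]
  rfl

theorem crossingPoint_mem (hN : 0 < N) {i j : ℕ} (hij : i < j) (hj : j < N) :
    crossingPoint N i j ∈
      (caterpillarLine N hN).selfIntersectionPoints (caterpillarProjection N) := by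
  have hi : i < N := hij.trans hj
  have hface : ∀ k (hk : k < N), (caterpillarLine N hN).IsFace {x | ∃ t : ℝ, 0 ≤ t ∧
      x = caterpillarPos N k + t • fun i : Fin (N + 1) => if i.val = k then (1 : ℝ) else 0} := by
    intro k hk
    rw [← halfRay_caterpillarLine hN ⟨k, hk⟩]
    refine TropicalLine.IsFace.ray _ _ ?_
    show attachIndex N _ = k
    simp [attachIndex, hk]
  refine ⟨_, _, hface i hi, hface j hj, ?_, ?_⟩
  -- The last coordinate has the constant values i and j on the two half-rays.
  · rw [Set.disjoint_left]
    rintro _ ⟨t, -, rfl⟩ ⟨t', -, h⟩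
    have := congrFun h (Fin.last N)
    simp [caterpillarPos, hi.ne', hj.ne', hi.le, hj.le] at this
    omega
  · ext p
    rw [Set.mem_inter_iff, mem_image_side_ray hi, mem_image_side_ray hj, Set.mem_singleton_iff]
    constructor
    · rintro ⟨⟨h1, -⟩, h2, -⟩
      have h3 := crossingPoint_left (N := N) i j
      have h4 := crossingPoint_right (N := N) hij
      have hne : (j : ℝ) - i ≠ 0 := sub_ne_zero.2 (by exact_mod_cast hij.ne')
      have h5 : p 1 = crossingPoint N i j 1 := by
        have : ((j : ℝ) - i) * (p 1 - crossingPoint N i j 1) = 0 := by linarith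
        exact sub_eq_zero.1 ((mul_eq_zero.1 this).resolve_left hne)
      ext r
      fin_cases r
      · show p 0 = crossingPoint N i j 0
        rw [h5] at h1; linarith
      · exact h5
    · rintro rfl
      exact ⟨⟨crossingPoint_left i j, sum_min_le_crossingPoint hij i⟩, crossingPoint_right hij,
        sum_min_le_crossingPoint hij j⟩

/-- Two different pairs involve at least three of the lines, which have no common point. -/
theorem crossingPoint_injOn : Set.InjOn (fun x : Σ _ : ℕ, ℕ => crossingPoint N x.2 x.1)
    ((Finset.range N).sigma fun j => Finset.range j : Finset (Σ _ : ℕ, ℕ)) := by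
  rintro ⟨j, i⟩ hij ⟨l, k⟩ hkl h
  simp only [Finset.coe_sigma, Set.mem_sigma_iff, Finset.coe_range, Set.mem_Iio] at hij hkl h
  have h1 := crossingPoint_left (N := N) i j
  have h2 := crossingPoint_right (N := N) hij.2
  have h3 := crossingPoint_left (N := N) k l
  have h4 := crossingPoint_right (N := N) hkl.2
  rw [← h] at h3 h4
  have e : i = k := by
    rcases lt_trichotomy i k with hlt | heq | hlt
    · exact (not_concurrent hlt hkl.2 hkl.1 h1 h3 h4).elim
    · exact heq
    · exact (not_concurrent hlt hij.2 hij.1 h3 h1 h2).elim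
  have e' : j = l := by
    rcases lt_trichotomy j l with hlt | heq | hlt
    · exact (not_concurrent hij.2 hlt hkl.1 h1 h2 h4).elim
    · exact heq
    · exact (not_concurrent hkl.2 hlt hij.1 h3 h4 h2).elim
  rw [e, e']

theorem choose_le_encard_selfIntersectionPoints (hN : 0 < N) : ((N.choose 2 : ℕ) : ℕ∞) ≤
    ((caterpillarLine N hN).selfIntersectionPoints (caterpillarProjection N)).encard := by
  have hcard : ((Finset.range N).sigma fun j => Finset.range j).card = N.choose 2 := by
    rw [Finset.card_sigma]
    simp only [Finset.card_range]
    rw [Finset.sum_range_id, Nat.choose_two_right]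
  rw [← hcard, ← Set.encard_coe_eq_coe_finsetCard, ← (crossingPoint_injOn (N := N)).encard_image]
  refine Set.encard_le_encard ?_
  rintro _ ⟨⟨j, i⟩, hx, rfl⟩
  simp only [Finset.coe_sigma, Set.mem_sigma_iff, Finset.coe_range, Set.mem_Iio] at hx
  exact crossingPoint_mem hN hx.2 hx.1

end

theorem theorem5p4 (n : ℕ) (hn : 2 ≤ n) :
    (∀ {V : Type*} [Fintype V] (L : TropicalLine n V), L.IsCaterpillar →
      ∀ A : Matrix (Fin 2) (Fin n) ℚ, A.rank = 2 →
        (L.selfIntersectionPoints A).encard ≤ ((n - 1).choose 2 : ℕ)) ∧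
    (∃ (V : Type) (_ : Fintype V) (L : TropicalLine n V) (A : Matrix (Fin 2) (Fin n) ℚ),
      L.IsTropicalization ∧ L.IsCaterpillar ∧ A.rank = 2 ∧
        (L.selfIntersectionPoints A).encard = ((n - 1).choose 2 : ℕ)) := by
  refine ⟨fun L hL A hA => TropicalLine.encard_selfIntersectionPoints_le hn hL hA, ?_⟩
  obtain ⟨N, rfl⟩ : ∃ N, n = N + 1 := ⟨n - 1, by omega⟩
  have hN : 0 < N := by omega
  have hcat := isCaterpillar_caterpillarLine hN
  have hrank := rank_caterpillarProjection hN
  exact ⟨Fin N, inferInstance, caterpillarLine N hN, caterpillarProjection N,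
    isTropicalization_caterpillarLine hN, hcat, hrank,
    (TropicalLine.encard_selfIntersectionPoints_le hn hcat hrank).antisymm
      (choose_le_encard_selfIntersectionPoints hN)⟩
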